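/- Let $\mathcal A=\{1,\dots,m\}$ and let $\zeta:\mathcal A\to\mathcal A^+$ be a substitution (every letter is sent to a non-empty finite word), extended to words by concatenation, with substitution matrix $\mathsf S(i,j)=$ number of symbols $i$ in $\zeta(j)$. Let $X_\zeta\subset\mathcal A^{\mathbb Z}$ be the set of all $x$ such that every block $x[-n,n]$ occurs as a subword of some $\zeta^k(a)$, $k\in\mathbb N$, $a\in\mathcal A$, and let $T$ be the left shift on $X_\zeta$. Assume that $\zeta$ is primitive (some power of $\mathsf S$ has only positive entries) and aperiodic ($T$ has no periodic points in $X_\zeta$), that the characteristic polynomial of $\mathsf S$ is irreducible over $\mathbb Q$, and that $|\theta_2|>1$, where $\theta_1>|\theta_2|\ge\dots$ are the eigenvalues of $\mathsf S$ ordered by magnitude. Let $\mu$ be the (unique) $T$-invariant Borel probability measure on $X_\zeta$. For $\vec s$ in the simplex $\Delta^{m-1}=\{\vec s\in\mathbb R^m: s_j>0 \text{ for all } j,\ \sum_j s_j=1\}$ let $(\mathfrak X_\zeta^{\vec s},\widetilde\mu,h_t)$ be the suspension flow over $(X_\zeta,T,\mu)$ with roof function equal to $s_j$ on the cylinder $\{x: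 x_0=j\}$, where $\widetilde\mu$ is the normalized restriction of $\mu\times\mathrm{Leb}$. A Lip-cylindrical function is a function $f(x,t)=\psi_{x_0}(t)$, $0\le t< s_{x_0}$, with $\psi_a:[0,s_a]\to\mathbb C$ Lipschitz for every $a\in\mathcal A$; put $\|f\|_L=\max_a\|\psi_a\|_L$, where $\|\psi\|_L$ is the supremum norm plus the best Lipschitz constant. The spectral measure $\sigma_f$ is the finite positive Borel measure on $\mathbb R$ with $\int e^{2\pi i\omega t}\,d\sigma_f(\omega)=\langle f\circ h_t,f\rangle_{L^2(\widetilde\mu)}$ for all $t\in\mathbb R$. Then there exist constants $\widetilde\gamma,Z>0$ and a function $C:\mathbb R\to(0,\infty)$, all depending only on $\zeta$, such that for Lebesgue-almost every $\vec s\in\Delta^{m-1}$ there is $r_0=r_0(\vec s)>0$ such that for every Lip-cylindrical function $f$ on $\mathfrak X_\zeta^{\vec s}$ (not necessarily of mean zero) and every $\omega\ne0$, $$\sigma_f([\omega-r,\omega+r])\le C(\|f\|_L)\, r^{\widetilde\gamma}\qquad\text{for all } 0<r<r_0|\omega|^Z .$$ -/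

import Mathlib

open MeasureTheory Set
open scoped ComplexConjugate

noncomputable section

/-- A substitution on the alphabet `Fin m`: every letter is sent to a non-empty finite word. -/
structure Substitution (m : ℕ) where
  toFun : Fin m → List (Fin m)
  ne_nil : ∀ a, toFun a ≠ []

namespace Substitution

variable {m : ℕ}

/-- The extension of `ζ` to words by concatenation. -/
def onWord (ζ : Substitution m) (w : List (Fin m)) : List (Fin m) := w.flatMap ζ.toFun

/-- The word `ζ^k(a)`. -/
def iter (ζ : Substitution m) (k : ℕ) (a : Fin m) : List (Fin m) := ζ.onWord^[k] [a]

/-- The substitution matrix: the entry `(i, j)` is the number of symbols `i` in `ζ(j)`. -/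
def matrix (ζ : Substitution m) : Matrix (Fin m) (Fin m) ℤ :=
  Matrix.of fun i j => ((ζ.toFun j).count i : ℤ)

/-- `ζ` is primitive: some power of the substitution matrix has only positive entries. -/
def Primitive (ζ : Substitution m) : Prop := ζ.matrix.IsPrimitive

/-- The moduli `|θ₁| ≥ |θ₂| ≥ …` of the complex eigenvalues of the substitution matrix, listed
with algebraic multiplicity in decreasing order. -/
def eigenvalueModuli (ζ : Substitution m) : List ℝ :=
  ((ζ.matrix.map (Int.cast : ℤ → ℂ)).charpoly.roots.map (fun z => ‖z‖)).sort (· ≥ ·)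

/-- `|θ₂|`, with the value `0` if there is no second eigenvalue. -/
def secondModulus (ζ : Substitution m) : ℝ := ζ.eigenvalueModuli.getD 1 0

end Substitution

/-- The left shift on two-sided sequences. -/
def leftShift {m : ℕ} (x : ℤ → Fin m) : ℤ → Fin m := fun n => x (n + 1)

/-- The block `x[-n, n]`. -/
def centralBlock {m : ℕ} (x : ℤ → Fin m) (n : ℕ) : List (Fin m) :=
  List.ofFn fun i : Fin (2 * n + 1) => x ((i : ℤ) - n)

namespace Substitution

variable {m : ℕ}

/-- The substitution space `X_ζ`: every central block of `x` is a subword (that is, a contiguous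
block) of some `ζ^k(a)`. -/
def space (ζ : Substitution m) : Set (ℤ → Fin m) :=
  {x | ∀ n : ℕ, ∃ (k : ℕ) (a : Fin m), centralBlock x n <:+: ζ.iter k a}

/-- `ζ` is aperiodic: the system `(X_ζ, T)` has no periodic points. -/
def Aperiodic (ζ : Substitution m) : Prop :=
  ∀ x ∈ ζ.space, x ∉ Function.periodicPts (leftShift (m := m))

/-- `μ` is a shift-invariant Borel probability measure on `X_ζ`, viewed as a measure on the
sequence space that gives no mass to the complement of `X_ζ`. If `ζ` is primitive, there is
exactly one such measure. -/
structure IsInvariantMeasure (ζ : Substitution m) (μ : Measure (ℤ → Fin m)) : Prop where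
  isProbabilityMeasure : IsProbabilityMeasure μ
  measurePreserving : MeasurePreserving leftShift μ μ
  compl_space : μ ζ.spaceᶜ = 0

end Substitution

/-- The open simplex of strictly positive roof vectors with coordinates summing to `1`. -/
def openSimplex (m : ℕ) : Set (Fin m → ℝ) := {s | (∀ j, 0 < s j) ∧ ∑ j, s j = 1}

/-- Lebesgue measure on the simplex, as the `(m - 1)`-dimensional Hausdorff measure; on the
hyperplane spanned by the simplex this is a positive constant multiple of Lebesgue measure. -/
def simplexMeasure (m : ℕ) : Measure (Fin m → ℝ) :=
  (Measure.hausdorffMeasure ((m : ℝ) - 1)).restrict (openSimplex m)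

section Suspension

variable {m : ℕ}

/-- The additive cocycle of the roof function: `s_{x_0} + … + s_{x_{n-1}}` for `n ≥ 0` and
`-(s_{x_n} + … + s_{x_{-1}})` for `n < 0`. -/
def roofSum (s : Fin m → ℝ) (x : ℤ → Fin m) (n : ℤ) : ℝ :=
  ∑ i ∈ Finset.Ico 0 n, s (x i) - ∑ i ∈ Finset.Ico n 0, s (x i)

/-- For a strictly positive `s`, the unique integer `n` with
`roofSum s x n ≤ u < roofSum s x (n + 1)`. -/
def tileIndex (s : Fin m → ℝ) (x : ℤ → Fin m) (u : ℝ) : ℤ := sSup {n : ℤ | roofSum s x n ≤ u}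

/-- The suspension space `{(x, t) : x ∈ X_ζ, 0 ≤ t < s_{x_0}}`; the points `(x, s_{x_0})` are
identified with `(T x, 0)` and not repeated. -/
def suspensionSpace (ζ : Substitution m) (s : Fin m → ℝ) : Set ((ℤ → Fin m) × ℝ) :=
  {p | p.1 ∈ ζ.space ∧ 0 ≤ p.2 ∧ p.2 < s (p.1 0)}

/-- The suspension flow `h_τ`: move up by `τ`, with `(x, s_{x_0})` identified with `(T x, 0)`. -/
def suspensionFlow (s : Fin m → ℝ) (τ : ℝ) (p : (ℤ → Fin m) × ℝ) : (ℤ → Fin m) × ℝ :=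
  let n := tileIndex s p.1 (p.2 + τ)
  (fun i => p.1 (i + n), p.2 + τ - roofSum s p.1 n)

/-- The invariant probability measure of the suspension flow induced by `μ`: the normalized
restriction of the product of `μ` with Lebesgue measure to the suspension space. -/
def suspensionMeasure (ζ : Substitution m) (s : Fin m → ℝ) (μ : Measure (ℤ → Fin m)) :
    Measure ((ℤ → Fin m) × ℝ) :=
  ProbabilityTheory.cond (μ.prod volume) (suspensionSpace ζ s)

/-- The cylindrical function `f(x, t) = ψ_{x_0}(t)`. -/
def cylFun (ψ : Fin m → ℝ → ℂ) (p : (ℤ → Fin m) × ℝ) : ℂ := ψ (p.1 0) p.2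

/-- `ψ_a ∈ Lip[0, s_a]` for every letter `a`. -/
def IsLipData (s : Fin m → ℝ) (ψ : Fin m → ℝ → ℂ) : Prop :=
  ∀ a, ∃ K, LipschitzOnWith K (ψ a) (Icc 0 (s a))

/-- The Lipschitz norm on `[0, b]`: the supremum norm plus the best Lipschitz constant. -/
def lipNormIcc (b : ℝ) (φ : ℝ → ℂ) : ℝ :=
  sSup ((fun t => ‖φ t‖) '' Icc 0 b) +
    sInf {K : ℝ | 0 ≤ K ∧ ∀ t ∈ Icc 0 b, ∀ u ∈ Icc 0 b, ‖φ t - φ u‖ ≤ K * |t - u|}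

/-- `‖f‖_L = max_a ‖ψ_a‖_L`. -/
def cylLipNorm (s : Fin m → ℝ) (ψ : Fin m → ℝ → ℂ) : ℝ := ⨆ a, lipNormIcc (s a) (ψ a)

end Suspension

/-- `σ` is the spectral measure of `f` for the flow `h` on `(Y, ν)`: the finite positive Borel
measure on `ℝ` with `∫ e^{2πiωt} dσ(ω) = ⟨f ∘ h_t, f⟩` for all real `t`. -/
structure IsSpectralMeasure {Y : Type*} [MeasurableSpace Y] (ν : Measure Y) (h : ℝ → Y → Y)
    (f : Y → ℂ) (σ : Measure ℝ) : Prop where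
  isFiniteMeasure : IsFiniteMeasure σ
  fourier : ∀ t : ℝ, ∫ ω : ℝ, Complex.exp (2 * Real.pi * Complex.I * ω * t) ∂σ =
    ∫ y, f (h t y) * conj (f y) ∂ν

end

/-! The mass that `σ_f` gives to an interval of radius `r` around `ω` is controlled by the twisted
integrals `∫ e^{-2πiωu} f(h_u y) du` over segments of length `R` comparable to `1 / r`
(`IsSpectralMeasure.measureReal_Icc_le`), so a power saving over the trivial bound `R` gives a
Hölder bound. Up to two incomplete tiles, such an integral is a twisted sum along a block of a point
of `X_ζ`, and every block is a concatenation of words `ζ^n(b)` with two short ends.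

Cancellation in these sums comes from a return word `cv` such that `cvc` occurs in every `ζ^q(b)`.
If `ω` times the roof length of `ζ^n(cv)` is away from the integers, the two copies of `ζ^n(c)` are
out of phase and the normalized sums contract by a fixed factor between levels `n` and `n + q`
(`maxTwisted_contract`). It remains to find a positive proportion of such levels, for almost every
`s` and uniformly in `e^{-κn} ≤ |ω| ≤ e^{κn}`.

This is an Erdős–Kahane argument (`exists_erdos_kahane`). With `l` the population vector of `cv`,
the numbers `⟨ωs, S^k l⟩` obey an integer recurrence, so their nearest integers obey it too, except
near the few levels that are off the integers. Hence a pair `(s, ω)` with few such levels has few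
possible integer sequences. By irreducibility an eigenvector of `S` is a combination of `m`
consecutive vectors `S^k l`, so the sequence determines `⟨ωs, w⟩` and `⟨ωs, b⟩` up to an
exponentially small error (`exists_contracting_functionals`); here `w` is the Perron eigenvector and
`b` comes from a second eigenvalue outside the unit disc, which is where `|θ₂| > 1` enters. The
ratio of the two functionals no longer contains `ω`. Bad pairs therefore project to sets of summable
measure on the line, and Borel–Cantelli with a Fubini argument (`ae_simplex_projCoord_notMem`)
excludes only a null set of `s`.

The argument covers scales `r` up to a constant times `e^{-Z |log |ω||}`. For `|ω| > 1` and larger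
`r`, the decay `1 / |ω|` of the integral of a Lipschitz function over one tile is enough
(`norm_integral_flowLine_le_div`). -/

/-! ### Cutting subwords of concatenations -/

namespace List

variable {α β : Type*}

lemma exists_flatMap_append_of_isPrefix {g : α → List β} {Q : ℕ} (hg : ∀ a, (g a).length ≤ Q)
    (w : List α) (u : List β) (h : u <+: w.flatMap g) :
    ∃ w' b, u = List.flatMap g w' ++ b ∧ b.length ≤ Q := by
  induction w generalizing u with
  | nil => exact ⟨[], [], by simpa using h, by simp⟩
  | cons c w ih =>
    obtain ⟨q, hq⟩ := h
    rw [List.flatMap_cons] at hq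
    rcases List.append_eq_append_iff.1 hq with ⟨a', h1, -⟩ | ⟨a', h1, h2⟩
    · refine ⟨[], u, by simp, le_trans ?_ (hg c)⟩
      rw [h1]; simp
    · obtain ⟨w', b, hb, hl⟩ := ih a' ⟨q, h2.symm⟩
      exact ⟨c :: w', b, by rw [h1, hb]; simp, hl⟩

/-- A subword meets at most two blocks incompletely, one at each end; if it lies inside a single
block, it is itself short and serves as the prefix. -/
lemma exists_flatMap_of_isInfix {g : α → List β} {Q : ℕ} (hg : ∀ a, (g a).length ≤ Q)
    (w : List α) (u : List β) (h : u <:+: w.flatMap g) :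
    ∃ a w' b, u = a ++ List.flatMap g w' ++ b ∧ a.length ≤ Q ∧ b.length ≤ Q := by
  induction w with
  | nil => exact ⟨[], [], [], by simpa using h, by simp, by simp⟩
  | cons c w ih =>
    obtain ⟨p, q, hq⟩ := h
    rw [List.flatMap_cons, List.append_assoc] at hq
    rcases List.append_eq_append_iff.1 hq with ⟨a', h1, h2⟩ | ⟨a', h1, h2⟩
    · rcases List.append_eq_append_iff.1 h2 with ⟨b', h3, -⟩ | ⟨b', h3, h4⟩
      · refine ⟨u, [], [], by simp, le_trans ?_ (hg c), by simp⟩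
        rw [h1, h3]; simp; omega
      · obtain ⟨w', b, hb, hl⟩ := exists_flatMap_append_of_isPrefix hg w b' ⟨q, h4.symm⟩
        refine ⟨a', w', b, by rw [h3, hb]; simp, le_trans ?_ (hg c), hl⟩
        rw [h1]; simp
    · exact ih ⟨a', q, by rw [h2]; simp⟩

end List

/-! ### Iterated words, their lengths and population vectors -/

namespace Substitution

variable {m : ℕ} (ζ : Substitution m)

/-- The word `ζ^n(w)`. -/
def iterWord (n : ℕ) (w : List (Fin m)) : List (Fin m) := ζ.onWord^[n] w

lemma iter_eq_iterWord (n : ℕ) (a : Fin m) : ζ.iter n a = ζ.iterWord n [a] := rfl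

lemma onWord_append (u w : List (Fin m)) : ζ.onWord (u ++ w) = ζ.onWord u ++ ζ.onWord w := by
  simp [onWord]

lemma iterWord_zero (w : List (Fin m)) : ζ.iterWord 0 w = w := rfl

lemma iterWord_succ (n : ℕ) (w : List (Fin m)) :
    ζ.iterWord (n + 1) w = ζ.onWord (ζ.iterWord n w) := by
  simp [iterWord, Function.iterate_succ_apply']

lemma iterWord_add (n k : ℕ) (w : List (Fin m)) :
    ζ.iterWord (n + k) w = ζ.iterWord n (ζ.iterWord k w) :=
  Function.iterate_add_apply _ _ _ _

lemma iter_add (n k : ℕ) (a : Fin m) : ζ.iter (n + k) a = ζ.iterWord n (ζ.iter k a) :=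
  ζ.iterWord_add n k [a]

lemma iterWord_append (n : ℕ) (u w : List (Fin m)) :
    ζ.iterWord n (u ++ w) = ζ.iterWord n u ++ ζ.iterWord n w := by
  induction n with
  | zero => rfl
  | succ n ih => rw [iterWord_succ, ih, onWord_append, ← iterWord_succ, ← iterWord_succ]

lemma iterWord_nil (n : ℕ) : ζ.iterWord n [] = [] := by
  have := congrArg List.length (ζ.iterWord_append n [] [])
  rw [List.append_nil, List.length_append] at this
  exact List.length_eq_zero_iff.1 (by omega)

lemma iterWord_cons (n : ℕ) (a : Fin m) (w : List (Fin m)) :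
    ζ.iterWord n (a :: w) = ζ.iter n a ++ ζ.iterWord n w :=
  ζ.iterWord_append n [a] w

lemma iterWord_eq_flatMap (n : ℕ) (w : List (Fin m)) : ζ.iterWord n w = w.flatMap (ζ.iter n) := by
  induction w with
  | nil => simp [iterWord_nil]
  | cons a w ih => rw [iterWord_cons, ih, List.flatMap_cons]

lemma length_le_onWord (w : List (Fin m)) : w.length ≤ (ζ.onWord w).length := by
  induction w with
  | nil => simp
  | cons a w ih =>
    have := List.length_pos_iff.2 (ζ.ne_nil a)
    simp only [onWord, List.flatMap_cons, List.length_append, List.length_cons] at *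
    omega

lemma length_iterWord_mono (w : List (Fin m)) : Monotone fun n => (ζ.iterWord n w).length :=
  monotone_nat_of_le_succ fun n => by
    rw [iterWord_succ]; exact ζ.length_le_onWord _

lemma length_iter_pos (n : ℕ) (a : Fin m) : 0 < (ζ.iter n a).length :=
  lt_of_lt_of_le (by simp [iterWord_zero]) (ζ.length_iterWord_mono [a] (Nat.zero_le n))

/-- The maximal length of the words `ζ^n(a)`. -/
def maxLen (n : ℕ) : ℕ := Finset.univ.sup fun a => (ζ.iter n a).length

lemma length_iter_le (n : ℕ) (a : Fin m) : (ζ.iter n a).length ≤ ζ.maxLen n :=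
  Finset.le_sup (f := fun a => (ζ.iter n a).length) (Finset.mem_univ a)

lemma maxLen_mono : Monotone ζ.maxLen := fun _ _ h =>
  Finset.sup_mono_fun fun a _ => ζ.length_iterWord_mono [a] h

lemma length_iterWord_le (n : ℕ) (w : List (Fin m)) :
    (ζ.iterWord n w).length ≤ w.length * ζ.maxLen n := by
  induction w with
  | nil => simp [iterWord_nil]
  | cons a w ih =>
    rw [iterWord_cons, List.length_append, List.length_cons, add_mul, one_mul]
    have := ζ.length_iter_le n a
    omega

lemma maxLen_add_le (n k : ℕ) : ζ.maxLen (n + k) ≤ ζ.maxLen n * ζ.maxLen k := by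
  refine Finset.sup_le fun a _ => ?_
  rw [iter_add]
  refine (ζ.length_iterWord_le n _).trans ?_
  rw [mul_comm]
  exact Nat.mul_le_mul le_rfl (ζ.length_iter_le k a)

lemma maxLen_zero_le : ζ.maxLen 0 ≤ 1 := Finset.sup_le fun a _ => by simp [iter]

lemma maxLen_le_pow (n : ℕ) : ζ.maxLen n ≤ ζ.maxLen 1 ^ n := by
  induction n with
  | zero => simpa using ζ.maxLen_zero_le
  | succ n ih =>
    rw [pow_succ]
    exact (ζ.maxLen_add_le n 1).trans (Nat.mul_le_mul ih le_rfl)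

/-- A subword of some `ζ^k(a)` is a concatenation of words `ζ^n(b)`, up to a short prefix and a
short suffix. -/
lemma exists_iterWord_of_isInfix (n k : ℕ) (a : Fin m) (u : List (Fin m)) (h : u <:+: ζ.iter k a) :
    ∃ p w q, u = p ++ ζ.iterWord n w ++ q ∧ p.length ≤ ζ.maxLen n ∧ q.length ≤ ζ.maxLen n := by
  rcases lt_or_ge k n with hk | hk
  · refine ⟨u, [], [], by simp [iterWord_nil], ?_, by simp⟩
    exact h.length_le.trans ((ζ.length_iter_le k a).trans (ζ.maxLen_mono hk.le))
  · obtain ⟨j, rfl⟩ := Nat.exists_eq_add_of_le hk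
    rw [iter_add, iterWord_eq_flatMap] at h
    obtain ⟨p, w, q, h1, h2, h3⟩ := List.exists_flatMap_of_isInfix (ζ.length_iter_le n) _ _ h
    exact ⟨p, w, q, by rw [iterWord_eq_flatMap, h1], h2, h3⟩

/-- The population vector of a word. -/
def popVec (w : List (Fin m)) : Fin m → ℤ := fun i => (w.count i : ℤ)

lemma popVec_append (u w : List (Fin m)) : popVec (u ++ w) = popVec u + popVec w := by
  ext i; simp [popVec]

lemma popVec_singleton (a : Fin m) : popVec [a] = Pi.single a 1 := by
  ext j
  by_cases h : a = j
  · subst h; simp [popVec]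
  · simp [popVec, h, Ne.symm h]

lemma popVec_onWord (w : List (Fin m)) : popVec (ζ.onWord w) = ζ.matrix.mulVec (popVec w) := by
  induction w with
  | nil => ext i; simp [popVec, onWord, Matrix.mulVec, dotProduct]
  | cons a w ih =>
    have h1 : ζ.onWord (a :: w) = ζ.toFun a ++ ζ.onWord w := by simp [onWord]
    have h2 : popVec (a :: w) = popVec [a] + popVec w := popVec_append [a] w
    rw [h1, h2, popVec_append, ih, Matrix.mulVec_add]
    congr 1
    ext i
    rw [popVec_singleton]
    simp [popVec, matrix]

lemma popVec_iterWord (n : ℕ) (w : List (Fin m)) :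
    popVec (ζ.iterWord n w) = (ζ.matrix ^ n).mulVec (popVec w) := by
  induction n with
  | zero => simp [iterWord_zero]
  | succ n ih => rw [iterWord_succ, popVec_onWord, ih, Matrix.mulVec_mulVec, pow_succ']

variable {ζ}

/-- Column `b` of `S^p` is the population vector of `ζ^p(b)`, so a positive entry is an occurrence.
-/
lemma Primitive.exists_mem_iter (h : ζ.Primitive) : ∃ p, ∀ a b, a ∈ ζ.iter p b := by
  obtain ⟨p, -, hp⟩ := h.exists_pos_pow
  refine ⟨p, fun a b => ?_⟩
  have h1 := congrFun (ζ.popVec_iterWord p [b]) a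
  rw [popVec_singleton, Matrix.mulVec_single_one] at h1
  have h2 := hp a b
  have h4 : 0 < popVec (ζ.iterWord p [b]) a := by rw [h1]; exact h2
  simp only [popVec, Nat.cast_pos] at h4
  exact List.count_pos_iff.1 h4

lemma iterWord_isInfix (n : ℕ) {u w : List (Fin m)} (h : u <:+: w) :
    ζ.iterWord n u <:+: ζ.iterWord n w := by
  obtain ⟨p, q, rfl⟩ := h
  rw [iterWord_append, iterWord_append]
  exact List.infix_append _ _ _

lemma iter_infix_iter_add {p : ℕ} (hp : ∀ a b, a ∈ ζ.iter p b) (n : ℕ) (a b : Fin m) :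
    ζ.iter n a <:+: ζ.iter (n + p) b := by
  rw [iter_add, iter_eq_iterWord]
  obtain ⟨s, t, h⟩ := List.append_of_mem (hp a b)
  exact iterWord_isInfix n ⟨s, t, by rw [h]; simp⟩

/-- All words `ζ^n(a)` have comparable lengths. -/
lemma maxLen_le_mul_length {p : ℕ} (hp : ∀ a b, a ∈ ζ.iter p b) (n : ℕ) (c : Fin m) :
    ζ.maxLen n ≤ (ζ.iter n c).length * ζ.maxLen p := by
  refine Finset.sup_le fun a _ => ((iter_infix_iter_add hp n a c).length_le).trans ?_
  -- Reading `ζ^(n+p)(c)` as `ζ^p(ζ^n(c))` bounds its length by that of `ζ^n(c)`.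
  rw [add_comm, iter_add]
  exact ζ.length_iterWord_le p _

/-- A primitive substitution on at least two letters has a return word that occurs in all `ζ^q(b)`
for some `q`. -/
lemma exists_return_word {p : ℕ} (hp : ∀ a b, a ∈ ζ.iter p b) (hm : 2 ≤ m) :
    ∃ (q : ℕ) (c : Fin m) (v : List (Fin m)), ∀ b, (c :: v ++ [c]) <:+: ζ.iter q b := by
  let c : Fin m := ⟨0, by omega⟩
  obtain ⟨a, a', w, hw⟩ : ∃ a a' w, ζ.iter p c = a :: a' :: w := by
    have h0 := hp ⟨0, by omega⟩ c
    have h1 := hp ⟨1, by omega⟩ c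
    match h : ζ.iter p c with
    | [] => simp [h] at h0
    | [x] =>
      rw [h, List.mem_singleton] at h0 h1
      simp [← h0] at h1
    | x :: y :: w => exact ⟨x, y, w, rfl⟩
  obtain ⟨s₁, t₁, h₁⟩ := List.append_of_mem (hp c a)
  obtain ⟨s₂, t₂, h₂⟩ := List.append_of_mem (hp c a')
  -- One `p` produces the adjacent letters `a a'`, one puts a `c` into each of their images, and one
  -- makes the result occur in the image of every `b`.
  refine ⟨p + p + p, c, t₁ ++ s₂, fun b => ?_⟩
  refine List.IsInfix.trans ?_ (iter_infix_iter_add hp (p + p) c b)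
  rw [iter_add, hw, iterWord_cons, iterWord_cons, h₁, h₂]
  exact ⟨s₁, t₂ ++ ζ.iterWord p w, by simp⟩

end Substitution

/-! ### Phases, twisted sums and their contraction -/

noncomputable section

/-- The phase `e^{2πix}`. -/
def phase (x : ℝ) : ℂ := Complex.exp ((2 * Real.pi * x : ℝ) * Complex.I)

lemma phase_zero : phase 0 = 1 := by simp [phase]

lemma phase_add (x y : ℝ) : phase (x + y) = phase x * phase y := by
  rw [phase, phase, phase, ← Complex.exp_add]; push_cast; ring_nf

lemma norm_phase (x : ℝ) : ‖phase x‖ = 1 := Complex.norm_exp_ofReal_mul_I _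

lemma continuous_phase : Continuous phase := by unfold phase; fun_prop

lemma conj_phase (x : ℝ) : conj (phase x) = phase (-x) := by
  rw [phase, phase, ← Complex.exp_conj, map_mul, Complex.conj_I, Complex.conj_ofReal]
  push_cast
  ring_nf

lemma norm_one_add_phase_sq (x : ℝ) : ‖1 + phase x‖ ^ 2 = (2 * Real.cos (Real.pi * x)) ^ 2 := by
  rw [phase, Complex.exp_mul_I, ← Complex.ofReal_cos, ← Complex.ofReal_sin, Complex.sq_norm,
    Complex.normSq_apply]
  simp only [Complex.add_re, Complex.one_re, Complex.ofReal_re, Complex.mul_re, Complex.I_re,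
    Complex.ofReal_im, Complex.I_im, Complex.add_im, Complex.one_im, Complex.mul_im]
  have h : 2 * Real.pi * x = 2 * (Real.pi * x) := by ring
  rw [h, Real.cos_two_mul, Real.sin_two_mul]
  have := Real.sin_sq_add_cos_sq (Real.pi * x)
  linear_combination (4 * Real.cos (Real.pi * x) ^ 2) * this

/-- The modulus equals `2 |cos πx|`, which decreases in the distance from `x` to the nearest
integer. -/
lemma norm_one_add_phase_le {ρ x : ℝ} (hρ : 0 ≤ ρ) (hx : ρ ≤ |x - round x|) :
    ‖1 + phase x‖ ≤ 2 * Real.cos (Real.pi * ρ) := by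
  have hpi := Real.pi_pos
  have h1 : |x - round x| ≤ 1 / 2 := abs_sub_round x
  have h2 : 0 ≤ Real.cos (Real.pi * ρ) :=
    Real.cos_nonneg_of_mem_Icc ⟨by nlinarith, by nlinarith⟩
  rw [← sq_le_sq₀ (norm_nonneg _) (by positivity), norm_one_add_phase_sq]
  have h3 : Real.cos (Real.pi * x) ^ 2 = Real.cos (Real.pi * |x - round x|) ^ 2 := by
    have h4 : Real.pi * |x - round x| = |Real.pi * x - (round x : ℤ) * Real.pi| := by
      rw [← abs_of_pos hpi, ← abs_mul, abs_of_pos hpi]; ring_nf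
    rw [h4, Real.cos_abs, Real.cos_sub_int_mul_pi, mul_pow, ← sq_abs ((-1 : ℝ) ^ round x),
      abs_zpow]
    simp
  rw [mul_pow, mul_pow, h3]
  have h5 : Real.cos (Real.pi * |x - round x|) ≤ Real.cos (Real.pi * ρ) :=
    Real.cos_le_cos_of_nonneg_of_le_pi (by positivity) (by nlinarith) (by gcongr)
  have h6 : 0 ≤ Real.cos (Real.pi * |x - round x|) :=
    Real.cos_nonneg_of_mem_Icc ⟨by nlinarith, by nlinarith⟩
  gcongr

/-- If an antitone sequence contracts over `q` steps at every index of a set `G`, then it decays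
geometrically in the number of elements of `G`. -/
lemma antitone_decay {A : ℕ → ℝ} (hA : Antitone A) (h0 : ∀ n, 0 ≤ A n) {q : ℕ} (hq : q ≠ 0)
    {μ : ℝ} (hμ : 0 ≤ μ) (G : ℕ → Prop) [DecidablePred G]
    (hG : ∀ n, G n → A (n + q) ≤ μ ^ q * A n) (n : ℕ) :
    A (n + q) ≤ A 0 * μ ^ Nat.count G n := by
  -- The product over a window of `q` terms is used because sliding the window by one replaces `A n`
  -- by `A (n + q)`. Each index of `G` thus yields one factor `μ ^ q`, although the contraction
  -- steps overlap.
  have key : ∀ n, ∏ i ∈ Finset.range q, A (n + i) ≤ (A 0 * μ ^ Nat.count G n) ^ q := by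
    intro n
    induction n with
    | zero =>
      rw [Nat.count_zero, pow_zero, mul_one]
      calc ∏ i ∈ Finset.range q, A (0 + i) ≤ ∏ i ∈ Finset.range q, A 0 :=
            Finset.prod_le_prod (fun i _ => h0 _) fun i _ => hA (Nat.zero_le _)
        _ = _ := by simp
    | succ n ih =>
      obtain ⟨k, rfl⟩ := Nat.exists_eq_succ_of_ne_zero hq
      have e1 : ∏ i ∈ Finset.range k, A (n + 1 + i) = ∏ i ∈ Finset.range k, A (n + (i + 1)) :=
        Finset.prod_congr rfl fun i _ => by ring_nf
      have hP : 0 ≤ ∏ i ∈ Finset.range k, A (n + (i + 1)) := Finset.prod_nonneg fun i _ => h0 _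
      rw [Finset.prod_range_succ', add_zero] at ih
      rw [Finset.prod_range_succ, e1, Nat.count_succ]
      have e2 : n + 1 + k = n + (k + 1) := by ring
      rw [e2]
      split_ifs with hn
      · calc _ ≤ (∏ i ∈ Finset.range k, A (n + (i + 1))) * (μ ^ (k + 1) * A n) := by
              gcongr; exact hG n hn
          _ = μ ^ (k + 1) * ((∏ i ∈ Finset.range k, A (n + (i + 1))) * A n) := by ring
          _ ≤ μ ^ (k + 1) * (A 0 * μ ^ Nat.count G n) ^ (k + 1) := by gcongr
          _ = _ := by rw [← mul_pow, pow_succ μ]; congr 1; ring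
      · calc _ ≤ (∏ i ∈ Finset.range k, A (n + (i + 1))) * A n := by
              gcongr; exact hA (Nat.le_add_right _ _)
          _ ≤ _ := ih
  rw [← pow_le_pow_iff_left₀ (h0 _) (mul_nonneg (h0 _) (pow_nonneg hμ _)) hq]
  refine le_trans ?_ (key n)
  calc A (n + q) ^ q = ∏ i ∈ Finset.range q, A (n + q) := by simp
    _ ≤ _ := Finset.prod_le_prod (fun i _ => h0 _) fun i hi =>
      hA (by have := Finset.mem_range.1 hi; omega)

section Twisted

variable {m : ℕ} (ω : ℝ) (s : Fin m → ℝ) (φ : Fin m → ℂ)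

/-- The total roof length of a word. -/
def roofWord (w : List (Fin m)) : ℝ := (w.map s).sum

lemma roofWord_append (u w : List (Fin m)) :
    roofWord s (u ++ w) = roofWord s u + roofWord s w := by simp [roofWord]

lemma roofWord_eq_sum (w : List (Fin m)) :
    roofWord s w = ∑ i, s i * (Substitution.popVec w i : ℝ) := by
  induction w with
  | nil => simp [roofWord, Substitution.popVec]
  | cons a w ih =>
    rw [show a :: w = [a] ++ w from rfl, roofWord_append, ih, Substitution.popVec_append,
      Substitution.popVec_singleton]
    simp [roofWord, mul_add, Finset.sum_add_distrib, Pi.single_apply]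

/-- The twisted sum of the letter weights `φ` along a word. -/
def twistedSum : List (Fin m) → ℂ
  | [] => 0
  | a :: w => φ a + phase (-(ω * s a)) * twistedSum w

lemma twistedSum_append (u w : List (Fin m)) :
    twistedSum ω s φ (u ++ w) =
      twistedSum ω s φ u + phase (-(ω * roofWord s u)) * twistedSum ω s φ w := by
  induction u with
  | nil => simp [twistedSum, roofWord, phase_zero]
  | cons a u ih =>
    have : roofWord s (a :: u) = s a + roofWord s u := by simp [roofWord]
    rw [List.cons_append, twistedSum, twistedSum, ih, this, mul_add ω, neg_add, phase_add]
    ring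

lemma norm_twistedSum_append_le (u w : List (Fin m)) :
    ‖twistedSum ω s φ (u ++ w)‖ ≤ ‖twistedSum ω s φ u‖ + ‖twistedSum ω s φ w‖ := by
  rw [twistedSum_append]
  refine (norm_add_le _ _).trans ?_
  rw [norm_mul, norm_phase, one_mul]

lemma twistedSum_singleton (a : Fin m) : twistedSum ω s φ [a] = φ a := by simp [twistedSum]

variable {φ} in
lemma norm_twistedSum_le {M : ℝ} (hM : ∀ a, ‖φ a‖ ≤ M) (w : List (Fin m)) :
    ‖twistedSum ω s φ w‖ ≤ M * w.length := by
  induction w with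
  | nil => simp [twistedSum]
  | cons a w ih =>
    have := norm_twistedSum_append_le ω s φ [a] w
    rw [twistedSum_singleton] at this
    have h2 := hM a
    simp only [List.singleton_append, List.length_cons] at *
    push_cast
    linarith

variable (ζ : Substitution m)

/-- The maximal normalized twisted sum over the words `ζ^n(a)`. -/
def maxTwisted (n : ℕ) : ℝ := ⨆ a, ‖twistedSum ω s φ (ζ.iter n a)‖ / (ζ.iter n a).length

lemma maxTwisted_nonneg (n : ℕ) : 0 ≤ maxTwisted ω s φ ζ n :=
  Real.iSup_nonneg fun _ => by positivity

lemma norm_twistedSum_iter_le (n : ℕ) (a : Fin m) :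
    ‖twistedSum ω s φ (ζ.iter n a)‖ ≤ maxTwisted ω s φ ζ n * (ζ.iter n a).length := by
  have h : (0 : ℝ) < (ζ.iter n a).length := by exact_mod_cast ζ.length_iter_pos n a
  rw [← div_le_iff₀ h]
  exact le_ciSup (f := fun a => ‖twistedSum ω s φ (ζ.iter n a)‖ / (ζ.iter n a).length)
    (Set.finite_range _).bddAbove a

lemma norm_twistedSum_iterWord_le (n : ℕ) (w : List (Fin m)) :
    ‖twistedSum ω s φ (ζ.iterWord n w)‖ ≤ maxTwisted ω s φ ζ n * (ζ.iterWord n w).length := by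
  induction w with
  | nil => simp [Substitution.iterWord_nil, twistedSum]
  | cons a w ih =>
    rw [Substitution.iterWord_cons, List.length_append]
    have := norm_twistedSum_append_le ω s φ (ζ.iter n a) (ζ.iterWord n w)
    have := norm_twistedSum_iter_le ω s φ ζ n a
    push_cast
    linarith

lemma maxTwisted_le [NeZero m] {n : ℕ} {B : ℝ}
    (h : ∀ a, ‖twistedSum ω s φ (ζ.iter n a)‖ ≤ B * (ζ.iter n a).length) :
    maxTwisted ω s φ ζ n ≤ B :=
  ciSup_le fun a => by
    rw [div_le_iff₀ (by exact_mod_cast ζ.length_iter_pos n a)]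
    exact h a

/-- A word of level `n + 1` is a concatenation of words of level `n`, and the norms of twisted sums
are subadditive under concatenation. -/
lemma maxTwisted_antitone [NeZero m] : Antitone (maxTwisted ω s φ ζ) :=
  antitone_nat_of_succ_le fun n => maxTwisted_le ω s φ ζ fun a => by
    rw [Substitution.iter_add]
    exact norm_twistedSum_iterWord_le ω s φ ζ n _

variable {ζ}

/-- If the return word `c :: v` is out of phase at level `n`, then the normalized twisted sums
contract. -/
lemma maxTwisted_contract [NeZero m] {p q : ℕ} (hp : ∀ a b, a ∈ ζ.iter p b) {c : Fin m}
    {v : List (Fin m)} (hv : ∀ b, (c :: v ++ [c]) <:+: ζ.iter q b) {ρ : ℝ} (hρ : 0 ≤ ρ) (n : ℕ)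
    (hn : ρ ≤ |ω * roofWord s (ζ.iterWord n (c :: v)) -
      round (ω * roofWord s (ζ.iterWord n (c :: v)))|) :
    maxTwisted ω s φ ζ (n + q) ≤
      (1 - (2 - 2 * Real.cos (Real.pi * ρ)) / (ζ.maxLen p * ζ.maxLen q)) *
        maxTwisted ω s φ ζ n := by
  refine maxTwisted_le ω s φ ζ fun b => ?_
  obtain ⟨P, Q, h⟩ := hv b
  set A := maxTwisted ω s φ ζ n with hA
  have hA0 : 0 ≤ A := maxTwisted_nonneg ω s φ ζ n
  set x := roofWord s (ζ.iterWord n (c :: v)) with hx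
  have e : ζ.iter (n + q) b = ζ.iterWord n P ++ ((ζ.iterWord n (c :: v) ++ ζ.iter n c) ++
      ζ.iterWord n Q) := by
    rw [Substitution.iter_add, ← h, Substitution.iterWord_append, Substitution.iterWord_append,
      Substitution.iterWord_append, ← Substitution.iter_eq_iterWord, List.append_assoc]
  have hlen : ((ζ.iter (n + q) b).length : ℝ) = (ζ.iterWord n P).length +
      (2 * (ζ.iter n c).length + (ζ.iterWord n v).length + (ζ.iterWord n Q).length) := by
    rw [e, Substitution.iterWord_cons]
    simp only [List.length_append]
    push_cast
    ring
  have hmid : ‖twistedSum ω s φ (ζ.iterWord n (c :: v) ++ ζ.iter n c)‖ ≤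
      A * (ζ.iter n c).length * (2 * Real.cos (Real.pi * ρ)) + A * (ζ.iterWord n v).length := by
    rw [twistedSum_append, ← hx, Substitution.iterWord_cons, twistedSum_append]
    -- Both copies of `ζ^n(c)` have the same twisted sum `X`; together they contribute `X (1 + b)`
    -- with `b` the phase of the return word.
    have e3 : ∀ X Y a b : ℂ, X + a * Y + b * X = X * (1 + b) + a * Y := by intros; ring
    rw [e3]
    refine (norm_add_le _ _).trans ?_
    rw [norm_mul, norm_mul, norm_phase, one_mul]
    have h1 : ‖1 + phase (-(ω * x))‖ ≤ 2 * Real.cos (Real.pi * ρ) := by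
      have : ‖1 + phase (-(ω * x))‖ = ‖1 + phase (ω * x)‖ := by
        rw [← conj_phase, ← RCLike.norm_conj]; simp
      rw [this]
      exact norm_one_add_phase_le hρ hn
    have h2 := norm_twistedSum_iter_le ω s φ ζ n c
    have h3 := norm_twistedSum_iterWord_le ω s φ ζ n v
    gcongr
  have hP := norm_twistedSum_iterWord_le ω s φ ζ n P
  have hQ := norm_twistedSum_iterWord_le ω s φ ζ n Q
  rw [← hA] at hP hQ
  have t1 := norm_twistedSum_append_le ω s φ (ζ.iterWord n P)
    ((ζ.iterWord n (c :: v) ++ ζ.iter n c) ++ ζ.iterWord n Q)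
  have t2 := norm_twistedSum_append_le ω s φ (ζ.iterWord n (c :: v) ++ ζ.iter n c)
    (ζ.iterWord n Q)
  rw [← e] at t1
  -- The word `ζ^n(c)` fills a fixed fraction of `ζ^(n+q)(b)`, so the gain on it is a gain relative
  -- to the whole length.
  have hc : ((ζ.iter (n + q) b).length : ℝ) ≤
      (ζ.iter n c).length * (ζ.maxLen p * ζ.maxLen q) := by
    have h1 := ζ.length_iter_le (n + q) b
    have h2 := ζ.maxLen_add_le n q
    have h3 := Nat.mul_le_mul (Substitution.maxLen_le_mul_length hp n c) (le_refl (ζ.maxLen q))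
    rw [mul_assoc] at h3
    exact_mod_cast h1.trans (h2.trans h3)
  have hpos : (0 : ℝ) < ζ.maxLen p * ζ.maxLen q := by
    have h1 := (ζ.length_iter_pos p c).trans_le (ζ.length_iter_le p c)
    have h2 := (ζ.length_iter_pos q c).trans_le (ζ.length_iter_le q c)
    positivity
  have hκ : 0 ≤ 2 - 2 * Real.cos (Real.pi * ρ) := by linarith [Real.cos_le_one (Real.pi * ρ)]
  have hfin : (2 - 2 * Real.cos (Real.pi * ρ)) / (ζ.maxLen p * ζ.maxLen q) *
      (ζ.iter (n + q) b).length ≤ (2 - 2 * Real.cos (Real.pi * ρ)) * (ζ.iter n c).length := by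
    rw [div_mul_eq_mul_div, div_le_iff₀ hpos, mul_assoc]
    gcongr
  have hfin2 := mul_le_mul_of_nonneg_left hfin hA0
  calc ‖twistedSum ω s φ (ζ.iter (n + q) b)‖
      ≤ A * (ζ.iter (n + q) b).length -
        A * ((2 - 2 * Real.cos (Real.pi * ρ)) * (ζ.iter n c).length) := by
        rw [hlen]; linarith
    _ ≤ _ := by linarith

/-- Twisted sums over `ζ^(n+q)(w)` decay in the number of levels at which the return word is out of
phase. -/
lemma exists_twistedSum_decay [NeZero m] {p q : ℕ} (hp : ∀ a b, a ∈ ζ.iter p b) {c : Fin m}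
    {v : List (Fin m)} (hv : ∀ b, (c :: v ++ [c]) <:+: ζ.iter q b) {ρ : ℝ} (hρ : 0 < ρ)
    (hρ1 : ρ ≤ 1) :
    ∃ μ : ℝ, 0 < μ ∧ μ < 1 ∧ ∀ (ω : ℝ) (s : Fin m → ℝ) (φ : Fin m → ℂ) (M : ℝ),
      (∀ a, ‖φ a‖ ≤ M) → ∀ (n : ℕ) (w : List (Fin m)),
        ‖twistedSum ω s φ (ζ.iterWord (n + q) w)‖ ≤
          M * μ ^ Nat.count (fun k => ρ ≤ |ω * roofWord s (ζ.iterWord k (c :: v)) -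
            round (ω * roofWord s (ζ.iterWord k (c :: v)))|) n *
              (ζ.iterWord (n + q) w).length := by
  have hq : q ≠ 0 := by
    rintro rfl
    have := (hv c).length_le
    simp [Substitution.iter] at this
  set κ := (2 - 2 * Real.cos (Real.pi * ρ)) / (ζ.maxLen p * ζ.maxLen q) with hκ
  have h1p : (1 : ℝ) ≤ ζ.maxLen p := by
    exact_mod_cast (ζ.length_iter_pos p c).trans_le (ζ.length_iter_le p c)
  have h1q : (2 : ℝ) ≤ ζ.maxLen q := by
    have h := (hv c).length_le.trans (ζ.length_iter_le q c)
    simp only [List.length_append, List.length_cons, List.length_nil] at h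
    have : 2 ≤ ζ.maxLen q := by omega
    exact_mod_cast this
  have hcos : Real.cos (Real.pi * ρ) < 1 := by
    have hpi := Real.pi_pos
    have := Real.cos_lt_cos_of_nonneg_of_le_pi le_rfl (by nlinarith : Real.pi * ρ ≤ Real.pi)
      (by positivity)
    simpa using this
  have hden : (2 : ℝ) ≤ ζ.maxLen p * ζ.maxLen q := by nlinarith
  have hκ0 : 0 < κ := div_pos (by linarith) (by linarith)
  -- The number `1 - κ` may fail to be positive; the maximum with `1 / 2` permits a `q`-th root.
  have hη : 0 < max (1 - κ) (1 / 2) := by positivity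
  have hη1 : max (1 - κ) (1 / 2) < 1 := max_lt (by linarith) (by norm_num)
  have hpow : (max (1 - κ) (1 / 2) ^ ((q : ℝ)⁻¹)) ^ q = max (1 - κ) (1 / 2) :=
    Real.rpow_inv_natCast_pow hη.le hq
  refine ⟨max (1 - κ) (1 / 2) ^ ((q : ℝ)⁻¹), Real.rpow_pos_of_pos hη _,
    Real.rpow_lt_one hη.le hη1 (by positivity), fun ω s φ M hM n w => ?_⟩
  refine (norm_twistedSum_iterWord_le ω s φ ζ (n + q) w).trans ?_
  gcongr
  refine (antitone_decay (maxTwisted_antitone ω s φ ζ) (maxTwisted_nonneg ω s φ ζ) hq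
    (Real.rpow_pos_of_pos hη (q : ℝ)⁻¹).le
    (fun k => ρ ≤ |ω * roofWord s (ζ.iterWord k (c :: v)) -
      round (ω * roofWord s (ζ.iterWord k (c :: v)))|) (fun k hk => ?_) n).trans ?_
  · rw [hpow]
    refine (maxTwisted_contract ω s φ hp hv hρ.le k hk).trans ?_
    gcongr
    · exact maxTwisted_nonneg ω s φ ζ k
    · exact le_max_left _ _
  · gcongr
    refine maxTwisted_le ω s φ ζ fun a => ?_
    exact norm_twistedSum_le ω s hM _

end Twisted

end

/-! ### Perron–Frobenius, Krylov matrices and recurrences -/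

noncomputable section

namespace Matrix

/-- The Perron–Frobenius theorem for primitive matrices. -/
theorem exists_perron_eigenvector {m : ℕ} [NeZero m] (A : Matrix (Fin m) (Fin m) ℝ)
    (h0 : ∀ i j, 0 ≤ A i j) (p : ℕ) (hp : ∀ i j, 0 < (A ^ p) i j) :
    ∃ (lam : ℝ) (w : Fin m → ℝ), (∀ i, 0 < w i) ∧ A *ᵥ w = lam • w ∧
      ∀ (θ : ℂ) (v : Fin m → ℂ), v ≠ 0 → (A.map Complex.ofReal) *ᵥ v = θ • v → ‖θ‖ ≤ lam := by
  set B : ℝ := ∑ i, ∑ j, A i j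
  have hmv : ∀ (M : Matrix (Fin m) (Fin m) ℝ) (x : Fin m → ℝ) (i : Fin m),
    (M *ᵥ x) i = ∑ j, M i j * x j := fun _ _ _ => rfl
  have hbound : ∀ t : ℝ, ∀ x ∈ stdSimplex ℝ (Fin m), (∀ i, t * x i ≤ (A *ᵥ x) i) → t ≤ B := by
    intro t x hx h
    calc t = ∑ i, t * x i := by rw [← Finset.mul_sum, hx.2, mul_one]
      _ ≤ ∑ i, (A *ᵥ x) i := Finset.sum_le_sum fun i _ => h i
      _ ≤ B := by
        refine Finset.sum_le_sum fun i _ => ?_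
        rw [hmv]
        refine Finset.sum_le_sum fun j _ => ?_
        have hj : x j ≤ 1 := by
          rw [← hx.2]; exact Finset.single_le_sum (fun k _ => hx.1 k) (Finset.mem_univ j)
        exact mul_le_of_le_one_right (h0 i j) hj
  -- Collatz–Wielandt: the Perron eigenvalue is the largest `t` with `t x ≤ A x` for some `x` in the
  -- simplex, and compactness gives a maximizer.
  set T : Set (ℝ × (Fin m → ℝ)) :=
    (Icc 0 B ×ˢ stdSimplex ℝ (Fin m)) ∩ {y | ∀ i, y.1 * y.2 i ≤ (A *ᵥ y.2) i} with hT
  have hTc : IsCompact T := by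
    refine (isCompact_Icc.prod (isCompact_stdSimplex (𝕜 := ℝ) (Fin m))).inter_right ?_
    simp only [ofPred_forall]
    refine isClosed_iInter fun i => isClosed_le (by fun_prop) ?_
    simp only [mulVec, dotProduct]
    fun_prop
  have hx0 : Pi.single (0 : Fin m) (1 : ℝ) ∈ stdSimplex ℝ (Fin m) := single_mem_stdSimplex ℝ 0
  have hnn : ∀ x : Fin m → ℝ, (∀ i, 0 ≤ x i) → ∀ i, 0 ≤ (A *ᵥ x) i := fun x hx i => by
    rw [hmv]
    exact Finset.sum_nonneg fun j _ => mul_nonneg (h0 i j) (hx j)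
  have hTn : T.Nonempty := by
    have h1 : ∀ i, (0 : ℝ) * (Pi.single (0 : Fin m) (1 : ℝ) : Fin m → ℝ) i ≤
        (A *ᵥ Pi.single (0 : Fin m) (1 : ℝ)) i := fun i => by
      rw [zero_mul]; exact hnn _ hx0.1 i
    exact ⟨(0, Pi.single 0 1), ⟨⟨le_rfl, hbound 0 _ hx0 h1⟩, hx0⟩, h1⟩
  obtain ⟨⟨lam, x⟩, ⟨⟨hlam, hx⟩, hlx⟩, hmax⟩ := hTc.exists_isMaxOn hTn continuousOn_fst
  simp only [mem_ofPred_eq] at hlx hlam hx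
  have hmax' : ∀ t : ℝ, ∀ u : Fin m → ℝ, (∀ i, 0 ≤ u i) → u ≠ 0 → 0 ≤ t →
      (∀ i, t * u i ≤ (A *ᵥ u) i) → t ≤ lam := by
    intro t u hu hu0 ht h
    have hs : 0 < ∑ i, u i := by
      obtain ⟨i, hi⟩ := Function.ne_iff.1 hu0
      exact Finset.sum_pos' (fun i _ => hu i) ⟨i, Finset.mem_univ i, (hu i).lt_of_ne' hi⟩
    have hmem : (∑ i, u i)⁻¹ • u ∈ stdSimplex ℝ (Fin m) := by
      refine ⟨fun i => mul_nonneg (by positivity) (hu i), ?_⟩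
      simp only [Pi.smul_apply, smul_eq_mul, ← Finset.mul_sum]
      exact inv_mul_cancel₀ hs.ne'
    have hin : ∀ i, t * ((∑ i, u i)⁻¹ • u) i ≤ (A *ᵥ ((∑ i, u i)⁻¹ • u)) i := by
      intro i
      rw [mulVec_smul, Pi.smul_apply, Pi.smul_apply, smul_eq_mul, smul_eq_mul, mul_left_comm]
      exact mul_le_mul_of_nonneg_left (h i) (by positivity)
    exact hmax (a := (t, (∑ i, u i)⁻¹ • u)) ⟨⟨⟨ht, hbound t _ hmem hin⟩, hmem⟩, hin⟩
  have hpos : ∀ u : Fin m → ℝ, (∀ i, 0 ≤ u i) → u ≠ 0 → ∀ i, 0 < ((A ^ p) *ᵥ u) i := by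
    intro u hu hu0 i
    obtain ⟨j, hj⟩ := Function.ne_iff.1 hu0
    rw [hmv]
    exact Finset.sum_pos' (fun k _ => mul_nonneg (hp i k).le (hu k))
      ⟨j, Finset.mem_univ j, mul_pos (hp i j) ((hu j).lt_of_ne' hj)⟩
  have hxne : x ≠ 0 := by
    rintro rfl
    have := hx.2
    simp at this
  -- Otherwise `A x - lam x` is nonnegative and nonzero, and `A ^ p` makes it strictly positive.
  -- Then `A ^ p x` satisfies the inequality with a larger constant, against maximality.
  have heig : A *ᵥ x = lam • x := by
    by_contra hne
    have hy := hpos (A *ᵥ x - lam • x) (fun i => by simpa using hlx i) (sub_ne_zero.2 hne)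
    have hx' := hpos x hx.1 hxne
    have hcomm : (A ^ p) *ᵥ (A *ᵥ x - lam • x) =
        A *ᵥ ((A ^ p) *ᵥ x) - lam • ((A ^ p) *ᵥ x) := by
      rw [mulVec_sub, mulVec_smul, mulVec_mulVec, mulVec_mulVec, ← pow_succ, ← pow_succ']
    rw [hcomm] at hy
    set x' := (A ^ p) *ᵥ x
    obtain ⟨i₀, -, hi₀⟩ := Finset.exists_min_image Finset.univ
      (fun i => (A *ᵥ x' - lam • x') i / x' i) Finset.univ_nonempty
    set ε := (A *ᵥ x' - lam • x') i₀ / x' i₀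
    have hε : 0 < ε := div_pos (hy i₀) (hx' i₀)
    have := hmax' (lam + ε) x' (fun i => (hx' i).le) (fun h => by
      have := hx' 0; rw [h] at this; simp at this) (by linarith [hlam.1]) fun i => by
      have := (le_div_iff₀ (hx' i)).1 (hi₀ i (Finset.mem_univ i))
      simp only [Pi.sub_apply, Pi.smul_apply, smul_eq_mul] at this
      linarith
    linarith
  refine ⟨lam, x, fun i => ?_, heig, fun θ v hv hθ => ?_⟩
  · refine (hx.1 i).lt_of_ne fun h => ?_
    have hpow : ∀ k : ℕ, (A ^ k) *ᵥ x = lam ^ k • x := by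
      intro k
      induction k with
      | zero => simp
      | succ k ih => rw [pow_succ', ← mulVec_mulVec, ih, mulVec_smul, heig, smul_smul, pow_succ]
    have := hpos x hx.1 hxne i
    rw [hpow, Pi.smul_apply, ← h] at this
    simp at this
  -- By the triangle inequality the vector of moduli satisfies `‖θ‖ |v| ≤ A |v|`.
  · refine hmax' ‖θ‖ (fun i => ‖v i‖) (fun i => norm_nonneg _) (fun h => hv ?_) (norm_nonneg _)
      fun i => ?_
    · ext i
      simpa using congrFun h i
    · have h1 := congrFun hθ i
      simp only [Pi.smul_apply, smul_eq_mul] at h1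
      rw [← norm_mul, ← h1]
      simp only [mulVec, dotProduct]
      refine (norm_sum_le _ _).trans (Finset.sum_le_sum fun j _ => ?_)
      simp [abs_of_nonneg (h0 i j)]

variable {m : ℕ} (S : Matrix (Fin m) (Fin m) ℤ) (v : Fin m → ℤ)

/-- The matrix with columns `v, S v, …, S^(m-1) v`. -/
def krylov : Matrix (Fin m) (Fin m) ℤ := of fun i j => ((S ^ (j : ℕ)) *ᵥ v) i

lemma pow_mulVec_map {K : Type*} [Field K] (k : ℕ) (i : Fin m) :
    (((S ^ k) *ᵥ v) i : K) =
      (((S.map (Int.cast : ℤ → K)) ^ k) *ᵥ (fun j => (v j : K))) i := by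
  have h : (S.map (Int.cast : ℤ → K)) ^ k = (S ^ k).map (Int.cast : ℤ → K) := by
    have := (map_pow (Int.castRingHom K).mapMatrix S k).symm
    simpa using this
  rw [h]
  simp [mulVec, dotProduct]

/-- A kernel vector would be a nonzero polynomial `P` of degree below `m` with `P(S) v = 0`. It is
coprime to the irreducible characteristic polynomial, so Bézout and Cayley–Hamilton give `v = 0`. -/
lemma det_krylov_ne_zero (hirr : Irreducible (S.map (Int.cast : ℤ → ℚ)).charpoly) (hv : v ≠ 0) :
    (krylov S v).det ≠ 0 := by
  intro hdet
  set A := S.map (Int.cast : ℤ → ℚ) with hA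
  set u : Fin m → ℚ := fun j => (v j : ℚ) with hu
  have hdet' : ((krylov S v).map (Int.cast : ℤ → ℚ)).det = 0 := by
    have := (Int.castRingHom ℚ).map_det (krylov S v)
    rw [hdet, map_zero] at this
    exact this.symm
  obtain ⟨q, hq0, hq⟩ := exists_mulVec_eq_zero_iff.2 hdet'
  set P : Polynomial ℚ := ∑ j : Fin m, Polynomial.C (q j) * Polynomial.X ^ (j : ℕ) with hP
  have hcoeff : ∀ j : Fin m, P.coeff j = q j := by
    intro j
    simp [hP, Polynomial.finsetSum_coeff, Polynomial.coeff_C_mul, Polynomial.coeff_X_pow,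
      Fin.val_inj, Finset.sum_ite_eq]
  have hP0 : P ≠ 0 := by
    intro h
    apply hq0
    ext j
    rw [← hcoeff j, h]; simp
  have hPS : (Polynomial.aeval A P) *ᵥ u = 0 := by
    ext i
    have h1 := congrFun hq i
    rw [← h1, hP, map_sum, sum_mulVec]
    simp only [Finset.sum_apply, map_mul, Polynomial.aeval_C, map_pow, Polynomial.aeval_X]
    simp only [mulVec, dotProduct, map_apply, krylov, of_apply]
    refine Finset.sum_congr rfl fun j _ => ?_
    have h2 := pow_mulVec_map (K := ℚ) S v j i
    simp only [mulVec, dotProduct] at h2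
    rw [h2, Finset.sum_mul]
    refine Finset.sum_congr rfl fun k _ => ?_
    rw [Matrix.algebraMap_eq_diagonal, diagonal_mul]
    simp [hA, hu]
    ring
  have hdeg : P.degree < A.charpoly.degree := by
    rw [charpoly_degree_eq_dim, Fintype.card_fin]
    exact Polynomial.degree_sum_fin_lt q
  have hcop : IsCoprime A.charpoly P := by
    rw [hirr.coprime_iff_not_dvd]
    intro hd
    exact absurd (Polynomial.degree_le_of_dvd hd hP0) (not_le.2 hdeg)
  obtain ⟨a, b, hab⟩ := hcop
  have h3 := congrArg (fun R => (Polynomial.aeval A R) *ᵥ u) hab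
  simp only [map_add, map_mul, aeval_self_charpoly, mul_zero, zero_add, map_one, one_mulVec,
    ← mulVec_mulVec, hPS, mulVec_zero] at h3
  apply hv
  ext j
  have := congrFun h3 j
  simp only [hu, Pi.zero_apply] at this
  exact_mod_cast this.symm

/-- An eigenvector of `S` can be read off from `m` consecutive vectors `S^k v`. -/
lemma exists_eigenvector_eq_sum {K : Type*} [Field K] [CharZero K]
    (hdet : (krylov S v).det ≠ 0) (θ : K) (w : Fin m → K)
    (hw : (S.map (Int.cast : ℤ → K)) *ᵥ w = θ • w) :
    ∃ q : Fin m → K, ∀ (k : ℕ) (i : Fin m),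
      θ ^ k * w i = ∑ j : Fin m, q j * (((S ^ (k + (j : ℕ))) *ᵥ v) i : K) := by
  set A := S.map (Int.cast : ℤ → K) with hA
  set V := (krylov S v).map (Int.cast : ℤ → K) with hV
  have hVdet : V.det ≠ 0 := by
    have := (Int.castRingHom K).map_det (krylov S v)
    intro h
    apply hdet
    have h2 : ((krylov S v).det : K) = 0 := by
      rw [← h]; exact this
    exact_mod_cast h2
  have hunit : IsUnit V.det := isUnit_iff_ne_zero.2 hVdet
  refine ⟨V⁻¹ *ᵥ w, fun k i => ?_⟩
  have hpow : ∀ k : ℕ, (A ^ k) *ᵥ w = θ ^ k • w := by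
    intro k
    induction k with
    | zero => simp
    | succ k ih => rw [pow_succ', ← mulVec_mulVec, ih, mulVec_smul, hw, smul_smul, pow_succ]
  have h1 : w = V *ᵥ (V⁻¹ *ᵥ w) := by rw [mulVec_mulVec, mul_nonsing_inv _ hunit, one_mulVec]
  set q := V⁻¹ *ᵥ w
  have h2 := congrFun (hpow k) i
  rw [Pi.smul_apply, smul_eq_mul] at h2
  rw [← h2, h1, mulVec_mulVec]
  change ∑ j, (A ^ k * V) i j * q j = _
  refine Finset.sum_congr rfl fun j _ => ?_
  rw [mul_comm]
  congr 1
  have h3 : _ = ((A ^ (k + (j : ℕ))) *ᵥ (fun j => (v j : K))) i :=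
    pow_mulVec_map (K := K) S v (k + j) i
  rw [pow_add A, ← mulVec_mulVec] at h3
  have h4 : (fun l => V l j) = (A ^ (j : ℕ)) *ᵥ (fun j => (v j : K)) := by
    ext l
    rw [← pow_mulVec_map]
    rfl
  rw [mul_apply]
  have h5 : ∑ l, (A ^ k) i l * V l j = ((A ^ k) *ᵥ (fun l => V l j)) i := rfl
  rw [h5, h4, ← h3]

/-- Cayley–Hamilton. The coefficients are integers, which later makes the defect of a rounded
sequence an integer. -/
lemma exists_recurrence :
    ∃ c : Fin m → ℤ, ∀ (k : ℕ) (i : Fin m),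
      ((S ^ (k + m)) *ᵥ v) i = ∑ j : Fin m, c j * ((S ^ (k + (j : ℕ))) *ᵥ v) i := by
  refine ⟨fun j => -S.charpoly.coeff j, fun k i => ?_⟩
  have h := aeval_self_charpoly S
  have hnat : S.charpoly.natDegree = m := by
    rw [charpoly_natDegree_eq_dim, Fintype.card_fin]
  have hlead : S.charpoly.coeff m = 1 := by
    have := S.charpoly_monic.coeff_natDegree
    rwa [hnat] at this
  rw [Polynomial.aeval_eq_sum_range, hnat, Finset.sum_range_succ, hlead, one_smul] at h
  have h2 : S ^ (k + m) = ∑ j : Fin m, (-S.charpoly.coeff j) • S ^ (k + (j : ℕ)) := by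
    rw [pow_add, eq_neg_of_add_eq_zero_right h, mul_neg, Finset.mul_sum,
      Finset.sum_range, ← Finset.sum_neg_distrib]
    refine Finset.sum_congr rfl fun j _ => ?_
    rw [mul_smul_comm, ← pow_add, neg_smul]
  rw [h2, sum_mulVec, Finset.sum_apply]
  refine Finset.sum_congr rfl fun j _ => ?_
  rw [smul_mulVec, Pi.smul_apply, smul_eq_mul]

end Matrix

/-! ### Eigenvalues outside the unit disc and contracting functionals -/

namespace Substitution

variable {m : ℕ} {ζ : Substitution m}

/-- With fewer than two letters there is no second eigenvalue and the default value `0` would have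
to exceed `1`. -/
lemma two_le_of_secondModulus (hθ : 1 < ζ.secondModulus) : 2 ≤ m := by
  by_contra hm
  have h1 : ζ.eigenvalueModuli.length ≤ 1 := by
    rw [eigenvalueModuli, Multiset.length_sort, Multiset.card_map]
    refine (Polynomial.card_roots' _).trans ?_
    rw [Matrix.charpoly_natDegree_eq_dim, Fintype.card_fin]
    omega
  rw [secondModulus, List.getD_eq_default _ _ h1] at hθ
  linarith

/-- If `|θ₂| > 1` and the eigenvalues are simple, then some eigenvalue other than a given number
lies outside the closed unit disc. -/
lemma exists_root_ne (hirr : Irreducible (ζ.matrix.map (Int.cast : ℤ → ℚ)).charpoly)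
    (hθ : 1 < ζ.secondModulus) (lam : ℂ) :
    ∃ θ : ℂ, (ζ.matrix.map (Int.cast : ℤ → ℂ)).charpoly.IsRoot θ ∧ θ ≠ lam ∧ 1 < ‖θ‖ := by
  set R := (ζ.matrix.map (Int.cast : ℤ → ℂ)).charpoly.roots with hR
  have hmap : (ζ.matrix.map (Int.cast : ℤ → ℂ)).charpoly =
      (ζ.matrix.map (Int.cast : ℤ → ℚ)).charpoly.map (algebraMap ℚ ℂ) := by
    rw [← Matrix.charpoly_map]
    congr 1
  -- Irreducible polynomials over `ℚ` are separable.
  have hnodup : R.Nodup := by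
    refine Polynomial.nodup_roots ?_
    rw [hmap]
    exact hirr.separable.map
  have hcount : 2 ≤ R.countP (fun z => 1 < ‖z‖) := by
    have h1 : R.countP (fun z => 1 < ‖z‖) = (R.map fun z => ‖z‖).countP (fun t => 1 < t) := by
      rw [Multiset.countP_map, Multiset.countP_eq_card_filter]
    have h2 : (R.map fun z => ‖z‖) = (ζ.eigenvalueModuli : Multiset ℝ) := by
      rw [eigenvalueModuli, Multiset.sort_eq]
    have hsort : ζ.eigenvalueModuli.Pairwise (· ≥ ·) := Multiset.pairwise_sort _ _
    rw [h1, h2, Multiset.coe_countP]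
    rw [secondModulus] at hθ
    match h : ζ.eigenvalueModuli with
    | [] => rw [h] at hθ; simp at hθ; linarith
    | [a] => rw [h] at hθ; simp at hθ; linarith
    | a :: b :: t =>
      rw [h] at hθ hsort
      simp only [List.getD_cons_succ, List.getD_cons_zero] at hθ
      have hab : b ≤ a := (List.pairwise_cons.1 hsort).1 b (by simp)
      rw [List.countP_cons_of_pos (by simpa using hθ.trans_le hab),
        List.countP_cons_of_pos (by simpa using hθ)]
      omega
  by_contra! hcon
  -- If `lam` were the only root outside the disc, it would be a repeated root.
  have hrep := (Multiset.eq_replicate_card (s := R.filter fun z => 1 < ‖z‖) (a := lam)).2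
    fun z hz => by
      obtain ⟨hzR, hz1⟩ := Multiset.mem_filter.1 hz
      by_contra hne
      exact absurd hz1 (not_lt.2 (hcon z (Polynomial.isRoot_of_mem_roots hzR) hne))
  have h3 := Multiset.nodup_iff_count_le_one.1 (hnodup.filter fun z => 1 < ‖z‖) lam
  rw [hrep, Multiset.count_replicate_self, ← Multiset.countP_eq_card_filter] at h3
  omega

open Matrix in
/-- Two independent linear functionals, one of them positive, that are controlled by the numbers
`⟨x, S^k v⟩` with an exponentially small error. -/
theorem exists_contracting_functionals (hprim : ζ.Primitive)
    (hirr : Irreducible (ζ.matrix.map (Int.cast : ℤ → ℚ)).charpoly)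
    (hθ : 1 < ζ.secondModulus) {v : Fin m → ℤ} (hv : v ≠ 0) :
    ∃ (w b : Fin m → ℝ) (C τ : ℝ), 0 < C ∧ 0 < τ ∧ τ < 1 ∧ (∀ i, 0 < w i) ∧ (∀ c : ℝ, b ≠ c • w) ∧
      ∀ (x : Fin m → ℝ) (k : ℕ) (D : ℝ),
        (∀ j < m, |∑ i, x i * (((ζ.matrix ^ (k + j)) *ᵥ v) i : ℝ)| ≤ D) →
          |∑ i, x i * w i| ≤ C * D * τ ^ k ∧ |∑ i, x i * b i| ≤ C * D * τ ^ k := by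
  have hm := two_le_of_secondModulus hθ
  have : NeZero m := ⟨by omega⟩
  have hdet := det_krylov_ne_zero ζ.matrix v hirr hv
  set A := ζ.matrix.map (Int.cast : ℤ → ℝ) with hA
  obtain ⟨p, -, hp⟩ := hprim.exists_pos_pow
  have hApow : A ^ p = (ζ.matrix ^ p).map (Int.cast : ℤ → ℝ) := by
    have := (map_pow (Int.castRingHom ℝ).mapMatrix ζ.matrix p).symm
    simpa using this
  obtain ⟨lam, w, hw, hAw, hmax⟩ := exists_perron_eigenvector A
    (fun i j => by simp [hA, matrix]) p
    (fun i j => by rw [hApow, map_apply]; exact_mod_cast hp i j)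
  obtain ⟨θ, hroot, hne, hθ1⟩ := exists_root_ne hirr hθ (lam : ℂ)
  have hAC : A.map Complex.ofReal = ζ.matrix.map (Int.cast : ℤ → ℂ) := by ext i j; simp [hA]
  obtain ⟨u, hu0, hu⟩ : ∃ u : Fin m → ℂ, u ≠ 0 ∧
      (ζ.matrix.map (Int.cast : ℤ → ℂ)) *ᵥ u = θ • u := by
    rw [Polynomial.IsRoot, eval_charpoly] at hroot
    obtain ⟨u, hu0, hu⟩ := exists_mulVec_eq_zero_iff.2 hroot
    refine ⟨u, hu0, ?_⟩
    rw [sub_mulVec, sub_eq_zero] at hu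
    rw [← hu]
    ext i
    simp [scalar_apply, mulVec_diagonal]
  have hlam1 : 1 < lam := hθ1.trans_le (hmax θ u hu0 (by rw [hAC, hu]))
  obtain ⟨q, hq⟩ := exists_eigenvector_eq_sum ζ.matrix v hdet lam w hAw
  obtain ⟨q', hq'⟩ := exists_eigenvector_eq_sum ζ.matrix v hdet θ u hu
  have hlamC : (ζ.matrix.map (Int.cast : ℤ → ℂ)) *ᵥ (fun i => (w i : ℂ)) =
      (lam : ℂ) • fun i => (w i : ℂ) := by
    ext i
    have := congrArg Complex.ofReal (congrFun hAw i)
    simp only [mulVec, dotProduct, hA, map_apply, Pi.smul_apply, smul_eq_mul, Complex.ofReal_sum,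
      Complex.ofReal_mul, Complex.ofReal_intCast] at this ⊢
    exact this
  have hnot : ¬ ∃ c : ℂ, u = c • fun i => (w i : ℂ) := by
    rintro ⟨c, rfl⟩
    rw [mulVec_smul, hlamC, smul_comm, ← sub_eq_zero, ← sub_smul] at hu
    rcases smul_eq_zero.1 hu with h | h
    · exact hne (sub_eq_zero.1 h).symm
    · exact hu0 h
  -- The eigenvalue `θ` may be non-real, so `b` is the real or the imaginary part of `u`. Both
  -- cannot be multiples of `w`, since `u` and `w` belong to different eigenvalues.
  obtain ⟨b, hb, hbu⟩ : ∃ b : Fin m → ℝ, (∀ c : ℝ, b ≠ c • w) ∧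
      ∀ x : Fin m → ℝ, |∑ i, x i * b i| ≤ ‖∑ i, (x i : ℂ) * u i‖ := by
    by_cases h : ∃ c : ℝ, (fun i => (u i).re) = c • w
    · refine ⟨fun i => (u i).im, fun c' hc' => ?_, fun x => ?_⟩
      · obtain ⟨c, hc⟩ := h
        refine hnot ⟨c + c' * Complex.I, ?_⟩
        ext i
        have h1 := congrFun hc i
        have h2 := congrFun hc' i
        simp only [Pi.smul_apply, smul_eq_mul] at h1 h2 ⊢
        rw [← Complex.re_add_im (u i), h1, h2]
        push_cast
        ring
      · refine le_trans (le_of_eq ?_) (Complex.abs_im_le_norm _)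
        simp
    · push Not at h
      refine ⟨fun i => (u i).re, h, fun x => ?_⟩
      refine le_trans (le_of_eq ?_) (Complex.abs_re_le_norm _)
      simp
  set τ := max lam⁻¹ ‖θ‖⁻¹ with hτ
  have hτ0 : 0 < τ := lt_max_of_lt_left (by positivity)
  set C := 1 + ∑ j, |q j| + ∑ j, ‖q' j‖ with hC
  have hs1 : 0 ≤ ∑ j, |q j| := by positivity
  have hs2 : 0 ≤ ∑ j, ‖q' j‖ := by positivity
  refine ⟨w, b, C, τ, by positivity, hτ0, max_lt (inv_lt_one_of_one_lt₀ hlam1)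
    (inv_lt_one_of_one_lt₀ hθ1), hw, hb, fun x k D hD => ?_⟩
  have hD0 : 0 ≤ D := (abs_nonneg _).trans (hD 0 (by omega))
  -- The left side grows like `lam ^ k` while the right side is bounded by a multiple of `D`; this
  -- is the source of the factor `τ ^ k`.
  have e1 : lam ^ k * ∑ i, x i * w i =
      ∑ j : Fin m, q j * ∑ i, x i * (((ζ.matrix ^ (k + (j : ℕ))) *ᵥ v) i : ℝ) := by
    simp only [Finset.mul_sum]
    rw [Finset.sum_comm]
    refine Finset.sum_congr rfl fun i _ => ?_
    rw [mul_left_comm, hq, Finset.mul_sum]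
    exact Finset.sum_congr rfl fun j _ => by ring
  have e2 : θ ^ k * ∑ i, (x i : ℂ) * u i =
      ∑ j : Fin m, q' j * ((∑ i, x i * (((ζ.matrix ^ (k + (j : ℕ))) *ᵥ v) i : ℝ) : ℝ) : ℂ) := by
    simp only [Finset.mul_sum, Complex.ofReal_sum]
    rw [Finset.sum_comm]
    refine Finset.sum_congr rfl fun i _ => ?_
    rw [mul_left_comm, hq', Finset.mul_sum]
    exact Finset.sum_congr rfl fun j _ => by push_cast; ring
  constructor
  · have h1 : lam ^ k * |∑ i, x i * w i| ≤ C * D := by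
      rw [← abs_of_pos (by positivity : 0 < lam ^ k), ← abs_mul, e1]
      calc _ ≤ ∑ j : Fin m, |q j| * D := by
            refine (Finset.abs_sum_le_sum_abs _ _).trans (Finset.sum_le_sum fun j _ => ?_)
            rw [abs_mul]
            exact mul_le_mul_of_nonneg_left (hD j j.2) (abs_nonneg _)
        _ ≤ C * D := by
          rw [← Finset.sum_mul]
          exact mul_le_mul_of_nonneg_right (by linarith) hD0
    calc |∑ i, x i * w i| = (lam⁻¹) ^ k * (lam ^ k * |∑ i, x i * w i|) := by
          rw [← mul_assoc, ← mul_pow, inv_mul_cancel₀ (by positivity), one_pow, one_mul]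
      _ ≤ τ ^ k * (C * D) := by
          gcongr
          exact le_max_left _ _
      _ = _ := by ring
  · have hθ0 : 0 < ‖θ‖ := by linarith
    have h1 : ‖θ‖ ^ k * |∑ i, x i * b i| ≤ C * D := by
      refine (mul_le_mul_of_nonneg_left (hbu x) (by positivity)).trans ?_
      rw [← norm_pow, ← norm_mul, e2]
      calc _ ≤ ∑ j : Fin m, ‖q' j‖ * D := by
            refine (norm_sum_le _ _).trans (Finset.sum_le_sum fun j _ => ?_)
            rw [norm_mul, Complex.norm_real]
            exact mul_le_mul_of_nonneg_left (hD j j.2) (norm_nonneg _)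
        _ ≤ C * D := by
          rw [← Finset.sum_mul]
          exact mul_le_mul_of_nonneg_right (by linarith) hD0
    calc |∑ i, x i * b i| = (‖θ‖⁻¹) ^ k * (‖θ‖ ^ k * |∑ i, x i * b i|) := by
          rw [← mul_assoc, ← mul_pow, inv_mul_cancel₀ (by positivity), one_pow, one_mul]
      _ ≤ τ ^ k * (C * D) := by
          gcongr
          exact le_max_right _ _
      _ = _ := by ring

end Substitution

end

/-! ### The Erdős–Kahane counting argument -/

noncomputable section

/-- The image is covered by one set of diameter at most `d` for each code. -/
lemma volume_image_le_card_mul {α ι : Type*} (B : Set α) (g : α → ℝ) (code : α → ι)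
    (I : Finset ι) (hcode : ∀ x ∈ B, code x ∈ I) {d : ℝ}
    (hd : ∀ x ∈ B, ∀ y ∈ B, code x = code y → |g x - g y| ≤ d) :
    volume (g '' B) ≤ I.card * ENNReal.ofReal d := by
  have hsub : g '' B ⊆ ⋃ i ∈ I, g '' {x ∈ B | code x = i} := by
    rintro _ ⟨x, hx, rfl⟩
    simp only [mem_iUnion]
    exact ⟨code x, hcode x hx, x, ⟨hx, rfl⟩, rfl⟩
  refine (measure_mono hsub).trans ((measure_biUnion_finset_le I _).trans ?_)
  rw [← nsmul_eq_mul, ← Finset.sum_const]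
  refine Finset.sum_le_sum fun i _ => (Real.volume_le_diam _).trans ?_
  refine Metric.ediam_le ?_
  rintro _ ⟨x, hx, rfl⟩ _ ⟨y, hy, rfl⟩
  rw [edist_dist, Real.dist_eq]
  exact ENNReal.ofReal_le_ofReal (hd x hx.1 y hy.1 (hx.2.trans hy.2.symm))

/-- The number of sparse integer sequences. -/
lemma card_sparse_le (n H : ℕ) (J : ℝ) {t : ℝ} (ht : 0 < t) (ht1 : t ≤ 1) :
    (((Fintype.piFinset fun _ : Fin n => Finset.Icc (-H : ℤ) H).filter fun e =>
      ((Finset.univ.filter fun k => e k ≠ 0).card : ℝ) ≤ J).card : ℝ) * t ^ J ≤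
        (1 + 2 * H * t) ^ n := by
  -- Exponential-moment bound: give a sequence the weight `t` to the number of its nonzero terms.
  -- The total weight factorizes, and each sparse sequence weighs at least `t ^ J`.
  have hsum : ∑ e ∈ Finset.Icc (-H : ℤ) H, (if e = 0 then 1 else t) = 1 + 2 * H * t := by
    have h0 : (0 : ℤ) ∈ Finset.Icc (-H : ℤ) H := by simp
    rw [← Finset.add_sum_erase _ _ h0, if_pos rfl]
    congr 1
    rw [Finset.sum_congr rfl (g := fun _ => t) fun e he => if_neg (Finset.ne_of_mem_erase he),
      Finset.sum_const, Finset.card_erase_of_mem h0, Int.card_Icc, nsmul_eq_mul]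
    congr 1
    have : ((H : ℤ) + 1 - -(H : ℤ)).toNat - 1 = 2 * H := by omega
    rw [this]; push_cast; ring
  have hprod : ∑ e ∈ Fintype.piFinset fun _ : Fin n => Finset.Icc (-H : ℤ) H,
      ∏ k, (if e k = 0 then 1 else t) = (1 + 2 * H * t) ^ n := by
    have h := Finset.prod_univ_sum (fun _ : Fin n => Finset.Icc (-H : ℤ) H)
      (fun _ e => if e = 0 then 1 else t)
    rw [← h]
    simp [hsum]
  rw [← hprod, ← nsmul_eq_mul, ← Finset.sum_const]
  refine (Finset.sum_le_sum fun e he => ?_).trans (Finset.sum_le_sum_of_subset_of_nonneg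
    (Finset.filter_subset _ _) fun e _ _ => Finset.prod_nonneg fun k _ => by split_ifs <;> positivity)
  have h1 : ∏ k, (if e k = 0 then 1 else t) = t ^ ((Finset.univ.filter fun k => e k ≠ 0).card) := by
    rw [Finset.prod_ite]; simp
  rw [h1, ← Real.rpow_natCast]
  exact Real.rpow_le_rpow_of_exponent_ge ht ht1 (Finset.mem_filter.1 he).2

/-- Each `k` is charged to an element of `G` at distance at most `m`, which receives at most `m + 1`
charges; the summand `m` pays for those `k` whose charge falls beyond `n`. -/
lemma count_shift_card_le (n m : ℕ) (G Q : ℕ → Prop) [DecidablePred G] [DecidablePred Q]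
    (h : ∀ k, Q k → ∃ j ≤ m, G (k + j)) :
    (Finset.univ.filter fun k : Fin n => Q k).card ≤ (m + 1) * Nat.count G n + m := by
  set T : Finset ℕ := (Finset.range n).filter G
  have hT : T.card = Nat.count G n := (Nat.count_eq_card_filter_range G n).symm
  have h1 : (Finset.univ.filter fun k : Fin n => Q k).card ≤
      ((Finset.range n).filter Q).card := by
    refine Finset.card_le_card_of_injOn (fun k : Fin n => (k : ℕ)) (fun k hk => ?_)
      (fun a _ b _ hab => Fin.ext hab)
    simp only [Finset.coe_filter, Finset.mem_univ, true_and, mem_ofPred_eq, Finset.mem_range] at hk ⊢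
    exact ⟨k.2, hk⟩
  have h2 : (Finset.range n).filter Q ⊆ Finset.Ico (n - m) n ∪
      (Finset.range (m + 1)).biUnion fun j => (Finset.range n).filter fun k => k + j ∈ T := by
    intro k hk
    obtain ⟨hkn, hQ⟩ := Finset.mem_filter.1 hk
    have hkn' := Finset.mem_range.1 hkn
    obtain ⟨j, hj, hG⟩ := h k hQ
    by_cases hlt : k + j < n
    · refine Finset.mem_union_right _ (Finset.mem_biUnion.2 ⟨j, Finset.mem_range.2 (by omega), ?_⟩)
      exact Finset.mem_filter.2 ⟨hkn, Finset.mem_filter.2 ⟨Finset.mem_range.2 hlt, hG⟩⟩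
    · exact Finset.mem_union_left _ (Finset.mem_Ico.2 ⟨by omega, hkn'⟩)
  have h3 : ∀ j ∈ Finset.range (m + 1),
      ((Finset.range n).filter fun k => k + j ∈ T).card ≤ Nat.count G n := fun j _ => by
    rw [← hT]
    exact Finset.card_le_card_of_injOn (fun k => k + j)
      (fun k hk => (Finset.mem_filter.1 hk).2) (fun a _ b _ hab => by simpa using hab)
  have h4 := (Finset.card_le_card h2).trans (Finset.card_union_le _ _)
  have h5 := Finset.card_biUnion_le_card_mul (Finset.range (m + 1)) _ _ h3
  rw [Finset.card_range] at h5
  rw [Nat.card_Ico] at h4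
  omega

/-- Integer sequences satisfying the same perturbed linear recurrence with the same initial data
agree. -/
lemma eq_of_recurrence {m n : ℕ} (c : Fin m → ℤ) {K K' : ℕ → ℤ}
    (h0 : ∀ j < m, K j = K' j)
    (h : ∀ k < n, K (k + m) - ∑ j : Fin m, c j * K (k + j) =
      K' (k + m) - ∑ j : Fin m, c j * K' (k + j)) : ∀ k < n + m, K k = K' k := by
  intro k
  induction k using Nat.strong_induction_on with
  | _ k ih =>
    intro hk
    rcases lt_or_ge k m with hkm | hkm
    · exact h0 k hkm
    · obtain ⟨l, rfl⟩ := Nat.exists_eq_add_of_le' hkm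
      have h1 := h l (by omega)
      have h2 : ∑ j : Fin m, c j * K (l + j) = ∑ j : Fin m, c j * K' (l + j) :=
        Finset.sum_congr rfl fun j _ => by rw [ih (l + j) (by omega) (by omega)]
      omega

section ErdosKahane

variable {m : ℕ} (u : ℕ → Fin m → ℤ)

/-- The pairing of a real vector with the `k`-th vector of an integer sequence. -/
def pairing (x : Fin m → ℝ) (k : ℕ) : ℝ := ∑ i, x i * (u k i : ℝ)

/-- The pairing at `k` is at distance at least `ρ` from the integers. -/
def OffIntegers (ρ : ℝ) (x : Fin m → ℝ) (k : ℕ) : Prop :=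
  ρ ≤ |pairing u x k - round (pairing u x k)|

instance (ρ : ℝ) (x : Fin m → ℝ) : DecidablePred (OffIntegers u ρ x) :=
  fun _ => inferInstanceAs (Decidable (_ ≤ _))

/-- The pairs of a roof vector and a frequency, bounded above and below by `e^{±κn}`, for which few
of the first `n` pairings are off the integers. -/
def badPairs (ρ κ η : ℝ) (n : ℕ) : Set ((Fin m → ℝ) × ℝ) :=
  {y | y.1 ∈ openSimplex m ∧ Real.exp (-(κ * n)) ≤ |y.2| ∧ |y.2| ≤ Real.exp (κ * n) ∧
    (Nat.count (OffIntegers u ρ (y.2 • y.1)) n : ℝ) < η * n}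

/-- The projective coordinate of a roof vector determined by two linear functionals. -/
def projCoord (w b : Fin m → ℝ) (s : Fin m → ℝ) : ℝ := (∑ i, s i * b i) / ∑ i, s i * w i

lemma defect_eq (c : Fin m → ℤ)
    (hu : ∀ k i, u (k + m) i = ∑ j : Fin m, c j * u (k + j) i) (x : Fin m → ℝ) (k : ℕ) :
    pairing u x (k + m) = ∑ j : Fin m, (c j : ℝ) * pairing u x (k + j) := by
  simp only [pairing, Finset.mul_sum]
  rw [Finset.sum_comm]
  refine Finset.sum_congr rfl fun i _ => ?_
  rw [hu]
  push_cast
  rw [Finset.mul_sum]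
  exact Finset.sum_congr rfl fun j _ => by ring

/-- The defect of the rounded pairings with respect to the recurrence. -/
def defect (c : Fin m → ℤ) (x : Fin m → ℝ) (k : ℕ) : ℤ :=
  round (pairing u x (k + m)) - ∑ j : Fin m, c j * round (pairing u x (k + j))

/-- The pairings satisfy the recurrence exactly, so only rounding errors contribute to the defect.
-/
lemma abs_defect_le (c : Fin m → ℤ)
    (hu : ∀ k i, u (k + m) i = ∑ j : Fin m, c j * u (k + j) i) (x : Fin m → ℝ) (k : ℕ) {ε : ℝ}
    (hε : ∀ j ≤ m, |pairing u x (k + j) - round (pairing u x (k + j))| ≤ ε) :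
    |(defect u c x k : ℝ)| ≤ (1 + ∑ j, |(c j : ℝ)|) * ε := by
  have e : (defect u c x k : ℝ) = -(pairing u x (k + m) - round (pairing u x (k + m))) +
      ∑ j : Fin m, (c j : ℝ) * (pairing u x (k + j) - round (pairing u x (k + j))) := by
    have h := defect_eq u c hu x k
    simp only [mul_sub, Finset.sum_sub_distrib, ← h, defect]
    push_cast
    ring
  rw [e, add_mul, one_mul, Finset.sum_mul]
  refine (abs_add_le _ _).trans (add_le_add ?_ ?_)
  · rw [abs_neg]; exact hε m le_rfl
  · refine (Finset.abs_sum_le_sum_abs _ _).trans (Finset.sum_le_sum fun j _ => ?_)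
    rw [abs_mul]
    exact mul_le_mul_of_nonneg_left (hε j j.2.le) (abs_nonneg _)

variable {u}

/-- A bad pair is coded by its first `m` rounded pairings and its first `n` defects, most of which
vanish. The three factors of the bound count the initial data, count the defect sequences, and bound
the spread of the projective coordinate for a given code. -/
lemma volume_badPairs_le [NeZero m] (c : Fin m → ℤ)
    (hu : ∀ k i, u (k + m) i = ∑ j : Fin m, c j * u (k + j) i)
    {w b : Fin m → ℝ} {C τ : ℝ} (hC : 0 < C) (hτ : 0 < τ) (hw : ∀ i, 0 < w i)
    (hcon : ∀ (x : Fin m → ℝ) (k : ℕ) (D : ℝ), (∀ j < m, |pairing u x (k + j)| ≤ D) →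
      |∑ i, x i * w i| ≤ C * D * τ ^ k ∧ |∑ i, x i * b i| ≤ C * D * τ ^ k)
    (H : ℕ) (hH : (1 + ∑ j, |(c j : ℝ)|) ≤ H) :
    ∃ C' : ℝ, 0 < C' ∧ ∀ (κ η t : ℝ), 0 < κ → 0 < η → 0 < t → t ≤ 1 → ∀ n : ℕ,
      volume ((fun y => projCoord w b y.1) '' badPairs u (1 / H) κ η n) ≤
        ENNReal.ofReal ((C' * Real.exp (κ * n)) ^ m *
          (t ^ (-((m + 1) * (η * n) + m)) * (1 + 2 * H * t) ^ n) *
            (C' * τ ^ n * Real.exp (κ * n))) := by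
  have hH1 : (1 : ℝ) ≤ H := by
    have : 0 ≤ ∑ j, |(c j : ℝ)| := by positivity
    linarith
  obtain ⟨i₀, -, hi₀⟩ := Finset.exists_min_image Finset.univ w Finset.univ_nonempty
  set w₀ := w i₀ with hw₀
  have hw0 : 0 < w₀ := hw i₀
  set B := ∑ i, |b i| with hB
  have hB0 : 0 ≤ B := by positivity
  set U : ℝ := ∑ j : Fin m, ∑ i, |(u j i : ℝ)| with hU
  have hU0 : 0 ≤ U := by positivity
  set C' := max (2 * U + 5) ((1 + B / w₀) * C / w₀) with hC'
  have hC'0 : 0 < C' := lt_max_of_lt_left (by positivity)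
  refine ⟨C', hC'0, fun κ η t hκ hη ht ht1 n => ?_⟩
  set E := Real.exp (κ * n) with hE
  have hE1 : 1 ≤ E := Real.one_le_exp (by positivity)
  have hsimp : ∀ s ∈ openSimplex m, (∀ i, s i ≤ 1) ∧ w₀ ≤ ∑ i, s i * w i ∧
      |∑ i, s i * b i| ≤ B := by
    intro s hs
    have h1 : ∀ i, s i ≤ 1 := fun i => by
      rw [← hs.2]
      exact Finset.single_le_sum (fun k _ => (hs.1 k).le) (Finset.mem_univ i)
    refine ⟨h1, ?_, ?_⟩
    · calc w₀ = ∑ i, s i * w₀ := by rw [← Finset.sum_mul, hs.2, one_mul]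
        _ ≤ _ := Finset.sum_le_sum fun i _ =>
          mul_le_mul_of_nonneg_left (hi₀ i (Finset.mem_univ i)) (hs.1 i).le
    · refine (Finset.abs_sum_le_sum_abs _ _).trans (Finset.sum_le_sum fun i _ => ?_)
      rw [abs_mul, abs_of_pos (hs.1 i)]
      exact mul_le_of_le_one_left (abs_nonneg _) (h1 i)
  -- Bounds the rounded initial pairings, since `|ω| ≤ E` and the coordinates of `s` are at most
  -- `1`.
  set N : ℕ := ⌈U * E⌉₊ + 1 with hN
  have hNle : ((2 * N + 1 : ℕ) : ℝ) ≤ C' * E := by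
    have h1 : (⌈U * E⌉₊ : ℝ) < U * E + 1 := Nat.ceil_lt_add_one (by positivity)
    have h2 : (2 * U + 5) * E ≤ C' * E := by gcongr; exact le_max_left _ _
    rw [hN]; push_cast
    nlinarith
  set J : ℝ := (m + 1) * (η * n) + m with hJ
  set I₁ := Fintype.piFinset fun _ : Fin m => Finset.Icc (-N : ℤ) N
  set I₂ := (Fintype.piFinset fun _ : Fin n => Finset.Icc (-H : ℤ) H).filter fun e =>
      ((Finset.univ.filter fun k => e k ≠ 0).card : ℝ) ≤ J
  have hI₁ : I₁.card = (2 * N + 1) ^ m := by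
    rw [Fintype.card_piFinset_const, Int.card_Icc]
    congr 1
    omega
  have hI₂ : (I₂.card : ℝ) ≤ t ^ (-J) * (1 + 2 * H * t) ^ n := by
    have h := card_sparse_le n H J ht ht1
    rw [Real.rpow_neg ht.le, inv_mul_eq_div, le_div_iff₀ (Real.rpow_pos_of_pos ht J)]
    exact h
  have hmain := volume_image_le_card_mul (badPairs u (1 / H) κ η n)
    (fun y => projCoord w b y.1)
    (fun y => ((fun j : Fin m => round (pairing u (y.2 • y.1) j)),
      fun k : Fin n => defect u c (y.2 • y.1) k)) (I₁ ×ˢ I₂) ?_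
    (d := C' * τ ^ n * E) ?_
  · refine hmain.trans ?_
    rw [Finset.card_product, ← ENNReal.ofReal_natCast, ← ENNReal.ofReal_mul (by positivity)]
    apply ENNReal.ofReal_le_ofReal
    rw [hI₁]
    push_cast at hNle ⊢
    gcongr
  · rintro ⟨s, ω⟩ ⟨hs, hω1, hω2, hcount⟩
    simp only at hs hω1 hω2 hcount
    obtain ⟨hs1, -, -⟩ := hsimp s hs
    refine Finset.mem_product.2 ⟨Fintype.mem_piFinset.2 fun j => ?_, Finset.mem_filter.2
      ⟨Fintype.mem_piFinset.2 fun k => ?_, ?_⟩⟩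
    · have h1 : |pairing u (ω • s) j| ≤ U * E := by
        calc |pairing u (ω • s) j| ≤ ∑ i, E * |(u j i : ℝ)| := by
              refine (Finset.abs_sum_le_sum_abs _ _).trans (Finset.sum_le_sum fun i _ => ?_)
              rw [abs_mul, Pi.smul_apply, smul_eq_mul, abs_mul, abs_of_pos (hs.1 i)]
              have := mul_le_mul hω2 (hs1 i) (hs.1 i).le (by positivity)
              rw [mul_one] at this
              gcongr
          _ = E * ∑ i, |(u j i : ℝ)| := by rw [Finset.mul_sum]
          _ ≤ E * U := by
              gcongr
              exact Finset.single_le_sum (f := fun j : Fin m => ∑ i, |(u j i : ℝ)|)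
                (fun _ _ => by positivity) (Finset.mem_univ j)
          _ = _ := mul_comm _ _
      have h2 := abs_sub_round (pairing u (ω • s) j)
      have h3 : |(round (pairing u (ω • s) j) : ℝ)| ≤ N := by
        have := Nat.le_ceil (U * E)
        rw [hN]; push_cast
        rw [abs_le] at *
        constructor <;> linarith
      rw [Finset.mem_Icc, ← abs_le]
      exact_mod_cast h3
    · have h1 := abs_defect_le u c hu (ω • s) k (ε := 1 / 2) fun j _ => abs_sub_round _
      have h2 : |(defect u c (ω • s) k : ℝ)| ≤ H := by
        have : 0 ≤ 1 + ∑ j, |(c j : ℝ)| := by positivity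
        linarith
      rw [Finset.mem_Icc, ← abs_le]
      exact_mod_cast h2
    -- If all of `m + 1` consecutive pairings are within `1 / H` of integers, the defect is an
    -- integer of modulus below `1`, hence zero.
    · have h1 := count_shift_card_le n m (OffIntegers u (1 / H) (ω • s))
        (fun k => defect u c (ω • s) k ≠ 0) fun k hk => by
          by_contra! hno
          apply hk
          obtain ⟨j₀, hj₀, hj₀'⟩ := Finset.exists_max_image (Finset.range (m + 1))
            (fun j => |pairing u (ω • s) (k + j) - round (pairing u (ω • s) (k + j))|)
            ⟨0, by simp⟩
          have h2 := abs_defect_le u c hu (ω • s) k fun j hj =>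
            hj₀' j (Finset.mem_range.2 (by omega))
          have h3 := hno j₀ (by have := Finset.mem_range.1 hj₀; omega)
          rw [OffIntegers, not_le] at h3
          have h4 : |(defect u c (ω • s) k : ℝ)| < 1 := by
            refine h2.trans_lt ?_
            calc _ ≤ (H : ℝ) * |pairing u (ω • s) (k + j₀) -
                  round (pairing u (ω • s) (k + j₀))| := by gcongr
              _ < H * (1 / H) := by gcongr
              _ = 1 := by field_simp
          have h5 : |defect u c (ω • s) k| < 1 := by exact_mod_cast h4
          exact Int.abs_lt_one_iff.1 h5
      have h2 : ((Finset.univ.filter fun k : Fin n => defect u c (ω • s) k ≠ 0).card : ℝ) ≤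
          (m + 1) * (Nat.count (OffIntegers u (1 / H) (ω • s)) n : ℝ) + m := by exact_mod_cast h1
      refine h2.trans ?_
      rw [hJ]
      gcongr
  · rintro ⟨s, ω⟩ ⟨hs, hω1, hω2, hcount⟩ ⟨s', ω'⟩ ⟨hs', -, -, -⟩ heq
    simp only [Prod.mk.injEq] at heq hs hω1 hω2 hs' ⊢
    obtain ⟨heq1, heq2⟩ := heq
    have hK := eq_of_recurrence (n := n) c
      (K := fun k => round (pairing u (ω • s) k)) (K' := fun k => round (pairing u (ω' • s') k))
      (fun j hj => congrFun heq1 ⟨j, hj⟩) (fun k hk => congrFun heq2 ⟨k, hk⟩)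
    -- Equal codes give equal rounded pairings up to index `n + m`, so the pairings themselves
    -- differ by at most `1`.
    obtain ⟨hcw, hcb⟩ := hcon (ω • s - ω' • s') n 1 fun j hj => by
      have e : pairing u (ω • s - ω' • s') (n + j) =
          pairing u (ω • s) (n + j) - pairing u (ω' • s') (n + j) := by
        simp only [pairing, Pi.sub_apply, sub_mul, Finset.sum_sub_distrib]
      have h1 := abs_sub_round (pairing u (ω • s) (n + j))
      have h2 := abs_sub_round (pairing u (ω' • s') (n + j))
      have h3 : round (pairing u (ω • s) (n + j)) = round (pairing u (ω' • s') (n + j)) :=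
        hK (n + j) (by omega)
      rw [← h3] at h2
      rw [e]
      rw [abs_le] at *
      constructor <;> linarith
    obtain ⟨-, ha, hb⟩ := hsimp s hs
    obtain ⟨-, ha', hb'⟩ := hsimp s' hs'
    have hlin : ∀ d : Fin m → ℝ, ∑ i, (ω • s - ω' • s') i * d i =
        ω * ∑ i, s i * d i - ω' * ∑ i, s' i * d i := by
      intro d
      simp only [Pi.sub_apply, Pi.smul_apply, smul_eq_mul, sub_mul, Finset.sum_sub_distrib,
        Finset.mul_sum, mul_assoc]
    rw [hlin] at hcw hcb
    rw [mul_one] at hcw hcb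
    simp only [projCoord]
    set a := ∑ i, s i * w i
    set a' := ∑ i, s' i * w i
    set β := ∑ i, s i * b i
    set β' := ∑ i, s' i * b i
    have hapos : 0 < a := hw0.trans_le ha
    have hapos' : 0 < a' := hw0.trans_le ha'
    have hg' : |β' / a'| ≤ B / w₀ := by
      rw [abs_div, abs_of_pos hapos']
      gcongr
    have hEinv : E⁻¹ ≤ |ω| := by rw [hE, ← Real.exp_neg]; exact hω1
    have hωa : E⁻¹ * w₀ ≤ |ω * a| := by
      rw [abs_mul, abs_of_pos hapos]
      gcongr
    have hωa0 : 0 < |ω * a| := lt_of_lt_of_le (by positivity) hωa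
    -- Only the differences `ω β - ω' β'` and `ω a - ω' a'` are known to be small; the identity
    -- passes to the ratios, and the lower bound on `|ω|` permits the division.
    have key : (β / a - β' / a') * (ω * a) =
        (ω * β - ω' * β') - β' / a' * (ω * a - ω' * a') := by
      field_simp
      ring
    have h1 : |β / a - β' / a'| * |ω * a| ≤ (1 + B / w₀) * (C * τ ^ n) := by
      rw [← abs_mul, key]
      refine (abs_sub _ _).trans ?_
      rw [add_mul, one_mul, abs_mul]
      gcongr
    have h2 : |β / a - β' / a'| * (E⁻¹ * w₀) ≤ (1 + B / w₀) * (C * τ ^ n) :=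
      (mul_le_mul_of_nonneg_left hωa (abs_nonneg _)).trans h1
    have h3 : |β / a - β' / a'| ≤ ((1 + B / w₀) * C / w₀) * τ ^ n * E := by
      rw [← le_div_iff₀ (by positivity)] at h2
      refine h2.trans (le_of_eq ?_)
      field_simp
    refine h3.trans ?_
    gcongr
    exact le_max_right _ _

/-- The Erdős–Kahane argument: outside a null set of projective coordinates, a positive proportion
of the pairings is off the integers. -/
theorem exists_erdos_kahane [NeZero m] (c : Fin m → ℤ)
    (hu : ∀ k i, u (k + m) i = ∑ j : Fin m, c j * u (k + j) i)
    {w b : Fin m → ℝ} {C τ : ℝ} (hC : 0 < C) (hτ : 0 < τ) (hτ1 : τ < 1) (hw : ∀ i, 0 < w i)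
    (hcon : ∀ (x : Fin m → ℝ) (k : ℕ) (D : ℝ), (∀ j < m, |pairing u x (k + j)| ≤ D) →
      |∑ i, x i * w i| ≤ C * D * τ ^ k ∧ |∑ i, x i * b i| ≤ C * D * τ ^ k) :
    ∃ (ρ κ η : ℝ) (N : Set ℝ), 0 < ρ ∧ ρ ≤ 1 ∧ 0 < κ ∧ 0 < η ∧ volume N = 0 ∧
      ∀ s ∈ openSimplex m, projCoord w b s ∉ N → ∃ n₀ : ℕ, ∀ n ≥ n₀, ∀ ω : ℝ,
        Real.exp (-(κ * n)) ≤ |ω| → |ω| ≤ Real.exp (κ * n) →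
          η * n ≤ Nat.count (OffIntegers u ρ (ω • s)) n := by
  obtain ⟨H, hH⟩ := exists_nat_ge (1 + ∑ j, |(c j : ℝ)|)
  have hH1 : (1 : ℝ) ≤ H := by
    have : 0 ≤ ∑ j, |(c j : ℝ)| := by positivity
    linarith
  obtain ⟨C', hC', hvol⟩ := volume_badPairs_le c hu hC hτ hw hcon H hH
  -- The contraction is `τ ^ n = e^{-4an}`. The choices of `t`, `η` and `κ` let the values at the
  -- defects, their sparsity and the range of `ω` each cost at most `e^{an}`, which leaves
  -- `e^{-an}`.
  set a : ℝ := -Real.log τ / 4 with ha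
  have ha0 : 0 < a := by have := Real.log_neg hτ hτ1; rw [ha]; linarith
  set t : ℝ := min (1 / 2) (a / (2 * H)) with ht
  have ht0 : 0 < t := lt_min (by norm_num) (by positivity)
  have ht1 : t < 1 := (min_le_left _ _).trans_lt (by norm_num)
  have hHt : 1 + 2 * H * t ≤ Real.exp a := by
    have : 2 * H * t ≤ a := by
      calc 2 * H * t ≤ 2 * H * (a / (2 * H)) := by gcongr; exact min_le_right _ _
        _ = a := by field_simp
    linarith [Real.add_one_le_exp a]
  have hlogt : Real.log t < 0 := Real.log_neg ht0 ht1
  have hm1 : (0 : ℝ) < m + 1 := by positivity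
  set η : ℝ := a / ((m + 1) * -Real.log t) with hη
  have hη0 : 0 < η := div_pos ha0 (mul_pos hm1 (by linarith))
  set κ : ℝ := a / (m + 1) with hκ
  have hκ0 : 0 < κ := by positivity
  set A := C' ^ m * t ^ (-(m : ℝ)) * C' with hA
  have hA0 : 0 < A := by have := Real.rpow_pos_of_pos ht0 (-(m : ℝ)); positivity
  set P : ℕ → Set ℝ := fun n => (fun y => projCoord w b y.1) '' badPairs u (1 / H) κ η n with hP
  have hbound : ∀ n, volume (P n) ≤ ENNReal.ofReal (A * Real.exp (-a) ^ n) := by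
    intro n
    refine (hvol κ η t hκ0 hη0 ht0 ht1.le n).trans (ENNReal.ofReal_le_ofReal ?_)
    have e1 : t ^ (-((m + 1) * (η * n) + m)) = t ^ (-(m : ℝ)) * Real.exp a ^ n := by
      rw [neg_add, Real.rpow_add ht0, mul_comm]
      congr 1
      rw [Real.rpow_def_of_pos ht0, ← Real.exp_nat_mul]
      congr 1
      rw [hη]
      have : Real.log t ≠ 0 := hlogt.ne
      field_simp
    have e2 : τ ^ n = Real.exp (-(4 * a)) ^ n := by
      congr 1
      rw [ha, show -(4 * (-Real.log τ / 4)) = Real.log τ by ring, Real.exp_log hτ]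
    have e3 : Real.exp (κ * n) ^ m * Real.exp (κ * n) = Real.exp a ^ n := by
      rw [← pow_succ, ← Real.exp_nat_mul, ← Real.exp_nat_mul]
      congr 1
      rw [hκ]
      push_cast
      field_simp
    calc (C' * Real.exp (κ * n)) ^ m * (t ^ (-((m + 1) * (η * n) + m)) * (1 + 2 * H * t) ^ n) *
            (C' * τ ^ n * Real.exp (κ * n))
        ≤ (C' * Real.exp (κ * n)) ^ m * (t ^ (-((m + 1) * (η * n) + m)) * Real.exp a ^ n) *
            (C' * τ ^ n * Real.exp (κ * n)) := by
          have := Real.rpow_pos_of_pos ht0 (-((m + 1) * (η * n) + m))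
          gcongr
      _ = A * (Real.exp a ^ n * Real.exp a ^ n * (Real.exp (κ * n) ^ m * Real.exp (κ * n)) *
            Real.exp (-(4 * a)) ^ n) := by
          rw [e1, e2, hA, mul_pow]; ring
      _ = A * Real.exp (-a) ^ n := by
          rw [e3, ← mul_pow, ← mul_pow, ← mul_pow, ← Real.exp_add, ← Real.exp_add,
            ← Real.exp_add]
          congr 3
          ring
  have hsum : ∑' n, volume (P n) ≠ ⊤ := by
    have hs : Summable fun n : ℕ => A * Real.exp (-a) ^ n :=
      (summable_geometric_of_lt_one (Real.exp_pos _).le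
        (Real.exp_lt_one_iff.2 (by linarith))).mul_left A
    refine ne_top_of_le_ne_top ?_ (ENNReal.tsum_le_tsum hbound)
    rw [← ENNReal.ofReal_tsum_of_nonneg (fun n => by positivity) hs]
    exact ENNReal.ofReal_ne_top
  -- Borel–Cantelli. The frequency is part of the bad pair and is projected away, so `n₀` does not
  -- depend on `ω`.
  refine ⟨1 / H, κ, η, Filter.limsup P Filter.atTop, by positivity,
    (div_le_one (by positivity)).2 hH1, hκ0, hη0, measure_limsup_atTop_eq_zero hsum,
    fun s hs hN => ?_⟩
  rw [Filter.mem_limsup_iff_frequently_mem, Filter.not_frequently,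
    Filter.eventually_atTop] at hN
  obtain ⟨n₀, hn₀⟩ := hN
  refine ⟨n₀, fun n hn ω h1 h2 => ?_⟩
  by_contra! hlt
  exact hn₀ n hn ⟨(s, ω), ⟨hs, h1, h2, hlt⟩, rfl⟩

end ErdosKahane

end

/-! ### From null sets of ratios to null sets of the simplex -/

noncomputable section

/-- The linear parametrization of `ℝ^(k+1)` by the coordinate sum and the last `k` coordinates. -/
def sumCoord (k : ℕ) : (ℝ × (Fin k → ℝ)) →ₗ[ℝ] (Fin (k + 1) → ℝ) where
  toFun y := Fin.cons (y.1 - ∑ i, y.2 i) y.2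
  map_add' y z := by
    ext i
    refine Fin.cases ?_ (fun i => ?_) i
    · simp [Finset.sum_add_distrib]; ring
    · simp
  map_smul' c y := by
    ext i
    refine Fin.cases ?_ (fun i => ?_) i
    · simp [← Finset.mul_sum, mul_sub]
    · simp

lemma sumCoord_surj {k : ℕ} (x : Fin (k + 1) → ℝ) :
    sumCoord k (∑ i, x i, fun i => x i.succ) = x := by
  ext i
  refine Fin.cases ?_ (fun i => ?_) i
  · simp [sumCoord, Fin.sum_univ_succ]
  · simp [sumCoord]

lemma volume_preimage_affine_eq_zero {N : Set ℝ} (hN : volume N = 0) (p : ℝ) {q : ℝ}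
    (hq : q ≠ 0) : volume {t : ℝ | p + q * t ∈ N} = 0 := by
  have : {t : ℝ | p + q * t ∈ N} = (fun t => q * t) ⁻¹' ((fun t => p + t) ⁻¹' N) := rfl
  rw [this, Real.volume_preimage_mul_left hq, measure_preimage_add, hN, mul_zero]

/-- The cone over a null set of projective coordinates is null. -/
lemma volume_cone_eq_zero {k : ℕ} {w b : Fin (k + 1) → ℝ} (hb : ∀ c : ℝ, b ≠ c • w) {N : Set ℝ}
    (hNm : MeasurableSet N) (hN : volume N = 0) :
    ∀ᵐ y : ℝ × (Fin k → ℝ),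
      ¬ (∑ i, sumCoord k y i * w i ≠ 0 ∧ projCoord w b (sumCoord k y) ∈ N) := by
  have hcont : Continuous (sumCoord k) := LinearMap.continuous_of_finiteDimensional _
  have hcoord : ∀ i, Continuous fun y => sumCoord k y i := fun i => (continuous_apply i).comp hcont
  have hmeas : MeasurableSet {y : ℝ × (Fin k → ℝ) |
      ¬ (∑ i, sumCoord k y i * w i ≠ 0 ∧ projCoord w b (sumCoord k y) ∈ N)} := by
    have h1 : Measurable fun y => ∑ i, sumCoord k y i * w i :=
      Finset.measurable_sum _ fun i _ => (hcoord i).measurable.mul_const _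
    have h2 : Measurable fun y => ∑ i, sumCoord k y i * b i :=
      Finset.measurable_sum _ fun i _ => (hcoord i).measurable.mul_const _
    exact ((h1 (measurableSet_singleton 0).compl).inter ((h2.div h1) hNm)).compl
  -- In the direction `u` the denominator of the projective coordinate is constant and the numerator
  -- has nonzero slope. If no such `u` existed, the component of `b` orthogonal to `w` would vanish.
  obtain ⟨u, hu1, hu2⟩ : ∃ u : Fin (k + 1) → ℝ, ∑ i, u i * w i = 0 ∧ ∑ i, u i * b i ≠ 0 := by
    by_contra! hno
    have hww : ∑ i, w i * w i ≠ 0 := by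
      intro h0
      have hw0 : w = 0 := by
        ext i
        have := (Finset.sum_eq_zero_iff_of_nonneg fun i _ => mul_self_nonneg (w i)).1 h0 i
          (Finset.mem_univ i)
        simpa using this
      have h1 := hno b (by simp [hw0])
      refine hb 0 ?_
      ext i
      have := (Finset.sum_eq_zero_iff_of_nonneg fun i _ => mul_self_nonneg (b i)).1 h1 i
        (Finset.mem_univ i)
      simpa using this
    set c := (∑ i, b i * w i) / ∑ i, w i * w i with hc
    have h1 : ∑ i, (b i - c * w i) * w i = 0 := by
      simp only [sub_mul, Finset.sum_sub_distrib, mul_assoc, ← Finset.mul_sum]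
      rw [hc, div_mul_cancel₀ _ hww, sub_self]
    have h2 := hno (fun i => b i - c * w i) h1
    have h3 : ∑ i, (b i - c * w i) * (b i - c * w i) = 0 := by
      have : ∑ i, (b i - c * w i) * (b i - c * w i) =
          ∑ i, (b i - c * w i) * b i - c * ∑ i, (b i - c * w i) * w i := by
        rw [Finset.mul_sum, ← Finset.sum_sub_distrib]
        exact Finset.sum_congr rfl fun i _ => by ring
      rw [this, h1, h2]; ring
    refine hb c ?_
    ext i
    have := (Finset.sum_eq_zero_iff_of_nonneg
      fun i _ => mul_self_nonneg (b i - c * w i)).1 h3 i (Finset.mem_univ i)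
    simp only [mul_self_eq_zero, Pi.smul_apply, smul_eq_mul] at this ⊢
    linarith
  have hdir := sumCoord_surj u
  set d : ℝ × (Fin k → ℝ) := (∑ i, u i, fun i => u i.succ)
  have hHaar : (volume : Measure (ℝ × (Fin k → ℝ))).IsAddHaarMeasure :=
    inferInstanceAs ((volume : Measure ℝ).prod (volume : Measure (Fin k → ℝ))).IsAddHaarMeasure
  -- Fubini along the lines in direction `d`: each meets the cone in an affine preimage of `N` or
  -- not at all.
  refine ae_mem_of_ae_add_linearMap_mem (LinearMap.toSpanSingleton ℝ _ d) volume volume hmeas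
    fun y => ?_
  have hlin : ∀ (t : ℝ) (e : Fin (k + 1) → ℝ), ∑ i, sumCoord k (y + t • d) i * e i =
      ∑ i, sumCoord k y i * e i + t * ∑ i, u i * e i := by
    intro t e
    rw [map_add, map_smul, hdir, Finset.mul_sum, ← Finset.sum_add_distrib]
    exact Finset.sum_congr rfl fun i _ => by simp; ring
  by_cases ha : ∑ i, sumCoord k y i * w i = 0
  · refine Filter.Eventually.of_forall fun t => ?_
    change ¬ (∑ i, sumCoord k (y + t • d) i * w i ≠ 0 ∧
      projCoord w b (sumCoord k (y + t • d)) ∈ N)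
    rw [hlin, ha, hu1]
    simp
  · have hnull := volume_preimage_affine_eq_zero hN
      ((∑ i, sumCoord k y i * b i) / ∑ i, sumCoord k y i * w i)
      (q := (∑ i, u i * b i) / ∑ i, sumCoord k y i * w i) (div_ne_zero hu2 ha)
    have hnull' := measure_eq_zero_iff_ae_notMem.1 hnull
    filter_upwards [hnull'] with t ht
    change ¬ (∑ i, sumCoord k (y + t • d) i * w i ≠ 0 ∧
      projCoord w b (sumCoord k (y + t • d)) ∈ N)
    simp only [projCoord, hlin, hu1, mul_zero, add_zero]
    rintro ⟨-, hmem⟩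
    apply ht
    convert hmem using 1
    rw [add_div]
    ring

lemma measurableSet_openSimplex (m : ℕ) : MeasurableSet (openSimplex m) := by
  have : openSimplex m = (⋂ j, {s | 0 < s j}) ∩ {s | ∑ j, s j = 1} := by
    ext s; simp [openSimplex]
  rw [this]
  exact (MeasurableSet.iInter fun j => measurableSet_lt measurable_const (measurable_pi_apply j)).inter
    (measurableSet_eq_fun (Finset.measurable_sum _ fun i _ => measurable_pi_apply i)
      measurable_const)

/-- For independent functionals, a null set of projective coordinates corresponds to a null set of
the simplex. -/
theorem ae_simplex_projCoord_notMem {m : ℕ} (hm : m ≠ 0) {w b : Fin m → ℝ} (hw : ∀ i, 0 < w i)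
    (hb : ∀ c : ℝ, b ≠ c • w) {N : Set ℝ} (hN : volume N = 0) :
    ∀ᵐ s ∂(simplexMeasure m), s ∈ openSimplex m ∧ projCoord w b s ∉ N := by
  obtain ⟨k, rfl⟩ := Nat.exists_eq_succ_of_ne_zero hm
  set N' := toMeasurable volume N with hN'
  have hN'0 : volume N' = 0 := by rw [measure_toMeasurable, hN]
  set E : Set (ℝ × (Fin k → ℝ)) :=
    {y | ∑ i, sumCoord k y i * w i ≠ 0 ∧ projCoord w b (sumCoord k y) ∈ N'} with hE
  have hcone : ∀ᵐ y : ℝ × (Fin k → ℝ), y ∉ E :=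
    volume_cone_eq_zero hb (measurableSet_toMeasurable _ _) hN'0
  -- Fubini only provides some slice of nonzero coordinate sum. The projective coordinate is
  -- homogeneous of degree zero, so scaling carries the result to the slice of sum `1`.
  obtain ⟨σ, hσ, hσ0⟩ : ∃ σ : ℝ, (∀ᵐ y : Fin k → ℝ, (σ, y) ∉ E) ∧ σ ≠ 0 := by
    have h1 := Measure.ae_ae_of_ae_prod hcone
    have h2 : ∀ᵐ σ : ℝ, σ ≠ 0 := by
      rw [ae_iff]; simp
    exact (h1.and h2).exists
  set E₀ : Set (Fin k → ℝ) := {y | ((1 : ℝ), y) ∈ E} with hE₀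
  have hE₀0 : volume E₀ = 0 := by
    have h1 : E₀ ⊆ (fun y : Fin k → ℝ => σ • y) ⁻¹' {y | (σ, y) ∈ E} := by
      intro y hy
      have h2 : ((σ, σ • y) : ℝ × (Fin k → ℝ)) = σ • ((1 : ℝ), y) := by simp
      simp only [mem_preimage, mem_ofPred_eq, hE, hE₀, h2, map_smul, projCoord, Pi.smul_apply,
        smul_eq_mul, mul_assoc, ← Finset.mul_sum] at hy ⊢
      rw [mul_div_mul_left _ _ hσ0]
      exact ⟨mul_ne_zero hσ0 hy.1, hy.2⟩
    refine measure_mono_null h1 ?_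
    rw [Measure.addHaar_preimage_smul _ hσ0]
    have : volume {y | (σ, y) ∈ E} = 0 := by
      rw [ae_iff] at hσ
      simpa using hσ
    rw [this, mul_zero]
  -- Lipschitz maps preserve null sets of `k`-dimensional Hausdorff measure, which on `ℝ^k` is
  -- Lebesgue measure.
  have hlip : ∃ K, LipschitzWith K fun y : Fin k → ℝ => sumCoord k ((1 : ℝ), y) :=
    ⟨_, (sumCoord k).toContinuousLinearMap.lipschitz.comp (LipschitzWith.prodMk_left (1 : ℝ))⟩
  obtain ⟨K, hK⟩ := hlip
  have hdim : (((k + 1 : ℕ) : ℝ) - 1) = (Fintype.card (Fin k) : ℝ) := by simp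
  have himg : Measure.hausdorffMeasure (((k + 1 : ℕ) : ℝ) - 1)
      ((fun y : Fin k → ℝ => sumCoord k ((1 : ℝ), y)) '' E₀) = 0 := by
    rw [hdim]
    refine le_antisymm ((hK.hausdorffMeasure_image_le (by positivity) E₀).trans ?_) bot_le
    rw [hausdorffMeasure_pi_real, hE₀0, mul_zero]
  have hsub : ∀ s ∈ openSimplex (k + 1), projCoord w b s ∈ N →
      s ∈ (fun y : Fin k → ℝ => sumCoord k ((1 : ℝ), y)) '' E₀ := by
    intro s hs hmem
    have h1 := sumCoord_surj s
    rw [hs.2] at h1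
    refine ⟨fun i => s i.succ, ⟨?_, ?_⟩, h1⟩
    · rw [h1]
      exact (Finset.sum_pos (fun i _ => mul_pos (hs.1 i) (hw i)) Finset.univ_nonempty).ne'
    · rw [h1]
      exact subset_toMeasurable _ _ hmem
  rw [simplexMeasure]
  have h3 : ∀ᵐ s ∂(Measure.hausdorffMeasure (((k + 1 : ℕ) : ℝ) - 1) :
      Measure (Fin (k + 1) → ℝ)).restrict (openSimplex (k + 1)),
      s ∉ (fun y : Fin k → ℝ => sumCoord k ((1 : ℝ), y)) '' E₀ :=
    ae_restrict_of_ae (measure_eq_zero_iff_ae_notMem.1 himg)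
  filter_upwards [h3, ae_restrict_mem (measurableSet_openSimplex (k + 1))] with s hs1 hs2
  exact ⟨hs2, fun h => hs1 (hsub s hs2 h)⟩

end

/-! ### Flow lines of the suspension and their blocks -/

noncomputable section

section Roof

variable {m : ℕ} {s : Fin m → ℝ}

lemma roofSum_zero (x : ℤ → Fin m) : roofSum s x 0 = 0 := by simp [roofSum]

lemma roofSum_add_one (x : ℤ → Fin m) (n : ℤ) :
    roofSum s x (n + 1) = roofSum s x n + s (x n) := by
  simp only [roofSum]
  rcases lt_or_ge n 0 with hn | hn
  · have h1 : Finset.Ico n 0 = insert n (Finset.Ico (n + 1) 0) := by ext i; simp; omega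
    rw [Finset.Ico_eq_empty (b := n) (by omega), Finset.Ico_eq_empty (b := n + 1) (by omega), h1,
      Finset.sum_insert (by simp)]
    ring
  · have h1 : Finset.Ico 0 (n + 1) = insert n (Finset.Ico 0 n) := by ext i; simp; omega
    rw [Finset.Ico_eq_empty (a := n) (by omega), Finset.Ico_eq_empty (a := n + 1) (by omega), h1,
      Finset.sum_insert (by simp)]
    ring

lemma roofSum_strictMono (hs : ∀ j, 0 < s j) (x : ℤ → Fin m) : StrictMono (roofSum s x) :=
  strictMono_int_of_lt_succ fun n => by rw [roofSum_add_one]; linarith [hs (x n)]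

/-- Linear growth in both directions makes the set in `tileIndex` nonempty and bounded above, so its
supremum is attained. -/
lemma exists_roofSum_bounds (hs : ∀ j, 0 < s j) (x : ℤ → Fin m) :
    ∃ δ > 0, ∀ n : ℕ, δ * n ≤ roofSum s x n ∧ roofSum s x (-n) ≤ -(δ * n) := by
  obtain ⟨i₀, -, hi₀⟩ := Finset.exists_min_image Finset.univ s ⟨x 0, Finset.mem_univ _⟩
  refine ⟨s i₀, hs i₀, fun n => ?_⟩
  induction n with
  | zero => simp [roofSum_zero]
  | succ n ih =>
    have h1 := roofSum_add_one (s := s) x n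
    have h2 := roofSum_add_one (s := s) x (-(n + 1 : ℕ))
    have e : (-((n + 1 : ℕ) : ℤ) + 1) = -n := by push_cast; ring
    rw [e] at h2
    have h3 := hi₀ (x n) (Finset.mem_univ _)
    have h4 := hi₀ (x (-(n + 1 : ℕ))) (Finset.mem_univ _)
    push_cast at *
    constructor <;> linarith [ih.1, ih.2]

lemma tileIndex_spec (hs : ∀ j, 0 < s j) (x : ℤ → Fin m) (u : ℝ) :
    roofSum s x (tileIndex s x u) ≤ u ∧ u < roofSum s x (tileIndex s x u + 1) := by
  obtain ⟨δ, hδ, hb⟩ := exists_roofSum_bounds hs x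
  obtain ⟨n, hn⟩ := exists_nat_gt (|u| / δ)
  rw [div_lt_iff₀ hδ, mul_comm] at hn
  have hne : {n : ℤ | roofSum s x n ≤ u}.Nonempty :=
    ⟨-n, by have := (hb n).2; have := neg_abs_le u; change roofSum s x (-n) ≤ u; linarith⟩
  have hbdd : BddAbove {n : ℤ | roofSum s x n ≤ u} := by
    refine ⟨n, fun k hk => ?_⟩
    by_contra! hlt
    have h1 := roofSum_strictMono hs x hlt
    have h2 := (hb n).1
    have h3 : roofSum s x k ≤ u := hk
    have := le_abs_self u
    linarith
  refine ⟨Int.csSup_mem hne hbdd, ?_⟩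
  by_contra! hle
  have := le_csSup hbdd hle
  simp only [tileIndex] at this
  omega

lemma tileIndex_eq (hs : ∀ j, 0 < s j) (x : ℤ → Fin m) {u : ℝ} {n : ℤ}
    (h1 : roofSum s x n ≤ u) (h2 : u < roofSum s x (n + 1)) : tileIndex s x u = n := by
  obtain ⟨h3, h4⟩ := tileIndex_spec hs x u
  have h5 := (roofSum_strictMono hs x).lt_iff_lt.1 (h1.trans_lt h4)
  have h6 := (roofSum_strictMono hs x).lt_iff_lt.1 (h3.trans_lt h2)
  omega

/-- The function `ψ` read along the flow line through `(x, 0)`. -/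
def flowLine (s : Fin m → ℝ) (ψ : Fin m → ℝ → ℂ) (x : ℤ → Fin m) (u : ℝ) : ℂ :=
  ψ (x (tileIndex s x u)) (u - roofSum s x (tileIndex s x u))

lemma cylFun_suspensionFlow (ψ : Fin m → ℝ → ℂ) (τ : ℝ) (y : (ℤ → Fin m) × ℝ) :
    cylFun ψ (suspensionFlow s τ y) = flowLine s ψ y.1 (y.2 + τ) := by
  simp [cylFun, suspensionFlow, flowLine]

lemma flowLine_eq (hs : ∀ j, 0 < s j) (ψ : Fin m → ℝ → ℂ) (x : ℤ → Fin m) {u : ℝ} {n : ℤ}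
    (h1 : roofSum s x n ≤ u) (h2 : u < roofSum s x (n + 1)) :
    flowLine s ψ x u = ψ (x n) (u - roofSum s x n) := by
  rw [flowLine, tileIndex_eq hs x h1 h2]

lemma measurable_roofSum (s : Fin m → ℝ) (n : ℤ) :
    Measurable fun x : ℤ → Fin m => roofSum s x n := by
  have h : ∀ i : ℤ, Measurable fun x : ℤ → Fin m => s (x i) := fun i =>
    (measurable_of_countable s).comp (measurable_pi_apply i)
  exact (Finset.measurable_sum _ fun i _ => h i).sub (Finset.measurable_sum _ fun i _ => h i)

lemma measurable_tileIndex (hs : ∀ j, 0 < s j) :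
    Measurable fun y : (ℤ → Fin m) × ℝ => tileIndex s y.1 y.2 := by
  refine measurable_to_countable' fun n => ?_
  have : (fun y : (ℤ → Fin m) × ℝ => tileIndex s y.1 y.2) ⁻¹' {n} =
      {y | roofSum s y.1 n ≤ y.2} ∩ {y | y.2 < roofSum s y.1 (n + 1)} := by
    ext y
    simp only [mem_preimage, mem_singleton_iff, mem_inter_iff, mem_ofPred_eq]
    constructor
    · rintro rfl
      exact tileIndex_spec hs y.1 y.2
    · rintro ⟨h1, h2⟩
      exact tileIndex_eq hs y.1 h1 h2
  rw [this]
  exact (measurableSet_le ((measurable_roofSum s n).comp measurable_fst) measurable_snd).inter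
    (measurableSet_lt measurable_snd ((measurable_roofSum s (n + 1)).comp measurable_fst))

lemma measurable_flowLine (hs : ∀ j, 0 < s j) {ψ : Fin m → ℝ → ℂ} (hψ : ∀ a, Measurable (ψ a)) :
    Measurable fun y : (ℤ → Fin m) × ℝ => flowLine s ψ y.1 y.2 := by
  have h1 : Measurable fun z : Fin m × ℝ => ψ z.1 z.2 := measurable_from_prod_countable_right hψ
  have h2 : Measurable fun z : ℤ × ((ℤ → Fin m) × ℝ) =>
      ψ (z.2.1 z.1) (z.2.2 - roofSum s z.2.1 z.1) := by
    refine measurable_from_prod_countable_right fun n => ?_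
    exact h1.comp (((measurable_pi_apply n).comp measurable_fst).prodMk
      (measurable_snd.sub ((measurable_roofSum s n).comp measurable_fst)))
  exact h2.comp ((measurable_tileIndex hs).prodMk measurable_id)

/-- The block of `n` letters of `x` that starts at `p`. -/
def block (x : ℤ → Fin m) : ℤ → ℕ → List (Fin m)
  | _, 0 => []
  | p, n + 1 => x p :: block x (p + 1) n

lemma block_add (x : ℤ → Fin m) (p : ℤ) (a b : ℕ) :
    block x p (a + b) = block x p a ++ block x (p + a) b := by
  induction a generalizing p with
  | zero => simp [block]
  | succ a ih =>
    rw [show a + 1 + b = (a + b) + 1 by ring, block, ih, block, List.cons_append]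
    push_cast
    rw [show p + 1 + (a : ℤ) = p + (a + 1) by ring]

lemma ofFn_eq_block (x : ℤ → Fin m) (p : ℤ) (n : ℕ) :
    (List.ofFn fun i : Fin n => x ((i : ℤ) + p)) = block x p n := by
  induction n generalizing p with
  | zero => simp [block]
  | succ n ih =>
    rw [List.ofFn_succ, block, ← ih]
    simp only [Fin.val_zero, Fin.val_succ]
    push_cast
    simp only [zero_add, add_assoc, add_comm p 1]

lemma exists_block_isInfix {ζ : Substitution m} {x : ℤ → Fin m} (hx : x ∈ ζ.space) (p : ℤ) (n : ℕ) :
    ∃ k a, block x p n <:+: ζ.iter k a := by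
  set N : ℕ := p.natAbs + n
  obtain ⟨k, a, h⟩ := hx N
  refine ⟨k, a, List.IsInfix.trans ?_ h⟩
  have hc : centralBlock x N = block x (-N) (2 * N + 1) := by
    rw [← ofFn_eq_block]; rfl
  obtain ⟨i, hi⟩ : ∃ i : ℕ, p = -N + i := ⟨(p + N).toNat, by omega⟩
  obtain ⟨j, hj⟩ : ∃ j : ℕ, 2 * N + 1 = i + (n + j) := ⟨2 * N + 1 - i - n, by omega⟩
  rw [hc, hj, block_add, block_add, ← hi, ← List.append_assoc]
  exact List.infix_append _ _ _

lemma roofWord_block (x : ℤ → Fin m) (p : ℤ) (n : ℕ) :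
    roofWord s (block x p n) = roofSum s x (p + n) - roofSum s x p := by
  induction n generalizing p with
  | zero => simp [block, roofWord]
  | succ n ih =>
    have e : roofWord s (block x p (n + 1)) = s (x p) + roofWord s (block x (p + 1) n) := by
      simp [block, roofWord]
    rw [e, ih, roofSum_add_one]
    push_cast
    rw [show p + 1 + (n : ℤ) = p + (n + 1) by ring]
    ring

/-- The number of letters in a subword of `ζ^k(a)` is controlled by its roof length. -/
lemma length_le_of_isInfix {ζ : Substitution m} {p : ℕ} (hp : ∀ a b, a ∈ ζ.iter p b)
    (hs : s ∈ openSimplex m) {k : ℕ} {a : Fin m} {w : List (Fin m)} (hw : w <:+: ζ.iter k a) :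
    (w.length : ℝ) ≤ ζ.maxLen p * (2 + roofWord s w) := by
  have hnn : ∀ u : List (Fin m), 0 ≤ roofWord s u := fun u =>
    List.sum_nonneg fun t ht => by
      obtain ⟨j, -, rfl⟩ := List.mem_map.1 ht
      exact (hs.1 j).le
  -- Every letter occurs in `ζ^p(b)`, so its roof length is at least `∑ s_i = 1`. This keeps the
  -- constant independent of `s`, however small a coordinate may be.
  have hone : ∀ b, 1 ≤ roofWord s (ζ.iter p b) := fun b => by
    rw [roofWord_eq_sum, ← hs.2]
    refine Finset.sum_le_sum fun i _ => ?_
    have h1 : (1 : ℝ) ≤ (Substitution.popVec (ζ.iter p b) i : ℝ) := by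
      have h2 : 1 ≤ (ζ.iter p b).count i := List.count_pos_iff.2 (hp i b)
      simp only [Substitution.popVec]
      exact_mod_cast h2
    exact le_mul_of_one_le_right (hs.1 i).le h1
  have hword : ∀ u : List (Fin m), (u.length : ℝ) ≤ roofWord s (ζ.iterWord p u) := by
    intro u
    induction u with
    | nil => simpa using hnn _
    | cons b u ih =>
      rw [Substitution.iterWord_cons, roofWord_append, List.length_cons]
      push_cast
      linarith [hone b]
  obtain ⟨u, w', v, rfl, hu, hv⟩ := ζ.exists_iterWord_of_isInfix p k a w hw
  have h1 : ((u ++ ζ.iterWord p w' ++ v).length : ℝ) ≤ ζ.maxLen p * (2 + w'.length) := by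
    have h2 := ζ.length_iterWord_le p w'
    have h3 : (u ++ ζ.iterWord p w' ++ v).length ≤ ζ.maxLen p * (2 + w'.length) := by
      simp only [List.length_append]
      nlinarith
    exact_mod_cast h3
  refine h1.trans ?_
  rw [roofWord_append, roofWord_append]
  have := hword w'
  have := hnn u
  have := hnn v
  gcongr
  linarith

end Roof

/-! ### Twisted integrals along flow lines -/

section TwistedIntegral

variable {m : ℕ} {s : Fin m → ℝ} {ψ : Fin m → ℝ → ℂ} {L : ℝ}

/-- The twisted integral of `ψ a` over a tile. -/
def tileIntegral (ω : ℝ) (s : Fin m → ℝ) (ψ : Fin m → ℝ → ℂ) (a : Fin m) : ℂ :=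
  ∫ u in (0 : ℝ)..(s a), phase (-(ω * u)) * ψ a u

lemma norm_flowLine_le (hb : ∀ a t, ‖ψ a t‖ ≤ L) (x : ℤ → Fin m) (u : ℝ) :
    ‖flowLine s ψ x u‖ ≤ L := hb _ _

lemma norm_phase_mul (t : ℝ) (z : ℂ) : ‖phase t * z‖ = ‖z‖ := by rw [norm_mul, norm_phase, one_mul]

lemma intervalIntegrable_flowLine (hs : ∀ j, 0 < s j) (hψ : ∀ a, Measurable (ψ a))
    (hb : ∀ a t, ‖ψ a t‖ ≤ L) (ω : ℝ) (x : ℤ → Fin m) (A B : ℝ) :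
    IntervalIntegrable (fun u => phase (-(ω * u)) * flowLine s ψ x u) volume A B := by
  have hm : Measurable fun u => phase (-(ω * u)) * flowLine s ψ x u := by
    refine Measurable.mul ?_ ((measurable_flowLine hs hψ).comp measurable_prodMk_left)
    exact continuous_phase.measurable.comp (by fun_prop)
  refine (intervalIntegrable_const (c := L)).mono_fun' hm.aestronglyMeasurable ?_
  refine Filter.Eventually.of_forall fun u => ?_
  simp only [norm_phase_mul]
  exact norm_flowLine_le hb x u

lemma integral_tile (hs : ∀ j, 0 < s j) (ω : ℝ) (x : ℤ → Fin m) (p : ℤ) :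
    ∫ u in (roofSum s x p)..(roofSum s x (p + 1)), phase (-(ω * u)) * flowLine s ψ x u =
      phase (-(ω * roofSum s x p)) * tileIntegral ω s ψ (x p) := by
  have h1 : ∫ u in (roofSum s x p)..(roofSum s x (p + 1)), phase (-(ω * u)) * flowLine s ψ x u =
      ∫ u in (roofSum s x p)..(roofSum s x (p + 1)),
        phase (-(ω * u)) * ψ (x p) (u - roofSum s x p) := by
    refine intervalIntegral.integral_congr_ae ?_
    -- At its right end point the flow line already belongs to the next tile.
    have hne : ∀ᵐ u : ℝ, u ≠ roofSum s x (p + 1) := by rw [ae_iff]; simp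
    filter_upwards [hne] with u hu hmem
    rw [uIoc_of_le (roofSum_strictMono hs x (by omega : p < p + 1)).le] at hmem
    rw [flowLine_eq hs ψ x hmem.1.le (lt_of_le_of_ne hmem.2 hu)]
  rw [h1, tileIntegral, ← intervalIntegral.integral_const_mul]
  have h2 := intervalIntegral.integral_comp_add_right (a := 0) (b := s (x p))
    (fun u => phase (-(ω * u)) * ψ (x p) (u - roofSum s x p)) (roofSum s x p)
  rw [zero_add, add_comm (s (x p)), ← roofSum_add_one] at h2
  rw [← h2]
  refine intervalIntegral.integral_congr fun u _ => ?_
  simp only [add_sub_cancel_right]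
  rw [mul_add, neg_add, phase_add]
  ring

lemma integral_block (hs : ∀ j, 0 < s j) (hψ : ∀ a, Measurable (ψ a)) (hb : ∀ a t, ‖ψ a t‖ ≤ L)
    (ω : ℝ) (x : ℤ → Fin m) (p : ℤ) (n : ℕ) :
    ∫ u in (roofSum s x p)..(roofSum s x (p + n)), phase (-(ω * u)) * flowLine s ψ x u =
      phase (-(ω * roofSum s x p)) *
        twistedSum ω s (tileIntegral ω s ψ) (block x p n) := by
  induction n generalizing p with
  | zero => simp [block, twistedSum]
  | succ n ih =>
    have hint := intervalIntegrable_flowLine hs hψ hb ω x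
    rw [← intervalIntegral.integral_add_adjacent_intervals (hint _ (roofSum s x (p + 1)))
      (hint _ _), integral_tile hs]
    have e : p + ((n + 1 : ℕ) : ℤ) = p + 1 + n := by push_cast; ring
    rw [e, ih, block, twistedSum, roofSum_add_one, mul_add ω, neg_add, phase_add]
    ring

/-- The twisted integral over an interval of a flow line is a twisted sum over a block, up to the
two incomplete tiles at the ends. -/
lemma exists_block_integral_le (hs : s ∈ openSimplex m) (hψ : ∀ a, Measurable (ψ a))
    (hb : ∀ a t, ‖ψ a t‖ ≤ L) (ω : ℝ) (x : ℤ → Fin m) (A : ℝ) {R : ℝ} (hR : 0 ≤ R) :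
    ∃ (p : ℤ) (n : ℕ), roofWord s (block x p n) ≤ R + 1 ∧
      ‖∫ u in A..(A + R), phase (-(ω * u)) * flowLine s ψ x u‖ ≤
        2 * L + ‖twistedSum ω s (tileIntegral ω s ψ) (block x p n)‖ := by
  have hs0 := hs.1
  have hs1 : ∀ i, s i ≤ 1 := fun i => by
    rw [← hs.2]
    exact Finset.single_le_sum (fun k _ => (hs.1 k).le) (Finset.mem_univ i)
  obtain ⟨h1, h2⟩ := tileIndex_spec hs0 x A
  obtain ⟨h3, h4⟩ := tileIndex_spec hs0 x (A + R)
  set p := tileIndex s x A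
  set q := tileIndex s x (A + R)
  have hpq : p ≤ q := by
    have := (roofSum_strictMono hs0 x).lt_iff_lt.1 (h1.trans_lt (by linarith : A < _))
    omega
  obtain ⟨n, hn⟩ : ∃ n : ℕ, q = p + n := ⟨(q - p).toNat, by omega⟩
  rw [roofSum_add_one] at h2 h4
  have h5 := hs1 (x p)
  have h6 := hs1 (x q)
  refine ⟨p, n, ?_, ?_⟩
  · rw [roofWord_block, ← hn]; linarith
  have hint := intervalIntegrable_flowLine hs0 hψ hb ω x
  have e : ∫ u in A..(A + R), phase (-(ω * u)) * flowLine s ψ x u =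
      -(∫ u in (roofSum s x p)..A, phase (-(ω * u)) * flowLine s ψ x u) +
      ((∫ u in (roofSum s x p)..(roofSum s x q), phase (-(ω * u)) * flowLine s ψ x u) +
      ∫ u in (roofSum s x q)..(A + R), phase (-(ω * u)) * flowLine s ψ x u) := by
    rw [intervalIntegral.integral_add_adjacent_intervals (hint _ _) (hint _ _),
      ← intervalIntegral.integral_symm,
      intervalIntegral.integral_add_adjacent_intervals (hint _ _) (hint _ _)]
  have hL0 : 0 ≤ L := (norm_nonneg _).trans (hb (x 0) 0)
  have hsmall : ∀ C D : ℝ, |D - C| ≤ 1 →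
      ‖∫ u in C..D, phase (-(ω * u)) * flowLine s ψ x u‖ ≤ L := fun C D hCD => by
    refine (intervalIntegral.norm_integral_le_of_norm_le_const (C := L) fun u _ => ?_).trans
      (mul_le_of_le_one_right hL0 hCD)
    rw [norm_phase_mul]
    exact norm_flowLine_le hb x u
  have hmid : ‖∫ u in (roofSum s x p)..(roofSum s x q), phase (-(ω * u)) * flowLine s ψ x u‖ =
      ‖twistedSum ω s (tileIntegral ω s ψ) (block x p n)‖ := by
    rw [hn, integral_block hs0 hψ hb, norm_phase_mul]
  rw [e]
  have i1 := hsmall (roofSum s x p) A (by rw [abs_le]; constructor <;> linarith)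
  have i2 := hsmall (roofSum s x q) (A + R) (by rw [abs_le]; constructor <;> linarith)
  refine (norm_add_le _ _).trans ?_
  rw [norm_neg]
  have := norm_add_le (∫ u in (roofSum s x p)..(roofSum s x q), phase (-(ω * u)) * flowLine s ψ x u)
    (∫ u in (roofSum s x q)..(A + R), phase (-(ω * u)) * flowLine s ψ x u)
  linarith

lemma norm_tileIntegral_le (hs : s ∈ openSimplex m) (hb : ∀ a t, ‖ψ a t‖ ≤ L) (ω : ℝ)
    (a : Fin m) : ‖tileIntegral ω s ψ a‖ ≤ L := by
  have hs1 : s a ≤ 1 := by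
    rw [← hs.2]
    exact Finset.single_le_sum (fun k _ => (hs.1 k).le) (Finset.mem_univ a)
  have hL0 : 0 ≤ L := (norm_nonneg _).trans (hb a 0)
  refine (intervalIntegral.norm_integral_le_of_norm_le_const (C := L) fun u _ => ?_).trans
      (mul_le_of_le_one_right hL0 ?_)
  · rw [norm_phase_mul]; exact hb a u
  · rw [sub_zero, abs_of_pos (hs.1 a)]; exact hs1

lemma phase_neg_half : phase (-(1 / 2)) = -1 := by
  rw [phase, show (2 * Real.pi * (-(1 / 2)) : ℝ) = -Real.pi by ring]
  push_cast
  rw [neg_mul, Complex.exp_neg, Complex.exp_pi_mul_I]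
  norm_num

/-- Twisted integrals of Lipschitz functions decay in the frequency. -/
lemma norm_tileIntegral_le_div (hs : s ∈ openSimplex m) (hb : ∀ a t, ‖ψ a t‖ ≤ L)
    (hl : ∀ a t u, ‖ψ a t - ψ a u‖ ≤ L * |t - u|) (hψ : ∀ a, Continuous (ψ a)) {ω : ℝ} (hω : ω ≠ 0)
    (a : Fin m) : ‖tileIntegral ω s ψ a‖ ≤ L / |ω| := by
  have hs1 : s a ≤ 1 := by
    rw [← hs.2]
    exact Finset.single_le_sum (fun k _ => (hs.1 k).le) (Finset.mem_univ a)
  have hL0 : 0 ≤ L := (norm_nonneg _).trans (hb a 0)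
  set g : ℝ → ℂ := fun u => phase (-(ω * u)) * ψ a u with hg
  have hgc : Continuous g := by
    have := hψ a
    have h2 := continuous_phase
    exact (h2.comp (by fun_prop)).mul this
  have hgb : ∀ u, ‖g u‖ ≤ L := fun u => by rw [hg, norm_phase_mul]; exact hb a u
  -- Half a period: the shift by `h` reverses the sign of the phase. The sum of the integral and its
  -- shift is then small by the Lipschitz bound, and their difference is small because the intervals
  -- nearly agree.
  set h : ℝ := 1 / (2 * ω) with hh
  have habs : |h| = 1 / (2 * |ω|) := by rw [hh, abs_div, abs_mul]; simp
  have hshift : ∀ u, g (u + h) = -(phase (-(ω * u)) * ψ a (u + h)) := fun u => by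
    have e : -(ω * (u + h)) = -(ω * u) + -(1 / 2) := by rw [hh]; field_simp; ring
    simp only [hg]
    rw [e, phase_add, phase_neg_half]
    ring
  have hint : ∀ c d, IntervalIntegrable g volume c d := fun c d => hgc.intervalIntegrable c d
  have h1 : ‖(∫ u in (0 : ℝ)..(s a), g u) + ∫ u in (0 : ℝ)..(s a), g (u + h)‖ ≤ L * |h| := by
    have hgc' : Continuous fun u => g (u + h) := by fun_prop
    rw [← intervalIntegral.integral_add (hint _ _) (hgc'.intervalIntegrable _ _)]
    refine (intervalIntegral.norm_integral_le_of_norm_le_const (C := L * |h|) fun u _ => ?_).trans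
      (mul_le_of_le_one_right (by positivity) ?_)
    · have e : g u + g (u + h) = phase (-(ω * u)) * (ψ a u - ψ a (u + h)) := by
        rw [hshift]; simp only [hg]; ring
      rw [e, norm_phase_mul]
      refine (hl a u (u + h)).trans (le_of_eq ?_)
      rw [sub_add_cancel_left, abs_neg]
    · rw [sub_zero, abs_of_pos (hs.1 a)]; exact hs1
  have h2 : ‖(∫ u in (0 : ℝ)..(s a), g u) - ∫ u in (0 : ℝ)..(s a), g (u + h)‖ ≤ 2 * (L * |h|) := by
    rw [intervalIntegral.integral_comp_add_right,
      intervalIntegral.integral_interval_sub_interval_comm (hint _ _) (hint _ _) (hint _ _)]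
    refine (norm_sub_le _ _).trans ?_
    have i1 : ‖∫ u in (0 : ℝ)..(0 + h), g u‖ ≤ L * |h| := by
      refine (intervalIntegral.norm_integral_le_of_norm_le_const (C := L) fun u _ => hgb u).trans ?_
      simp
    have i2 : ‖∫ u in (s a)..(s a + h), g u‖ ≤ L * |h| := by
      refine (intervalIntegral.norm_integral_le_of_norm_le_const (C := L) fun u _ => hgb u).trans ?_
      simp
    linarith
  have e2 : (2 : ℂ) * tileIntegral ω s ψ a =
      ((∫ u in (0 : ℝ)..(s a), g u) + ∫ u in (0 : ℝ)..(s a), g (u + h)) +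
      ((∫ u in (0 : ℝ)..(s a), g u) - ∫ u in (0 : ℝ)..(s a), g (u + h)) := by
    simp only [tileIntegral, hg]; ring
  have h3 : 2 * ‖tileIntegral ω s ψ a‖ ≤ 3 * (L * |h|) := by
    have : ‖(2 : ℂ) * tileIntegral ω s ψ a‖ = 2 * ‖tileIntegral ω s ψ a‖ := by
      rw [norm_mul]; simp
    rw [← this, e2]
    refine (norm_add_le _ _).trans ?_
    linarith
  have hω' : 0 < |ω| := abs_pos.2 hω
  have h4 : L * |h| = L / |ω| / 2 := by rw [habs]; field_simp
  have h5 : 0 ≤ L / |ω| := by positivity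
  linarith

end TwistedIntegral

end

/-! ### Spectral measures and twisted integrals -/

noncomputable section

section Spectral

lemma exp_eq_phase (x t : ℝ) :
    Complex.exp (2 * Real.pi * Complex.I * x * t) = phase (x * t) := by
  rw [phase]; push_cast; ring_nf

lemma norm_phase_sub_one_le (x : ℝ) : ‖phase x - 1‖ ≤ 2 * Real.pi * |x| := by
  rw [phase, mul_comm]
  refine Real.norm_exp_I_mul_ofReal_sub_one_le.trans (le_of_eq ?_)
  rw [Real.norm_eq_abs, abs_mul, abs_of_pos Real.two_pi_pos]

/-- The Dirichlet integral `∫₀ᴿ e^{2πitξ} dt`. -/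
def dirichletIntegral (R ξ : ℝ) : ℂ := ∫ t in (0 : ℝ)..R, phase (t * ξ)

lemma continuous_dirichletIntegral (R : ℝ) : Continuous (dirichletIntegral R) := by
  unfold dirichletIntegral
  refine intervalIntegral.continuous_parametric_intervalIntegral_of_continuous' ?_ _ _
  exact continuous_phase.comp (by fun_prop)

lemma norm_dirichletIntegral_le {R : ℝ} (hR : 0 ≤ R) (ξ : ℝ) : ‖dirichletIntegral R ξ‖ ≤ R := by
  refine (intervalIntegral.norm_integral_le_of_norm_le_const (C := 1)
    fun t _ => (norm_phase _).le).trans ?_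
  rw [sub_zero, abs_of_nonneg hR, one_mul]

/-- For `|ξ| ≤ r` the phase moves by at most `2π / 16 < 1 / 2` from `1`, so there is almost no
cancellation. -/
lemma half_le_norm_dirichletIntegral {R r ξ : ℝ} (hR : 0 ≤ R) (hrR : r * R ≤ 1 / 16)
    (hξ : |ξ| ≤ r) : R / 2 ≤ ‖dirichletIntegral R ξ‖ := by
  have hc : Continuous fun t : ℝ => phase (t * ξ) := continuous_phase.comp (by fun_prop)
  have h1 : ‖dirichletIntegral R ξ - R‖ ≤ 1 / 2 * R := by
    have e : dirichletIntegral R ξ - R = ∫ t in (0 : ℝ)..R, (phase (t * ξ) - 1) := by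
      rw [intervalIntegral.integral_sub (hc.intervalIntegrable _ _) intervalIntegrable_const]
      simp [dirichletIntegral]
    rw [e]
    refine (intervalIntegral.norm_integral_le_of_norm_le_const (C := 1 / 2) fun t ht => ?_).trans ?_
    · rw [uIoc_of_le hR] at ht
      refine (norm_phase_sub_one_le _).trans ?_
      have h2 : |t * ξ| ≤ 1 / 16 := by
        rw [abs_mul, abs_of_pos ht.1]
        calc t * |ξ| ≤ R * r := mul_le_mul ht.2 hξ (abs_nonneg _) hR
          _ ≤ 1 / 16 := by linarith
      have h3 := Real.pi_lt_four
      have h4 := Real.pi_pos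
      nlinarith
    · rw [sub_zero, abs_of_nonneg hR]
  have h2 : ‖(R : ℂ)‖ = R := by rw [Complex.norm_real, Real.norm_eq_abs, abs_of_nonneg hR]
  have h3 := norm_sub_norm_le (R : ℂ) (dirichletIntegral R ξ)
  rw [norm_sub_rev] at h3
  linarith

lemma conj_dirichletIntegral {R : ℝ} (hR : 0 ≤ R) (ξ : ℝ) :
    conj (dirichletIntegral R ξ) = ∫ u in (0 : ℝ)..R, phase (-(u * ξ)) := by
  rw [dirichletIntegral, intervalIntegral.integral_of_le hR, intervalIntegral.integral_of_le hR,
    ← integral_conj]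
  simp only [conj_phase]

/-- Uniform bounds for twisted integrals along the flow bound the spectral measure of an interval. -/
lemma IsSpectralMeasure.measureReal_Icc_le {Y : Type*} [MeasurableSpace Y] {ν : Measure Y}
    [IsZeroOrProbabilityMeasure ν] {h : ℝ → Y → Y} {f : Y → ℂ} {σ : Measure ℝ}
    (hσ : IsSpectralMeasure ν h f σ) (hf : Measurable f)
    (hfh : Measurable fun z : ℝ × Y => f (h z.1 z.2)) {L : ℝ} (hL : 0 ≤ L) (hfb : ∀ y, ‖f y‖ ≤ L)
    {ω R B r : ℝ} (hR : 0 < R) (hrR : r * R ≤ 1 / 16)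
    (hB : ∀ᵐ y ∂ν, ∀ u : ℝ, ‖∫ τ in (-u)..(R - u), phase (-(ω * τ)) * f (h τ y)‖ ≤ B) (hB0 : 0 ≤ B) :
    (R / 2) ^ 2 * σ.real (Icc (ω - r) (ω + r)) ≤ R * (L * B) := by
  have := hσ.isFiniteMeasure
  set D := fun x : ℝ => dirichletIntegral R (x - ω) with hD
  have hDc : Continuous D := (continuous_dirichletIntegral R).comp (by fun_prop)
  -- Expanding one factor of `|D|²` gives `∫ |D|² dσ = ∫₀ᴿ H(u) du`. Each `H u` involves only the
  -- correlations `⟨f ∘ h_τ, f⟩`, so neither a group law for `h` nor invariance of `ν` is needed;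
  -- the price is `R L B` in place of `B²`.
  set H : ℝ → ℂ := fun u => ∫ x, D x * phase (-(u * (x - ω))) ∂σ with hH
  have hHle : ∀ u, ‖H u‖ ≤ L * B := by
    intro u
    have e1 : H u = ∫ t in (0 : ℝ)..R, ∫ x, phase (-(ω * (t - u))) * phase (x * (t - u)) ∂σ := by
      rw [intervalIntegral_integral_swap]
      · refine integral_congr_ae (Filter.Eventually.of_forall fun x => ?_)
        simp only [hD, dirichletIntegral]
        rw [← intervalIntegral.integral_mul_const]
        refine intervalIntegral.integral_congr fun t _ => ?_
        rw [← phase_add, ← phase_add]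
        congr 1
        ring
      · have hfin : IsFiniteMeasure ((volume : Measure ℝ).restrict (uIoc 0 R)) := by
          rw [uIoc_of_le hR.le]; infer_instance
        refine Integrable.of_bound (Continuous.aestronglyMeasurable ?_) 1
          (Filter.Eventually.of_forall fun z => ?_)
        · exact (continuous_phase.comp (by fun_prop)).mul (continuous_phase.comp (by fun_prop))
        · simp [Function.uncurry, norm_phase]
    have e2 : H u = ∫ τ in (-u)..(R - u), ∫ y, phase (-(ω * τ)) * (f (h τ y) * conj (f y)) ∂ν := by
      have h1 := intervalIntegral.integral_comp_sub_right (a := 0) (b := R)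
        (fun τ => ∫ y, phase (-(ω * τ)) * (f (h τ y) * conj (f y)) ∂ν) u
      rw [zero_sub] at h1
      rw [← h1, e1]
      refine intervalIntegral.integral_congr fun t _ => ?_
      rw [integral_const_mul, integral_const_mul, ← hσ.fourier]
      simp only [exp_eq_phase]
    have e3 : H u = ∫ y, conj (f y) *
        (∫ τ in (-u)..(R - u), phase (-(ω * τ)) * f (h τ y)) ∂ν := by
      rw [e2, intervalIntegral_integral_swap]
      · refine integral_congr_ae (Filter.Eventually.of_forall fun y => ?_)
        simp only
        rw [← intervalIntegral.integral_const_mul]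
        refine intervalIntegral.integral_congr fun t _ => ?_
        ring
      · have hfin : IsFiniteMeasure ((volume : Measure ℝ).restrict (uIoc (-u) (R - u))) := by
          rw [uIoc_of_le (by linarith)]; infer_instance
        refine Integrable.of_bound (Measurable.aestronglyMeasurable ?_) (L * L)
          (Filter.Eventually.of_forall fun z => ?_)
        · refine Measurable.mul (continuous_phase.measurable.comp (by fun_prop)) (hfh.mul ?_)
          exact Complex.continuous_conj.measurable.comp (hf.comp measurable_snd)
        · simp only [Function.uncurry]
          rw [norm_phase_mul, norm_mul, RCLike.norm_conj]
          exact mul_le_mul (hfb _) (hfb _) (norm_nonneg _) hL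
    rw [e3]
    refine (norm_integral_le_of_norm_le_const (C := L * B) ?_).trans
      (mul_le_of_le_one_right (by positivity) ?_)
    · filter_upwards [hB] with y hy
      rw [norm_mul, RCLike.norm_conj]
      exact mul_le_mul (hfb y) (hy u) (norm_nonneg _) hL
    · exact measureReal_le_one
  have hint : Integrable (fun x => ‖D x‖ ^ 2) σ :=
    Integrable.of_bound (hDc.norm.pow 2).aestronglyMeasurable (R ^ 2)
      (Filter.Eventually.of_forall fun x => by
        rw [Real.norm_eq_abs, abs_of_nonneg (by positivity)]
        gcongr
        exact norm_dirichletIntegral_le hR.le _)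
  have hsq : ((∫ x, ‖D x‖ ^ 2 ∂σ : ℝ) : ℂ) = ∫ u in (0 : ℝ)..R, H u := by
    rw [← integral_complex_ofReal, hH, intervalIntegral_integral_swap]
    · refine integral_congr_ae (Filter.Eventually.of_forall fun x => ?_)
      simp only [hD]
      rw [intervalIntegral.integral_const_mul, ← conj_dirichletIntegral hR.le, Complex.mul_conj,
        Complex.normSq_eq_norm_sq]
    · have hfin : IsFiniteMeasure ((volume : Measure ℝ).restrict (uIoc 0 R)) := by
        rw [uIoc_of_le hR.le]; infer_instance
      refine Integrable.of_bound (Continuous.aestronglyMeasurable ?_) R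
        (Filter.Eventually.of_forall fun z => ?_)
      · exact (hDc.comp continuous_snd).mul (continuous_phase.comp (by fun_prop))
      · simp only [Function.uncurry, norm_mul, norm_phase, mul_one]
        exact norm_dirichletIntegral_le hR.le _
  have hle : ∫ x, ‖D x‖ ^ 2 ∂σ ≤ R * (L * B) := by
    have h1 : ‖((∫ x, ‖D x‖ ^ 2 ∂σ : ℝ) : ℂ)‖ ≤ L * B * |R - 0| := by
      rw [hsq]
      exact intervalIntegral.norm_integral_le_of_norm_le_const fun u _ => hHle u
    rw [Complex.norm_real, Real.norm_eq_abs, sub_zero, abs_of_pos hR] at h1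
    linarith [le_abs_self (∫ x, ‖D x‖ ^ 2 ∂σ)]
  refine le_trans ?_ ((mul_meas_ge_le_integral_of_nonneg
    (Filter.Eventually.of_forall fun x => by positivity) hint ((R / 2) ^ 2)).trans hle)
  gcongr
  · exact measure_ne_top _ _
  · intro x hx
    have h1 : |x - ω| ≤ r := by rw [abs_le]; constructor <;> linarith [hx.1, hx.2]
    have h2 := half_le_norm_dirichletIntegral hR.le hrR h1
    change (R / 2) ^ 2 ≤ ‖D x‖ ^ 2
    gcongr

end Spectral

/-! ### Replacing Lipschitz data on `[0, s_a]` by data on the line -/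

section LipData

variable {m : ℕ} {s : Fin m → ℝ} {ψ : Fin m → ℝ → ℂ}

lemma lipNormIcc_bounds {b : ℝ} {φ : ℝ → ℂ} (hb : 0 ≤ b) {K : NNReal}
    (hφ : LipschitzOnWith K φ (Icc 0 b)) :
    (∀ t ∈ Icc 0 b, ‖φ t‖ ≤ lipNormIcc b φ) ∧
      ∀ t ∈ Icc 0 b, ∀ u ∈ Icc 0 b, ‖φ t - φ u‖ ≤ lipNormIcc b φ * |t - u| := by
  set T := {K : ℝ | 0 ≤ K ∧ ∀ t ∈ Icc 0 b, ∀ u ∈ Icc 0 b, ‖φ t - φ u‖ ≤ K * |t - u|}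
  have hT : T.Nonempty := ⟨K, K.2, fun t ht u hu => by
    have := hφ.dist_le_mul t ht u hu
    rwa [dist_eq_norm, Real.dist_eq] at this⟩
  have h0 : 0 ≤ sInf T := le_csInf hT fun k hk => hk.1
  have hbdd : BddAbove ((fun t => ‖φ t‖) '' Icc 0 b) :=
    (isCompact_Icc.image_of_continuousOn hφ.continuousOn.norm).bddAbove
  have hsup : ∀ t ∈ Icc 0 b, ‖φ t‖ ≤ sSup ((fun t => ‖φ t‖) '' Icc 0 b) := fun t ht =>
    le_csSup hbdd ⟨t, ht, rfl⟩
  have hsup0 := (norm_nonneg _).trans (hsup 0 ⟨le_rfl, hb⟩)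
  refine ⟨fun t ht => ?_, fun t ht u hu => ?_⟩
  · have := hsup t ht
    simp only [lipNormIcc]
    linarith
  · rcases eq_or_ne t u with rfl | hne
    · simp
    · have hpos : 0 < |t - u| := abs_pos.2 (sub_ne_zero.2 hne)
      rw [← div_le_iff₀ hpos]
      have : ‖φ t - φ u‖ / |t - u| ≤ sInf T := le_csInf hT fun k hk => by
        rw [div_le_iff₀ hpos]
        exact hk.2 t ht u hu
      simp only [lipNormIcc]
      linarith

/-- The extension of `ψ a` from `[0, s a]` to the line that is constant on both sides. -/
def clampData (s : Fin m → ℝ) (ψ : Fin m → ℝ → ℂ) (a : Fin m) (t : ℝ) : ℂ :=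
  ψ a (max 0 (min t (s a)))

lemma clampData_eq {a : Fin m} {t : ℝ} (ht : t ∈ Icc 0 (s a)) : clampData s ψ a t = ψ a t := by
  rw [clampData, min_eq_left ht.2, max_eq_right ht.1]

lemma clampData_bounds (hs : ∀ j, 0 < s j) (hψ : IsLipData s ψ) :
    (∀ a t, ‖clampData s ψ a t‖ ≤ cylLipNorm s ψ) ∧
      ∀ a t u, ‖clampData s ψ a t - clampData s ψ a u‖ ≤ cylLipNorm s ψ * |t - u| := by
  have hle : ∀ a, lipNormIcc (s a) (ψ a) ≤ cylLipNorm s ψ := fun a =>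
    le_ciSup (f := fun a => lipNormIcc (s a) (ψ a)) (Set.finite_range _).bddAbove a
  have hmem : ∀ a t, max 0 (min t (s a)) ∈ Icc 0 (s a) := fun a t =>
    ⟨le_max_left _ _, max_le (hs a).le (min_le_right _ _)⟩
  have hclamp : ∀ a t u, |max 0 (min t (s a)) - max 0 (min u (s a))| ≤ |t - u| := fun a t u => by
    have h := ((LipschitzWith.id (α := ℝ)).min_const (s a)).const_max 0
    have := h.dist_le_mul t u
    simpa [Real.dist_eq] using this
  refine ⟨fun a t => ?_, fun a t u => ?_⟩
  · obtain ⟨K, hK⟩ := hψ a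
    exact ((lipNormIcc_bounds (hs a).le hK).1 _ (hmem a t)).trans (hle a)
  · obtain ⟨K, hK⟩ := hψ a
    have h0 : 0 ≤ cylLipNorm s ψ :=
      (norm_nonneg _).trans (((lipNormIcc_bounds (hs a).le hK).1 _ (hmem a t)).trans (hle a))
    refine ((lipNormIcc_bounds (hs a).le hK).2 _ (hmem a t) _ (hmem a u)).trans ?_
    exact mul_le_mul (hle a) (hclamp a t u) (abs_nonneg _) h0

lemma continuous_of_lipschitz_bound {φ : ℝ → ℂ} {L : ℝ} (hL : 0 ≤ L)
    (h : ∀ t u, ‖φ t - φ u‖ ≤ L * |t - u|) : Continuous φ :=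
  (LipschitzWith.of_dist_le_mul (K := ⟨L, hL⟩) fun t u => by
    rw [dist_eq_norm, Real.dist_eq]; exact h t u).continuous

/-- Along a flow line the height inside a tile lies in `[0, s_a]`, where nothing is changed. -/
lemma flowLine_clampData (hs : ∀ j, 0 < s j) (x : ℤ → Fin m) (u : ℝ) :
    flowLine s (clampData s ψ) x u = flowLine s ψ x u := by
  obtain ⟨h1, h2⟩ := tileIndex_spec hs x u
  rw [roofSum_add_one] at h2
  exact clampData_eq ⟨by linarith, by linarith⟩

lemma measurableSet_space (ζ : Substitution m) : MeasurableSet ζ.space := by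
  have : ζ.space = ⋂ n : ℕ, (fun (x : ℤ → Fin m) (i : Fin (2 * n + 1)) => x ((i : ℤ) - n)) ⁻¹'
      {g | ∃ (k : ℕ) (a : Fin m), List.ofFn g <:+: ζ.iter k a} := by
    ext x; simp [Substitution.space, centralBlock]
  rw [this]
  exact MeasurableSet.iInter fun n => measurable_pi_lambda _ (fun i => measurable_pi_apply _)
    (Set.toFinite _).measurableSet

lemma measurableSet_suspensionSpace (ζ : Substitution m) (s : Fin m → ℝ) :
    MeasurableSet (suspensionSpace ζ s) := by
  have h : Measurable fun p : (ℤ → Fin m) × ℝ => s (p.1 0) :=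
    (measurable_of_countable s).comp ((measurable_pi_apply 0).comp measurable_fst)
  exact (measurable_fst (measurableSet_space ζ)).inter
    ((measurableSet_le measurable_const measurable_snd).inter (measurableSet_lt measurable_snd h))

lemma ae_mem_suspensionSpace (ζ : Substitution m) (s : Fin m → ℝ) (μ : Measure (ℤ → Fin m)) :
    ∀ᵐ y ∂(suspensionMeasure ζ s μ), y ∈ suspensionSpace ζ s :=
  ProbabilityTheory.ae_cond_mem (measurableSet_suspensionSpace ζ s)

lemma IsSpectralMeasure.clampData (hs : ∀ j, 0 < s j) {ζ : Substitution m}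
    {μ : Measure (ℤ → Fin m)} {σ : Measure ℝ}
    (hσ : IsSpectralMeasure (suspensionMeasure ζ s μ) (suspensionFlow s) (cylFun ψ) σ) :
    IsSpectralMeasure (suspensionMeasure ζ s μ) (suspensionFlow s) (cylFun (clampData s ψ)) σ where
  isFiniteMeasure := hσ.isFiniteMeasure
  fourier t := by
    rw [hσ.fourier]
    refine integral_congr_ae ?_
    filter_upwards [ae_mem_suspensionSpace ζ s μ] with y hy
    rw [cylFun_suspensionFlow, cylFun_suspensionFlow, flowLine_clampData hs]
    congr 2
    exact (clampData_eq ⟨hy.2.1, hy.2.2.le⟩).symm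

end LipData

end

/-! ### Decay estimates for almost every roof vector -/

section SpectralBounds

variable {m : ℕ}

/-- A bound for the twisted integrals over all flow line segments of length `R` bounds the spectral
measure of intervals of length comparable to `1 / R`. -/
lemma measureReal_Icc_le_of_flowLine {ζ : Substitution m} {s : Fin m → ℝ} (hs : ∀ j, 0 < s j)
    {ψ : Fin m → ℝ → ℂ} {L : ℝ} (hL : 0 ≤ L) (hψ : ∀ a, Measurable (ψ a))
    (hb : ∀ a t, ‖ψ a t‖ ≤ L) {μ : Measure (ℤ → Fin m)} {σ : Measure ℝ}
    (hσ : IsSpectralMeasure (suspensionMeasure ζ s μ) (suspensionFlow s) (cylFun ψ) σ)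
    {ω r B : ℝ} (hr : 0 < r) (hB0 : 0 ≤ B)
    (hB : ∀ x ∈ ζ.space, ∀ A : ℝ,
      ‖∫ u in A..(A + 1 / (16 * r)), phase (-(ω * u)) * flowLine s ψ x u‖ ≤ B * (1 / (16 * r))) :
    σ.real (Icc (ω - r) (ω + r)) ≤ 4 * L * B := by
  set R := 1 / (16 * r) with hR
  have hR0 : 0 < R := by positivity
  have hpair : Measurable fun z : Fin m × ℝ => ψ z.1 z.2 := measurable_from_prod_countable_right hψ
  have hfst : Measurable fun y : (ℤ → Fin m) × ℝ => y.1 0 :=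
    (measurable_pi_apply 0).comp measurable_fst
  have hf : Measurable (cylFun ψ) := hpair.comp (hfst.prodMk measurable_snd)
  have hfh : Measurable fun z : ℝ × ((ℤ → Fin m) × ℝ) =>
      cylFun ψ (suspensionFlow s z.1 z.2) := by
    simp only [cylFun_suspensionFlow]
    exact (measurable_flowLine hs hψ).comp ((measurable_fst.comp measurable_snd).prodMk
      ((measurable_snd.comp measurable_snd).add measurable_fst))
  have : IsZeroOrProbabilityMeasure (suspensionMeasure ζ s μ) := by
    unfold suspensionMeasure; infer_instance
  have key := hσ.measureReal_Icc_le hf hfh hL (fun y => hb _ _) (ω := ω) (r := r) (B := B * R) hR0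
    (by rw [hR]; field_simp; norm_num) ?_ (by positivity)
  · have h1 : R ^ 2 * (σ.real (Icc (ω - r) (ω + r))) ≤ R ^ 2 * (4 * L * B) := by nlinarith
    exact le_of_mul_le_mul_left h1 (by positivity)
  · filter_upwards [ae_mem_suspensionSpace ζ s μ] with y hy u
    have h1 := hB y.1 hy.1 (y.2 - u)
    -- Starting at height `y.2` only translates the segment and multiplies by a unimodular factor.
    have e : ∫ τ in (-u)..(R - u), phase (-(ω * τ)) * cylFun ψ (suspensionFlow s τ y) =
        phase (ω * y.2) * ∫ v in (y.2 - u)..(y.2 - u + R),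
          phase (-(ω * v)) * flowLine s ψ y.1 v := by
      have h2 := intervalIntegral.integral_comp_add_right (a := -u) (b := R - u)
        (fun v => phase (-(ω * v)) * flowLine s ψ y.1 v) y.2
      rw [show -u + y.2 = y.2 - u by ring, show R - u + y.2 = y.2 - u + R by ring] at h2
      rw [← h2, ← intervalIntegral.integral_const_mul]
      refine intervalIntegral.integral_congr fun τ _ => ?_
      simp only [cylFun_suspensionFlow]
      rw [← mul_assoc, ← phase_add, add_comm y.2 τ]
      congr 2
      ring
    rw [e, norm_phase_mul]
    exact h1

lemma norm_integral_flowLine_le {s : Fin m → ℝ} {ψ : Fin m → ℝ → ℂ} {L : ℝ}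
    (hb : ∀ a t, ‖ψ a t‖ ≤ L) (ω : ℝ) (x : ℤ → Fin m) (A : ℝ) {R : ℝ} (hR : 0 ≤ R) :
    ‖∫ u in A..(A + R), phase (-(ω * u)) * flowLine s ψ x u‖ ≤ L * R := by
  refine (intervalIntegral.norm_integral_le_of_norm_le_const (C := L) fun u _ => ?_).trans ?_
  · rw [norm_phase_mul]; exact norm_flowLine_le hb x u
  · rw [add_sub_cancel_left, abs_of_nonneg hR]

/-- At high frequencies twisted integrals are small. -/
lemma norm_integral_flowLine_le_div {ζ : Substitution m} {p : ℕ} (hp : ∀ a b, a ∈ ζ.iter p b)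
    {s : Fin m → ℝ} (hs : s ∈ openSimplex m) {ψ : Fin m → ℝ → ℂ} {L : ℝ} (hL : 0 ≤ L)
    (hb : ∀ a t, ‖ψ a t‖ ≤ L) (hl : ∀ a t u, ‖ψ a t - ψ a u‖ ≤ L * |t - u|) {ω : ℝ} (hω : ω ≠ 0)
    {x : ℤ → Fin m} (hx : x ∈ ζ.space) (A : ℝ) {R : ℝ} (hR : 1 ≤ R) :
    ‖∫ u in A..(A + R), phase (-(ω * u)) * flowLine s ψ x u‖ ≤
      L * (2 / R + 4 * ζ.maxLen p / |ω|) * R := by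
  have hψc : ∀ a, Continuous (ψ a) := fun a => continuous_of_lipschitz_bound hL (hl a)
  obtain ⟨i, n, hlen, hint⟩ := exists_block_integral_le hs (fun a => (hψc a).measurable) hb ω x A
    (by linarith : 0 ≤ R)
  obtain ⟨k, a, hinf⟩ := exists_block_isInfix hx i n
  have h1 := norm_twistedSum_le ω s (norm_tileIntegral_le_div hs hb hl hψc hω) (block x i n)
  have h2 := length_le_of_isInfix hp hs hinf
  have h3 : ((block x i n).length : ℝ) ≤ ζ.maxLen p * (4 * R) :=
    h2.trans (by gcongr; linarith)
  have hω' : 0 < |ω| := abs_pos.2 hω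
  have h4 : L / |ω| * (block x i n).length ≤ L / |ω| * (ζ.maxLen p * (4 * R)) := by gcongr
  refine (hint.trans (add_le_add le_rfl (h1.trans h4))).trans (le_of_eq ?_)
  have : R ≠ 0 := by positivity
  field_simp

/-- The twisted integrals over long segments of flow lines, in terms of the number of levels at
which the return word is out of phase. -/
lemma norm_integral_flowLine_le_of_decay {ζ : Substitution m} {p : ℕ}
    (hp : ∀ a b, a ∈ ζ.iter p b) {s : Fin m → ℝ} (hs : s ∈ openSimplex m) {ψ : Fin m → ℝ → ℂ}
    {L : ℝ} (hL : 0 ≤ L) (hψ : ∀ a, Measurable (ψ a)) (hb : ∀ a t, ‖ψ a t‖ ≤ L) {ω ε : ℝ}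
    (hε : 0 ≤ ε) {n : ℕ}
    (hdec : ∀ w, ‖twistedSum ω s (tileIntegral ω s ψ) (ζ.iterWord n w)‖ ≤
      L * ε * (ζ.iterWord n w).length)
    {x : ℤ → Fin m} (hx : x ∈ ζ.space) (A : ℝ) {R : ℝ} (hR : 1 ≤ R) :
    ‖∫ u in A..(A + R), phase (-(ω * u)) * flowLine s ψ x u‖ ≤
      L * (2 + 2 * ζ.maxLen n + 4 * ζ.maxLen p * ε * R) := by
  obtain ⟨i, N, hlen, hint⟩ := exists_block_integral_le hs hψ hb ω x A (by linarith : 0 ≤ R)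
  obtain ⟨k, a, hinf⟩ := exists_block_isInfix hx i N
  have h2 := length_le_of_isInfix hp hs hinf
  have h3 : ((block x i N).length : ℝ) ≤ ζ.maxLen p * (4 * R) :=
    h2.trans (by gcongr; linarith)
  obtain ⟨u, w, v, he, hu, hv⟩ := ζ.exists_iterWord_of_isInfix n k a _ hinf
  set φ := tileIntegral ω s ψ
  have hφ := norm_tileIntegral_le hs hb ω
  have hu' : (u.length : ℝ) ≤ ζ.maxLen n := by exact_mod_cast hu
  have hv' : (v.length : ℝ) ≤ ζ.maxLen n := by exact_mod_cast hv
  have hw' : ((ζ.iterWord n w).length : ℝ) ≤ ζ.maxLen p * (4 * R) := by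
    refine le_trans ?_ h3
    rw [he]
    simp only [List.length_append]
    push_cast
    have : (0 : ℝ) ≤ u.length := by positivity
    have : (0 : ℝ) ≤ v.length := by positivity
    linarith
  have t1 := norm_twistedSum_append_le ω s φ (u ++ ζ.iterWord n w) v
  have t2 := norm_twistedSum_append_le ω s φ u (ζ.iterWord n w)
  have t3 := (norm_twistedSum_le ω s hφ u).trans (mul_le_mul_of_nonneg_left hu' hL)
  have t4 := (norm_twistedSum_le ω s hφ v).trans (mul_le_mul_of_nonneg_left hv' hL)
  have t5 := (hdec w).trans (mul_le_mul_of_nonneg_left hw' (mul_nonneg hL hε))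
  rw [← he] at t1
  refine hint.trans ?_
  linarith

/-- For almost every roof vector, the normalized twisted sums over `ζ^n(w)` decay exponentially in
`n`, uniformly over a range of frequencies that grows exponentially. -/
theorem exists_ae_twistedSum_decay {ζ : Substitution m} (hprim : ζ.Primitive)
    (hirr : Irreducible (ζ.matrix.map (Int.cast : ℤ → ℚ)).charpoly)
    (hθ : 1 < ζ.secondModulus) :
    ∃ (q : ℕ) (ν κ η : ℝ), 0 < ν ∧ ν < 1 ∧ 0 < κ ∧ 0 < η ∧ ∀ᵐ s ∂(simplexMeasure m),
      s ∈ openSimplex m ∧ ∃ n₀ : ℕ, ∀ n ≥ n₀, ∀ ω : ℝ, ω ≠ 0 → |(Real.log |ω|)| ≤ κ * n →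
        ∀ (φ : Fin m → ℂ) (M : ℝ), (∀ a, ‖φ a‖ ≤ M) → ∀ w : List (Fin m),
          ‖twistedSum ω s φ (ζ.iterWord (n + q) w)‖ ≤
            M * ν ^ (η * n) * (ζ.iterWord (n + q) w).length := by
  have hm := Substitution.two_le_of_secondModulus hθ
  have : NeZero m := ⟨by omega⟩
  obtain ⟨p, hp⟩ := hprim.exists_mem_iter
  obtain ⟨q, c, v, hv⟩ := Substitution.exists_return_word hp hm
  set l : Fin m → ℤ := Substitution.popVec (c :: v) with hl
  have hl0 : l ≠ 0 := fun h => by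
    have := congrFun h c
    simp [hl, Substitution.popVec] at this
    omega
  set u : ℕ → Fin m → ℤ := fun k => (ζ.matrix ^ k).mulVec l with hu
  obtain ⟨coef, hrec⟩ := Matrix.exists_recurrence ζ.matrix l
  obtain ⟨w, b, C₀, τ, hC₀, hτ, hτ1, hw, hb, hcon⟩ :=
    Substitution.exists_contracting_functionals hprim hirr hθ hl0
  obtain ⟨ρ, κ, η, N, hρ, hρ1, hκ, hη, hN, hEK⟩ :=
    exists_erdos_kahane (u := u) coef hrec hC₀ hτ hτ1 hw hcon
  obtain ⟨ν, hν, hν1, hdecay⟩ := exists_twistedSum_decay hp hv hρ hρ1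
  -- Identifies the pairings of the Erdős–Kahane argument with the phases of the return word.
  have hpair : ∀ (ω : ℝ) (s : Fin m → ℝ) (k : ℕ),
      pairing u (ω • s) k = ω * roofWord s (ζ.iterWord k (c :: v)) := by
    intro ω s k
    rw [roofWord_eq_sum, Finset.mul_sum, Substitution.popVec_iterWord]
    exact Finset.sum_congr rfl fun i _ => by simp [hu, hl, mul_assoc]
  refine ⟨q, ν, κ, η, hν, hν1, hκ, hη, ?_⟩
  filter_upwards [ae_simplex_projCoord_notMem (by omega) hw hb hN] with s hs
  obtain ⟨hs, hsN⟩ := hs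
  obtain ⟨n₀, hn₀⟩ := hEK s hs hsN
  refine ⟨hs, n₀, fun n hn ω hω hωn φ M hφ w => ?_⟩
  have hωpos : 0 < |ω| := abs_pos.2 hω
  have hM : 0 ≤ M := (norm_nonneg _).trans (hφ c)
  have hcount := hn₀ n hn ω ((Real.le_log_iff_exp_le hωpos).1 (abs_le.1 hωn).1)
    ((Real.log_le_iff_le_exp hωpos).1 (abs_le.1 hωn).2)
  refine (hdecay ω s φ M hφ n w).trans ?_
  have e : Nat.count (fun k => ρ ≤ |ω * roofWord s (ζ.iterWord k (c :: v)) -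
      round (ω * roofWord s (ζ.iterWord k (c :: v)))|) n =
      Nat.count (OffIntegers u ρ (ω • s)) n := by
    rw [Nat.count_eq_card_filter_range, Nat.count_eq_card_filter_range]
    simp only [OffIntegers, hpair]
  rw [e]
  gcongr
  rw [← Real.rpow_natCast]
  exact Real.rpow_le_rpow_of_exponent_ge hν hν1.le hcount

/-- The Hölder bound for the spectral measure at all sufficiently small scales. -/
theorem exists_spectral_decay {ζ : Substitution m} (hprim : ζ.Primitive)
    (hirr : Irreducible (ζ.matrix.map (Int.cast : ℤ → ℚ)).charpoly)
    (hθ : 1 < ζ.secondModulus) :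
    ∃ γ Z C : ℝ, 0 < γ ∧ 0 < Z ∧ 0 < C ∧ ∀ᵐ s ∂(simplexMeasure m), s ∈ openSimplex m ∧
      ∃ r₁ : ℝ, 0 < r₁ ∧ r₁ ≤ 1 ∧ ∀ (ψ : Fin m → ℝ → ℂ) (L : ℝ), 0 ≤ L →
        (∀ a, Measurable (ψ a)) → (∀ a t, ‖ψ a t‖ ≤ L) → ∀ (μ : Measure (ℤ → Fin m)) (σ : Measure ℝ),
          IsSpectralMeasure (suspensionMeasure ζ s μ) (suspensionFlow s) (cylFun ψ) σ →
            ∀ ω : ℝ, ω ≠ 0 → ∀ r : ℝ, 0 < r → r ≤ r₁ * Real.exp (-(Z * |(Real.log |ω|)|)) →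
              σ.real (Icc (ω - r) (ω + r)) ≤ C * L ^ 2 * r ^ γ := by
  obtain ⟨p, hp⟩ := hprim.exists_mem_iter
  obtain ⟨q, ν, κ, η, hν, hν1, hκ, hη, hae⟩ := exists_ae_twistedSum_decay hprim hirr hθ
  set Q : ℝ := max (ζ.maxLen 1) 2 with hQ
  have hQ2 : 2 ≤ Q := le_max_right _ _
  have hlogQ : 0 < Real.log Q := Real.log_pos (by linarith)
  have hmaxQ : ∀ n, (ζ.maxLen n : ℝ) ≤ Q ^ n := fun n => by
    have h1 : (ζ.maxLen n : ℝ) ≤ (ζ.maxLen 1 : ℝ) ^ n := by exact_mod_cast ζ.maxLen_le_pow n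
    exact h1.trans (by gcongr; exact le_max_left _ _)
  have hlogν : Real.log ν < 0 := Real.log_neg hν hν1
  -- With `n` about `log R / (2 log Q)`, this is the exponent for which `ν ^ (η n)` is at most a
  -- multiple of `R ^ (-γ')`.
  set γ' : ℝ := η * -Real.log ν / (2 * Real.log Q) with hγ'
  have hγ'0 : 0 < γ' := div_pos (mul_pos hη (by linarith)) (by positivity)
  set γ := min γ' (1 / 2) with hγ
  have hγ0 : 0 < γ := lt_min hγ'0 (by norm_num)
  -- Chosen so that the condition on `r` forces `|log |ω|| ≤ κ n`.
  set Z : ℝ := 2 * Real.log Q / κ with hZ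
  have hZ0 : 0 < Z := by positivity
  set K : ℝ := 2 + 2 * Q ^ q + 4 * ζ.maxLen p * ν ^ (-η) with hK
  have hνη : 0 < ν ^ (-η) := Real.rpow_pos_of_pos hν _
  have hK0 : 0 < K := by positivity
  refine ⟨γ, Z, 4 * K * 16 ^ γ, hγ0, hZ0, by positivity, ?_⟩
  filter_upwards [hae] with s hs
  obtain ⟨hs, n₀, hn₀⟩ := hs
  -- The `16` matches `R = 1 / (16 r)`, and `n₀ + 1` allows for the floor in the choice of `n`.
  have hr₁ : 0 < Real.exp (-(2 * Real.log Q * (n₀ + 1))) / 16 := by positivity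
  refine ⟨hs, Real.exp (-(2 * Real.log Q * (n₀ + 1))) / 16, hr₁, ?_, ?_⟩
  · have : Real.exp (-(2 * Real.log Q * (n₀ + 1))) ≤ 1 :=
      Real.exp_le_one_iff.2 (by have : 0 ≤ 2 * Real.log Q * (n₀ + 1) := by positivity
                                linarith)
    linarith
  intro ψ L hL hψ hψb μ σ hσ ω hω r hr hrle
  set R := 1 / (16 * r) with hR
  have hR0 : 0 < R := by positivity
  have hlogR : 2 * Real.log Q * (n₀ + 1) + Z * |(Real.log |ω|)| ≤ Real.log R := by
    rw [Real.le_log_iff_exp_le hR0, hR, le_div_iff₀ (by positivity)]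
    rw [div_mul_eq_mul_div, ← Real.exp_add, le_div_iff₀ (by norm_num)] at hrle
    have h1 := mul_le_mul_of_nonneg_left hrle
      (Real.exp_pos (2 * Real.log Q * (n₀ + 1) + Z * |(Real.log |ω|)|)).le
    rw [← Real.exp_add] at h1
    have e : 2 * Real.log Q * (n₀ + 1) + Z * |(Real.log |ω|)| +
      (-(2 * Real.log Q * (n₀ + 1)) + -(Z * |(Real.log |ω|)|)) = 0 := by ring
    rw [e, Real.exp_zero] at h1
    linarith
  have hZlog : 0 ≤ Z * |(Real.log |ω|)| := by positivity
  have hR1 : 1 ≤ R := by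
    rw [← Real.log_nonneg_iff hR0]
    have : 0 ≤ 2 * Real.log Q * (n₀ + 1) := by positivity
    linarith
  have hlogR0 : 0 ≤ Real.log R := Real.log_nonneg hR1
  -- The level is such that `Q ^ n ≤ √R`: the incomplete words at the ends are negligible against
  -- `R`, while `n` is still proportional to `log R`.
  set n : ℕ := ⌊Real.log R / (2 * Real.log Q)⌋₊ with hn
  have hn1 : (n : ℝ) ≤ Real.log R / (2 * Real.log Q) := Nat.floor_le (by positivity)
  have hn2 : Real.log R / (2 * Real.log Q) < n + 1 := Nat.lt_floor_add_one _
  have hlow : n₀ + 1 + |(Real.log |ω|)| / κ ≤ Real.log R / (2 * Real.log Q) := by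
    rw [le_div_iff₀ (by positivity)]
    refine le_trans (le_of_eq ?_) hlogR
    rw [hZ]; ring
  have hκlog : 0 ≤ |(Real.log |ω|)| / κ := by positivity
  have hnn₀ : n₀ ≤ n := by
    have : (n₀ : ℝ) < n + 1 := by linarith
    exact Nat.lt_succ_iff.1 (by exact_mod_cast this)
  have hωn : |(Real.log |ω|)| ≤ κ * n := by
    have h1 : |(Real.log |ω|)| / κ ≤ n := by
      have : (0 : ℝ) ≤ n₀ := by positivity
      linarith
    rwa [div_le_iff₀ hκ, mul_comm] at h1
  set ε : ℝ := ν ^ (η * n) with hε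
  have hε0 : 0 < ε := Real.rpow_pos_of_pos hν _
  have hdec := hn₀ n hnn₀ ω hω hωn _ L (norm_tileIntegral_le hs hψb ω)
  have hQn : (Q : ℝ) ^ n ≤ R ^ (1 - γ) := by
    have h1 : Q ^ n = Real.exp (n * Real.log Q) := by
      rw [Real.exp_nat_mul, Real.exp_log (by linarith)]
    rw [h1, Real.rpow_def_of_pos hR0]
    apply Real.exp_le_exp.2
    rw [le_div_iff₀ (by positivity)] at hn1
    have h2 : γ ≤ 1 / 2 := min_le_right _ _
    nlinarith
  have hεR : ε * R ≤ ν ^ (-η) * R ^ (1 - γ) := by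
    have h1 : ε ≤ ν ^ (-η) * R ^ (-γ) := by
      rw [hε, Real.rpow_def_of_pos hν, Real.rpow_def_of_pos hν, Real.rpow_def_of_pos hR0,
        ← Real.exp_add]
      apply Real.exp_le_exp.2
      have h2 : Real.log R * γ ≤ Real.log R * γ' :=
        mul_le_mul_of_nonneg_left (min_le_left _ _) hlogR0
      have h3 : Real.log R * γ' ≤ (n + 1) * (η * -Real.log ν) := by
        have e : Real.log R * γ' = Real.log R / (2 * Real.log Q) * (η * -Real.log ν) := by
          rw [hγ']; ring
        rw [e]
        exact mul_le_mul_of_nonneg_right hn2.le (mul_nonneg hη.le (by linarith))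
      nlinarith
    calc ε * R ≤ ν ^ (-η) * R ^ (-γ) * R := by gcongr
      _ = ν ^ (-η) * R ^ (1 - γ) := by
        rw [mul_assoc, ← Real.rpow_add_one hR0.ne']; ring_nf
  have h1R : 1 ≤ R ^ (1 - γ) := by
    have h2 : γ ≤ 1 / 2 := min_le_right _ _
    exact Real.one_le_rpow hR1 (by linarith)
  have hfinal := measureReal_Icc_le_of_flowLine (ζ := ζ) hs.1 hL hψ hψb hσ (ω := ω) (r := r)
    (B := L * (K * R ^ (-γ))) hr (by positivity) fun x hx A => by
      rw [← hR]
      refine (norm_integral_flowLine_le_of_decay hp hs hL hψ hψb hε0.le hdec hx A hR1).trans ?_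
      have e : L * (K * R ^ (-γ)) * R = L * (K * R ^ (1 - γ)) := by
        rw [mul_assoc L, mul_assoc K, ← Real.rpow_add_one hR0.ne']; ring_nf
      rw [e]
      have h3 : (ζ.maxLen (n + q) : ℝ) ≤ Q ^ q * R ^ (1 - γ) := by
        refine (hmaxQ (n + q)).trans ?_
        rw [pow_add, mul_comm]
        gcongr
      have h4 : 4 * ζ.maxLen p * ε * R ≤ 4 * ζ.maxLen p * ν ^ (-η) * R ^ (1 - γ) := by
        rw [mul_assoc _ ε, mul_assoc _ (ν ^ (-η))]
        gcongr
      refine mul_le_mul_of_nonneg_left ?_ hL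
      rw [hK]
      linarith
  refine hfinal.trans (le_of_eq ?_)
  have e : R ^ (-γ) = 16 ^ γ * r ^ γ := by
    rw [hR, one_div, Real.inv_rpow (by positivity), Real.rpow_neg (by positivity), inv_inv,
      Real.mul_rpow (by norm_num) hr.le]
  rw [e]
  ring

end SpectralBounds

/-! ### Combining low and high frequencies -/

theorem mainTheorem3 {m : ℕ} (ζ : Substitution m) (hprim : ζ.Primitive) (haper : ζ.Aperiodic)
    (hirr : Irreducible (ζ.matrix.map (Int.cast : ℤ → ℚ)).charpoly)
    (hθ : 1 < ζ.secondModulus) :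
    ∃ γ Z : ℝ, 0 < γ ∧ 0 < Z ∧ ∃ C : ℝ → ℝ, (∀ L, 0 < C L) ∧
      ∀ μ : Measure (ℤ → Fin m), ζ.IsInvariantMeasure μ →
        ∀ᵐ s ∂(simplexMeasure m), ∃ r₀ : ℝ, 0 < r₀ ∧
          ∀ ψ : Fin m → ℝ → ℂ, IsLipData s ψ →
            ∀ σ : Measure ℝ,
              IsSpectralMeasure (suspensionMeasure ζ s μ) (suspensionFlow s) (cylFun ψ) σ →
                ∀ ω : ℝ, ω ≠ 0 → ∀ r : ℝ, 0 < r → r < r₀ * |ω| ^ Z →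
                  σ.real (Icc (ω - r) (ω + r)) ≤ C (cylLipNorm s ψ) * r ^ γ := by
  have hm := Substitution.two_le_of_secondModulus hθ
  obtain ⟨p, hp⟩ := hprim.exists_mem_iter
  obtain ⟨γ₁, Z, CA, hγ₁, hZ, hCA, hae⟩ := exists_spectral_decay hprim hirr hθ
  set Λ : ℝ := ((ζ.maxLen p : ℕ) : ℝ) with hΛ
  set CB : ℝ := 128 + 16 * Λ with hCB
  have hΛ0 : 0 ≤ Λ := by positivity
  set γ : ℝ := min γ₁ (min (1 / (2 * Z)) 1) with hγ
  have hγ0 : 0 < γ := lt_min hγ₁ (lt_min (by positivity) one_pos)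
  have hγA : γ ≤ γ₁ := min_le_left _ _
  have hγZ : γ ≤ 1 / (2 * Z) := (min_le_right _ _).trans (min_le_left _ _)
  have hγ1 : γ ≤ 1 := (min_le_right _ _).trans (min_le_right _ _)
  refine ⟨γ, Z, hγ0, hZ, fun L => (64 + CA + 2 * CB) * (1 + L ^ 2), fun L => by positivity,
    fun μ _ => ?_⟩
  filter_upwards [hae] with s hs
  obtain ⟨hs, r₁, hr₁, hr₁1, hdec⟩ := hs
  -- The cube is what forces `r₁ |ω|^Z ≥ 1` in the last case below.
  refine ⟨r₁ ^ 3, by positivity, fun ψ hψ σ hσ ω hω r hr hrlt => ?_⟩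
  obtain ⟨hb, hl⟩ := clampData_bounds hs.1 hψ
  set L := cylLipNorm s ψ with hLdef
  have hL : 0 ≤ L := (norm_nonneg _).trans (hb ⟨0, by omega⟩ 0)
  have hmeas : ∀ a, Measurable (clampData s ψ a) := fun a =>
    (continuous_of_lipschitz_bound hL (hl a)).measurable
  have hσ' := hσ.clampData hs.1
  have hωpos : 0 < |ω| := abs_pos.2 hω
  have hrγ : 0 < r ^ γ := Real.rpow_pos_of_pos hr _
  suffices h : ∃ C : ℝ, C ≤ 64 + CA + 2 * CB ∧
      σ.real (Icc (ω - r) (ω + r)) ≤ C * L ^ 2 * r ^ γ by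
    obtain ⟨C, hC, h⟩ := h
    refine h.trans ?_
    have h1 : C * L ^ 2 ≤ (64 + CA + 2 * CB) * L ^ 2 := by gcongr
    have h2 : (0 : ℝ) < 64 + CA + 2 * CB := by positivity
    gcongr
    linarith
  -- For `r ≥ 1 / 16` the segments are shorter than needed and the trivial bound suffices, because
  -- `r ^ γ ≥ 1 / 16`.
  rcases le_or_gt (1 / 16) r with hr16 | hr16
  · refine ⟨64, by linarith, ?_⟩
    have h1 := measureReal_Icc_le_of_flowLine (ζ := ζ) hs.1 hL hmeas hb hσ' (ω := ω) hr hL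
      fun x _ A => norm_integral_flowLine_le hb ω x A (by positivity)
    have h2 : 1 / 16 ≤ r ^ γ := by
      calc (1 / 16 : ℝ) = (1 / 16) ^ (1 : ℝ) := (Real.rpow_one _).symm
        _ ≤ (1 / 16) ^ γ := Real.rpow_le_rpow_of_exponent_ge (by norm_num) (by norm_num) hγ1
        _ ≤ r ^ γ := Real.rpow_le_rpow (by norm_num) hr16 hγ0.le
    nlinarith [sq_nonneg L]
  have hr1 : r ≤ 1 := by linarith
  have hA : r ≤ r₁ * Real.exp (-(Z * |(Real.log |ω|)|)) →
      σ.real (Icc (ω - r) (ω + r)) ≤ CA * L ^ 2 * r ^ γ := fun h => by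
    refine (hdec _ L hL hmeas hb μ σ hσ' ω hω r hr h).trans ?_
    have := Real.rpow_le_rpow_of_exponent_ge hr hr1 hγA
    gcongr
  have hX0 : 0 < |ω| ^ Z := Real.rpow_pos_of_pos hωpos _
  rcases le_or_gt |ω| 1 with hω1 | hω1
  · refine ⟨CA, by linarith, hA ?_⟩
    have e : Real.exp (-(Z * |(Real.log |ω|)|)) = |ω| ^ Z := by
      rw [abs_of_nonpos (Real.log_nonpos hωpos.le hω1), Real.rpow_def_of_pos hωpos]
      ring_nf
    rw [e]
    refine hrlt.le.trans ?_
    gcongr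
    exact pow_le_of_le_one hr₁.le hr₁1 (by norm_num)
  -- For `|ω| > 1` the decay estimate reaches only `r ≤ r₁ |ω|^{-Z}`, while the claim extends to `r₀
  -- |ω|^Z`; the gap is filled by the Lipschitz decay.
  · have e : Real.exp (-(Z * |(Real.log |ω|)|)) = (|ω| ^ Z)⁻¹ := by
      rw [abs_of_pos (Real.log_pos hω1), Real.rpow_def_of_pos hωpos, ← Real.exp_neg]
      ring_nf
    rw [e] at hA
    set X := |ω| ^ Z with hX
    by_cases hcase : r ≤ r₁ * X⁻¹
    · exact ⟨CA, by linarith, hA hcase⟩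
    refine ⟨2 * CB, by linarith, ?_⟩
    push Not at hcase
    have hXr : 1 ≤ r₁ * X := by
      by_contra! hlt
      have h1 : r₁ ^ 3 * X < r₁ ^ 2 := by nlinarith [pow_pos hr₁ 2]
      have h2 : r₁ ^ 2 ≤ r₁ * X⁻¹ := by
        rw [← div_eq_mul_inv, le_div_iff₀ hX0]
        nlinarith
      linarith
    -- Here `r > r₁ X⁻¹ ≥ X⁻²`, so `|ω|⁻¹ = X^{-1/Z}` is at most `r ^ (1 / (2 Z))`; this is the
    -- reason for the term `1 / (2 Z)` in `γ`.
    have hinv : |ω|⁻¹ ≤ r ^ γ := by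
      have h1 : (X⁻¹) ^ 2 ≤ r := by
        have h2 : X⁻¹ ≤ r₁ := by
          rw [inv_le_iff_one_le_mul₀ hX0]; linarith
        have h3 : 0 < X⁻¹ := by positivity
        nlinarith
      have h4 : |ω|⁻¹ = ((X⁻¹) ^ 2) ^ (1 / (2 * Z)) := by
        rw [hX, ← Real.rpow_neg hωpos.le, ← Real.rpow_natCast, ← Real.rpow_mul hωpos.le,
          ← Real.rpow_mul hωpos.le, ← Real.rpow_neg_one]
        congr 1
        push_cast
        field_simp
      rw [h4]
      refine (Real.rpow_le_rpow (by positivity) h1 (by positivity)).trans ?_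
      exact Real.rpow_le_rpow_of_exponent_ge hr hr1 hγZ
    have hrr : r ≤ r ^ γ := by
      calc r = r ^ (1 : ℝ) := (Real.rpow_one r).symm
        _ ≤ r ^ γ := Real.rpow_le_rpow_of_exponent_ge hr hr1 hγ1
    have hR1 : 1 ≤ 1 / (16 * r) := by
      rw [le_div_iff₀ (by positivity)]; linarith
    have h1 := measureReal_Icc_le_of_flowLine (ζ := ζ) hs.1 hL hmeas hb hσ' (ω := ω) hr
      (B := L * (2 / (1 / (16 * r)) + 4 * Λ / |ω|)) (by positivity)
      fun x hx A => norm_integral_flowLine_le_div hp hs hL hb hl hω hx A hR1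
    refine h1.trans ?_
    have e2 : 4 * L * (L * (2 / (1 / (16 * r)) + 4 * Λ / |ω|)) =
        L ^ 2 * (128 * r + 16 * Λ * |ω|⁻¹) := by
      field_simp
      ring
    rw [e2]
    have h5 : 128 * r + 16 * Λ * |ω|⁻¹ ≤ 2 * CB * r ^ γ := by
      have h6 : 16 * Λ * |ω|⁻¹ ≤ 16 * Λ * r ^ γ := by gcongr
      have h7 : 0 ≤ Λ * r ^ γ := by positivity
      rw [hCB]
      nlinarith
    calc L ^ 2 * (128 * r + 16 * Λ * |ω|⁻¹) ≤ L ^ 2 * (2 * CB * r ^ γ) := by gcongr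
      _ = _ := by ring
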